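/- For a group $G$ let $\omega(G)$ denote the set of orders of its elements; finite groups $G$ and $H$ are isospectral if $\omega(G)=\omega(H)$. A finite nonabelian simple group $L$ is called quasirecognizable by spectrum if every finite group isospectral to $L$ has exactly one nonabelian composition factor (counted with multiplicity) and this factor is isomorphic to $L$. Let $q$ be a power of $2$. Let $Sp_8(q)$ be the symplectic group of degree $8$ over the field of order $q$, let $GO_8^-(q)$ be the group of all linear isometries of a quadratic form of minus type on an $8$-dimensional vector space over this field (that is, a form with nondegenerate polar form and Witt index $3$), and let $\Omega_8^-(q)$ be the derived subgroup of $GO_8^-(q)$. Then $\omega(Sp_8(q))=\omega(GO_8^-(q))$. Moreover, $GO_8^-(q)$ has exactly one nonabelian composition factor, and this factor is isomorphic to $\Omega_8^-(q)$. In particular, $Sp_8(q)$ is not quasirecognizable by spectrum. -/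

import Mathlib

universe u v

/-- The spectrum `ω(G)` of a group `G`: the set of its element orders. -/
def elementOrders (G : Type u) [Group G] : Set ℕ :=
  {n | ∃ g : G, orderOf g = n}

/-- A composition series `1 = G₀ < G₁ < ⋯ < Gₙ = G` of a group `G`: every term is normal in
the next one, with simple quotient. -/
structure GroupCompSeries (G : Type u) [Group G] where
  length : ℕ
  term : Fin (length + 1) → Subgroup G
  bot_eq : term 0 = ⊥
  top_eq : term (Fin.last length) = ⊤
  le_succ : ∀ i : Fin length, term i.castSucc ≤ term i.succ
  normal : ∀ i : Fin length, ((term i.castSucc).subgroupOf (term i.succ)).Normal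
  simple : ∀ i : Fin length,
    haveI := normal i
    IsSimpleGroup (↥(term i.succ) ⧸ (term i.castSucc).subgroupOf (term i.succ))

/-- The `i`-th factor `Gᵢ₊₁ / Gᵢ` of a composition series. -/
abbrev GroupCompSeries.factor {G : Type u} [Group G] (s : GroupCompSeries G)
    (i : Fin s.length) : Type u :=
  ↥(s.term i.succ) ⧸ (s.term i.castSucc).subgroupOf (s.term i.succ)

instance GroupCompSeries.factorGroup {G : Type u} [Group G] (s : GroupCompSeries G)
    (i : Fin s.length) : Group (s.factor i) :=
  haveI := s.normal i
  QuotientGroup.Quotient.group _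

/-- `G` has exactly one nonabelian composition factor (counted with multiplicity), and this
factor is isomorphic to `S`.  By the Jordan–Hölder theorem it does not matter which composition
series of the finite group `G` is used. -/
def HasOnlyNonabelianFactor (G : Type u) [Group G] (S : Type v) [Group S] : Prop :=
  ∃ s : GroupCompSeries G, ∃ i : Fin s.length,
    Nonempty (s.factor i ≃* S) ∧ (¬ ∀ a b : s.factor i, a * b = b * a) ∧
      ∀ j : Fin s.length, j ≠ i → ∀ a b : s.factor j, a * b = b * a

/-- `L` is quasirecognizable by spectrum: every finite group isospectral to `L` has only one
nonabelian composition factor, and this factor is isomorphic to `L`.  (The notion is used for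
finite nonabelian simple groups `L`.) -/
def QuasirecognizableBySpectrum (L : Type u) [Group L] : Prop :=
  ∀ (G : Type u) [Group G] [Finite G],
    elementOrders G = elementOrders L → HasOnlyNonabelianFactor G L

section Orthogonal

variable {K : Type u} {V : Type v} [Field K] [AddCommGroup V] [Module K V]

/-- The general orthogonal group of a quadratic form: all invertible linear maps that
preserve the form. -/
def generalOrthogonalGroup (Q : QuadraticForm K V) : Subgroup (V ≃ₗ[K] V) where
  carrier := {g | ∀ x, Q (g x) = Q x}
  mul_mem' {a b} ha hb x := by
    rw [LinearEquiv.mul_apply, ha (b x), hb x]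
  one_mem' x := rfl
  inv_mem' {a} ha x := by
    have h := ha (a⁻¹ x)
    rw [← LinearEquiv.mul_apply, mul_inv_cancel] at h
    exact h.symm

/-- The group `Ω` of a quadratic form: the derived subgroup of its general orthogonal group. -/
abbrev omegaGroup (Q : QuadraticForm K V) : Subgroup ↥(generalOrthogonalGroup Q) :=
  commutator ↥(generalOrthogonalGroup Q)

/-- A subspace is totally singular if the quadratic form vanishes on it. -/
def IsTotallySingular (Q : QuadraticForm K V) (W : Submodule K V) : Prop :=
  ∀ x ∈ W, Q x = 0

/-- A quadratic form of minus type in dimension `2 * n`: its polar form is nondegenerate and its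
Witt index (the maximal dimension of a totally singular subspace) is `n - 1`. -/
structure IsMinusType (n : ℕ) (Q : QuadraticForm K V) : Prop where
  finrank_eq : Module.finrank K V = 2 * n
  nondegenerate : Q.polarBilin.Nondegenerate
  exists_totallySingular : ∃ W : Submodule K V,
    IsTotallySingular Q W ∧ Module.finrank K W + 1 = n
  finrank_lt : ∀ W : Submodule K V, IsTotallySingular Q W → Module.finrank K W < n

end Orthogonal

/-! Write q for the order of the field K, B for the polar form of Q and ψ for the additive character
of K with kernel {t² + t}. In characteristic two B is alternating, so every isometry of Q is
symplectic; this gives one inclusion of spectra. The type of a nondegenerate form on a space of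
dimension 2n is read off from the sum of ψ(Q x), which is ±q^n, is multiplicative over orthogonal
sums, and determines the form up to isometry (`equivalent_of_gaussSumForm_eq`). Thus element orders
in minus type can be produced on any convenient orthogonal sum whose signs multiply to -1.

For the other inclusion, the eigenvalues of a symplectic matrix form a multiset stable under
inversion and under x ↦ x^q. If m kills all eigenvalues and 2^k bounds their multiplicities,
Cayley–Hamilton makes the order divide m·2^k (`pow_eq_one_of_roots_charpoly`). The ways to cut eight
eigenvalues into orbits are few, and in each some m·2^k divides the order of a block isometry of
minus type (`IsReciprocalMultiset.hasMinusExponent`). The blocks are tori of order q^d + 1 (minus)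
or q^d - 1 (plus) in dimension 2d, and unipotents of order 2, 4, 8 in dimensions 2, 4, 6, which
exist with either sign and so correct the total sign. Spectra are closed under divisors, so this
suffices.

For the composition factors, reflections generate the orthogonal group of minus type
(`reflectionSubgroup_eq_top`) and a product of two reflections lies in the group generated by Siegel
transformations, which therefore has index at most two. That group is perfect and acts primitively
and faithfully on singular points, so Iwasawa's argument makes it simple
(`isSimpleGroup_siegelSubgroup`), and it equals the derived subgroup. Finally, the orthogonal group
has no composition factor isomorphic to the symplectic group: it would then be at least as large as
the symplectic group, in which it embeds properly. -/

set_option linter.unusedSectionVars false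
open QuadraticMap (polar polar_comm polar_smul_left polar_smul_right polar_add_left
  polar_add_right polarBilin_apply_apply)

/-! ### The Artin–Schreier character -/

section ArtinSchreier

variable (K : Type*) [Field K] [CharP K 2]

/-- The additive subgroup `{t ^ 2 + t}` of a field of characteristic two. -/
def artinSchreierImage : AddSubgroup K where
  carrier := {a | ∃ t : K, t ^ 2 + t = a}
  zero_mem' := ⟨0, by simp⟩
  add_mem' := by
    rintro _ _ ⟨s, rfl⟩ ⟨t, rfl⟩
    exact ⟨s + t, by rw [CharTwo.add_sq]; ring⟩
  neg_mem' := by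
    rintro _ ⟨s, rfl⟩
    exact ⟨s, by rw [CharTwo.neg_eq]⟩

/-- The Artin–Schreier map `t ↦ t ^ 2 + t`. -/
def artinSchreierHom : K →+ K where
  toFun t := t ^ 2 + t
  map_zero' := by simp
  map_add' s t := by rw [CharTwo.add_sq]; ring

variable [Finite K]

/-- The additive map t ↦ t² + t has kernel {0, 1}, so its image is half of the field. -/
theorem artinSchreierImage_index : (artinSchreierImage K).index = 2 := by
  have h1 : (artinSchreierHom K).range = artinSchreierImage K := by
    ext a; rfl
  have h2 : Nat.card (artinSchreierHom K).ker = 2 := by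
    have : ((artinSchreierHom K).ker : Set K) = {0, 1} := by
      ext t
      simp only [SetLike.mem_coe, AddMonoidHom.mem_ker, Set.mem_insert_iff, Set.mem_singleton_iff]
      change t ^ 2 + t = 0 ↔ _
      constructor
      · intro h
        have : t * (t + 1) = 0 := by linear_combination h
        rcases mul_eq_zero.1 this with h | h
        · exact Or.inl h
        · right; rwa [CharTwo.add_eq_zero] at h
      · rintro (rfl | rfl)
        · simp
        · simpa using CharTwo.add_self_eq_zero (1 : K)
    rw [← SetLike.coe_sort_coe, this, Nat.card_coe_set_eq, Set.ncard_pair zero_ne_one]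
  have h3 := (artinSchreierHom K).ker.card_mul_index
  rw [AddSubgroup.index_ker, h1, h2] at h3
  have h4 := (artinSchreierImage K).card_mul_index
  have h5 : 0 < Nat.card (artinSchreierImage K) := Nat.card_pos
  rw [← h3] at h4
  nlinarith

open Classical in
/-- The additive character of a finite field of characteristic two with kernel
`{t ^ 2 + t}`. -/
noncomputable def artinSchreierChar : AddChar K ℤ where
  toFun a := if a ∈ artinSchreierImage K then 1 else -1
  map_zero_eq_one' := by simp [zero_mem]
  map_add_eq_mul' a b := by
    have h := AddSubgroup.add_mem_iff_of_index_two (artinSchreierImage_index K) (a := a) (b := b)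
    by_cases ha : a ∈ artinSchreierImage K <;> by_cases hb : b ∈ artinSchreierImage K <;>
      simp [h, ha, hb]

variable {K}

theorem artinSchreierChar_apply_eq_one_iff (a : K) :
    artinSchreierChar K a = 1 ↔ ∃ t : K, t ^ 2 + t = a := by
  classical
  change (if a ∈ artinSchreierImage K then (1 : ℤ) else -1) = 1 ↔ a ∈ artinSchreierImage K
  split_ifs with h <;> simp [h]

theorem artinSchreierChar_eq_or (a : K) :
    artinSchreierChar K a = 1 ∨ artinSchreierChar K a = -1 := by
  classical
  change (if a ∈ artinSchreierImage K then (1 : ℤ) else -1) = 1 ∨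
    (if a ∈ artinSchreierImage K then (1 : ℤ) else -1) = -1
  split_ifs with h <;> simp

theorem artinSchreierChar_mul_self (a : K) :
    artinSchreierChar K a * artinSchreierChar K a = 1 := by
  rcases artinSchreierChar_eq_or a with h | h <;> simp [h]

theorem artinSchreierChar_sq (a : K) : artinSchreierChar K (a ^ 2) = artinSchreierChar K a := by
  have h : artinSchreierChar K (a ^ 2 + a) = 1 :=
    (artinSchreierChar_apply_eq_one_iff _).2 ⟨a, rfl⟩
  rw [AddChar.map_add_eq_mul] at h
  rcases artinSchreierChar_eq_or a with h' | h' <;> rw [h'] at h ⊢ <;> linarith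

theorem exists_artinSchreierChar_eq_neg_one : ∃ c : K, artinSchreierChar K c = -1 := by
  by_contra! h
  have h1 : ∀ a, a ∈ artinSchreierImage K := fun a =>
    (artinSchreierChar_apply_eq_one_iff a).1 ((artinSchreierChar_eq_or a).resolve_right (h a))
  have h2 := artinSchreierImage_index K
  rw [(AddSubgroup.eq_top_iff' _).2 h1, AddSubgroup.index_top] at h2
  omega

theorem exists_artinSchreierChar_eq {ε : ℤ} (hε : ε = 1 ∨ ε = -1) :
    ∃ c : K, artinSchreierChar K c = ε := by
  rcases hε with rfl | rfl
  · exact ⟨0, by simp⟩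
  · exact exists_artinSchreierChar_eq_neg_one

open Classical in
-- Orthogonality of characters: a nonzero functional takes every value, in particular one where ψ =
-- -1, so composing it with ψ gives a nontrivial character.
theorem sum_artinSchreierChar_comp_linearMap {V : Type*} [AddCommGroup V] [Module K V] [Fintype V]
    (f : V →ₗ[K] K) :
    ∑ x, artinSchreierChar K (f x) = if f = 0 then (Fintype.card V : ℤ) else 0 := by
  split_ifs with h
  · simp [h]
  · let ψ : AddChar V ℤ := (artinSchreierChar K).compAddMonoidHom f.toAddMonoidHom
    have : ψ ≠ 0 := by
      intro h0
      obtain ⟨c, hc⟩ := exists_artinSchreierChar_eq_neg_one (K := K)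
      obtain ⟨v, hv⟩ : ∃ v, f v ≠ 0 := by
        by_contra! h1
        exact h (LinearMap.ext h1)
      have h2 : ψ ((c * (f v)⁻¹) • v) = 1 := by rw [h0]; rfl
      have h3 : ψ ((c * (f v)⁻¹) • v) = artinSchreierChar K c := by
        change artinSchreierChar K (f _) = _
        rw [map_smul, smul_eq_mul, mul_assoc, inv_mul_cancel₀ hv, mul_one]
      rw [h3, hc] at h2
      omega
    exact AddChar.sum_eq_zero_iff_ne_zero.2 this

theorem exists_sq_eq (a : K) : ∃ b : K, b ^ 2 = a := by
  have : Function.Injective (fun b : K => b ^ 2) := fun a b h => CharTwo.sq_injective h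
  exact (Finite.injective_iff_surjective.1 this) a

end ArtinSchreier

/-! ### Character sums of quadratic forms -/

section GaussSum

variable {K : Type*} [Field K] {V : Type*} [AddCommGroup V] [Module K V]

/-- The polar form of `Q` has trivial radical. -/
def PolarSeparating (Q : QuadraticForm K V) : Prop :=
  ∀ x, (∀ y, polar Q x y = 0) → x = 0

theorem polarSeparating_iff_nondegenerate (Q : QuadraticForm K V) :
    PolarSeparating Q ↔ Q.polarBilin.Nondegenerate := by
  constructor
  · intro h
    refine ⟨fun x hx => h x hx, fun x hx => h x fun y => ?_⟩
    rw [polar_comm]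
    exact hx y
  · intro h x hx
    exact h.1 x hx

theorem PolarSeparating.exists_polar_ne_zero {Q : QuadraticForm K V} (h : PolarSeparating Q)
    {x : V} (hx : x ≠ 0) : ∃ y, polar Q x y ≠ 0 := by
  by_contra! h'
  exact hx (h x h')

theorem PolarSeparating.exists_polar_eq_one {Q : QuadraticForm K V} (h : PolarSeparating Q)
    {x : V} (hx : x ≠ 0) : ∃ y, polar Q x y = 1 := by
  obtain ⟨y, hy⟩ := h.exists_polar_ne_zero hx
  exact ⟨(polar Q x y)⁻¹ • y, by rw [polar_smul_right, smul_eq_mul, inv_mul_cancel₀ hy]⟩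

theorem PolarSeparating.of_equiv {V' : Type*} [AddCommGroup V'] [Module K V']
    {Q : QuadraticForm K V} {Q' : QuadraticForm K V'} (e : Q.IsometryEquiv Q')
    (h : PolarSeparating Q) : PolarSeparating Q' := by
  intro x hx
  have h1 : ∀ a b, polar Q' (e a) (e b) = polar Q a b := by
    intro a b
    simp only [polar, ← map_add, QuadraticMap.IsometryEquiv.map_app]
  have h2 := h (e.symm x) fun y => by
    rw [← h1]
    have : e (e.symm x) = x := e.toLinearEquiv.apply_symm_apply x
    rw [this]
    exact hx _
  have : e (e.symm x) = x := e.toLinearEquiv.apply_symm_apply x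
  rw [← this, h2]
  exact map_zero e.toLinearEquiv

theorem PolarSeparating.prod {V' : Type*} [AddCommGroup V'] [Module K V']
    {Q : QuadraticForm K V} {Q' : QuadraticForm K V'}
    (h : PolarSeparating Q) (h' : PolarSeparating Q') : PolarSeparating (Q.prod Q') := by
  intro x hx
  refine Prod.ext (h _ fun y => ?_) (h' _ fun y => ?_)
  · simpa using hx (y, 0)
  · simpa using hx (0, y)

theorem PolarSeparating.of_prod_right {V' : Type*} [AddCommGroup V'] [Module K V']
    {Q : QuadraticForm K V} {Q' : QuadraticForm K V'}
    (h : PolarSeparating (Q.prod Q')) : PolarSeparating Q' := by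
  intro x hx
  have := h (0, x) fun y => by simp [hx]
  exact congrArg Prod.snd this

theorem form_add (Q : QuadraticForm K V) (x y : V) : Q (x + y) = Q x + Q y + polar Q x y := by
  simp only [polar]; ring

theorem polar_self_eq_zero [CharP K 2] (Q : QuadraticForm K V) (x : V) : polar Q x x = 0 := by
  rw [QuadraticMap.polar_self, two_smul, CharTwo.add_self_eq_zero]

variable [CharP K 2] [Finite K]

/-- The character sum of a quadratic form. -/
noncomputable def gaussSumForm (Q : QuadraticForm K V) : ℤ :=
  ∑ᶠ x, artinSchreierChar K (Q x)

theorem gaussSumForm_eq_sum [Fintype V] (Q : QuadraticForm K V) :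
    gaussSumForm Q = ∑ x, artinSchreierChar K (Q x) :=
  finsum_eq_sum_of_fintype _

theorem gaussSumForm_congr {V' : Type*} [AddCommGroup V'] [Module K V']
    {Q : QuadraticForm K V} {Q' : QuadraticForm K V'} (e : Q.IsometryEquiv Q') :
    gaussSumForm Q = gaussSumForm Q' := by
  refine finsum_eq_of_bijective e e.toLinearEquiv.bijective fun x => ?_
  rw [QuadraticMap.IsometryEquiv.map_app]

theorem gaussSumForm_prod {V' : Type*} [AddCommGroup V'] [Module K V'] [Finite V] [Finite V']
    (Q : QuadraticForm K V) (Q' : QuadraticForm K V') :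
    gaussSumForm (Q.prod Q') = gaussSumForm Q * gaussSumForm Q' := by
  cases nonempty_fintype V
  cases nonempty_fintype V'
  rw [gaussSumForm_eq_sum, gaussSumForm_eq_sum, gaussSumForm_eq_sum, Fintype.sum_prod_type,
    Finset.sum_mul_sum]
  simp [AddChar.map_add_eq_mul]

/-- Substituting y = x + d in the double sum cancels ψ(Q x)² = 1 and leaves ψ(Q d) ψ(B(d, x)).
Summing over x kills every d except d = 0. -/
theorem gaussSumForm_mul_self [Finite V] {Q : QuadraticForm K V} (hQ : PolarSeparating Q) :
    gaussSumForm Q * gaussSumForm Q = Nat.card V := by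
  classical
  cases nonempty_fintype V
  rw [gaussSumForm_eq_sum, Finset.sum_mul_sum]
  have h1 : ∀ x : V, ∑ y, artinSchreierChar K (Q x) * artinSchreierChar K (Q y) =
      ∑ d, artinSchreierChar K (Q d) * artinSchreierChar K (Q.polarBilin d x) := by
    intro x
    rw [← Equiv.sum_comp (Equiv.addLeft x)]
    refine Finset.sum_congr rfl fun d _ => ?_
    rw [Equiv.coe_addLeft, form_add, AddChar.map_add_eq_mul, AddChar.map_add_eq_mul,
      ← mul_assoc, ← mul_assoc, artinSchreierChar_mul_self, one_mul, polarBilin_apply_apply,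
      polar_comm]
  simp_rw [h1]
  rw [Finset.sum_comm]
  simp_rw [← Finset.mul_sum, sum_artinSchreierChar_comp_linearMap]
  rw [Finset.sum_eq_single 0]
  · simp
  · intro d _ hd
    rw [if_neg, mul_zero]
    intro h
    exact hd (hQ d fun y => by rw [← polarBilin_apply_apply, h]; rfl)
  · simp

/-- The condition Q x = 0 is detected by summing ψ(t Q x) over t. Every nonzero t is a square s²,
and rescaling x by s shows that it contributes the same sum as t = 1. -/
theorem card_mul_card_singular [Finite V] (Q : QuadraticForm K V) :
    (Nat.card K : ℤ) * Nat.card {x : V // Q x = 0} =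
      Nat.card V + (Nat.card K - 1) * gaussSumForm Q := by
  classical
  cases nonempty_fintype V
  cases nonempty_fintype K
  have h1 : ∀ x : V, ∑ t : K, artinSchreierChar K (t * Q x) =
      if Q x = 0 then (Fintype.card K : ℤ) else 0 := by
    intro x
    have := sum_artinSchreierChar_comp_linearMap (K := K) (V := K) (LinearMap.mulRight K (Q x))
    simp only [LinearMap.mulRight_apply] at this
    rw [this]
    congr 1
    simp only [eq_iff_iff]
    constructor
    · intro h; simpa using LinearMap.congr_fun h 1
    · intro h; ext; simp [h]
  have h2 : ∀ t : K, ∑ x, artinSchreierChar K (t * Q x) =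
      if t = 0 then (Fintype.card V : ℤ) else gaussSumForm Q := by
    intro t
    split_ifs with ht
    · simp [ht]
    · obtain ⟨s, rfl⟩ := exists_sq_eq t
      have hs : s ≠ 0 := fun h => ht (by simp [h])
      rw [gaussSumForm_eq_sum]
      refine Equiv.sum_comp (LinearEquiv.smulOfNeZero K V s hs).toEquiv
        (fun x => artinSchreierChar K (Q x)) ▸ Finset.sum_congr rfl fun x _ => ?_
      simp [QuadraticMap.map_smul, pow_two]
  have h3 : ∑ x : V, ∑ t : K, artinSchreierChar K (t * Q x) =
    ∑ t : K, ∑ x, artinSchreierChar K (t * Q x) := Finset.sum_comm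
  simp_rw [h1, h2] at h3
  have h5 : ∀ t : K, (if t = 0 then (Fintype.card V : ℤ) else gaussSumForm Q) =
      (if t = 0 then (Fintype.card V : ℤ) - gaussSumForm Q else 0) + gaussSumForm Q := by
    intro t
    split_ifs <;> ring
  simp_rw [h5, Finset.sum_add_distrib] at h3
  rw [← Finset.sum_filter, Finset.sum_const, Finset.sum_const, Finset.card_univ,
    Finset.sum_ite_eq' Finset.univ (0 : K) fun _ => (Fintype.card V : ℤ) - gaussSumForm Q,
    if_pos (Finset.mem_univ _)] at h3
  simp only [Nat.card_eq_fintype_card, Fintype.card_subtype]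
  simp only [nsmul_eq_mul] at h3
  linarith

theorem gaussSumForm_eq_or [Finite V] {Q : QuadraticForm K V} (hQ : PolarSeparating Q) {n : ℕ}
    (hn : Module.finrank K V = 2 * n) :
    gaussSumForm Q = Nat.card K ^ n ∨ gaussSumForm Q = -Nat.card K ^ n := by
  have h := gaussSumForm_mul_self hQ
  rw [Module.natCard_eq_pow_finrank (K := K) (V := V), hn] at h
  rw [← sq_eq_sq_iff_eq_or_eq_neg]
  push_cast at h
  rw [pow_two, h]; ring

/-- If zero were the only singular vector, the count would read q = q^(2n) ± (q - 1) q^n. The only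
solution with n ≥ 1 is n = 1 with the minus sign, the anisotropic plane, which the hypothesis
excludes. -/
theorem exists_singular [Finite V] {Q : QuadraticForm K V} (hQ : PolarSeparating Q) {n : ℕ}
    (hn : Module.finrank K V = 2 * n) (h : 2 ≤ n ∨ (1 ≤ n ∧ 0 < gaussSumForm Q)) :
    ∃ x, x ≠ 0 ∧ Q x = 0 := by
  by_contra! h'
  have h1 : Nat.card {x : V // Q x = 0} = 1 := by
    rw [Nat.card_eq_one_iff_unique]
    refine ⟨⟨fun a b => Subtype.ext ?_⟩, ⟨⟨0, map_zero Q⟩⟩⟩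
    have : ∀ c : {x : V // Q x = 0}, c.1 = 0 := fun c => by_contra fun hc => h' _ hc c.2
    rw [this a, this b]
  have h2 := card_mul_card_singular Q
  rw [h1, Module.natCard_eq_pow_finrank (K := K) (V := V), hn] at h2
  push_cast at h2
  have hq : (2 : ℤ) ≤ Nat.card K := by exact_mod_cast Finite.one_lt_card (α := K)
  generalize hqq : (Nat.card K : ℤ) = q at *
  have hG := gaussSumForm_eq_or hQ hn
  rw [hqq] at hG
  have hp : q ^ (2 * n) = q ^ n * q ^ n := by ring
  have hle : q ≤ q ^ n := by
    have : 1 ≤ n := by omega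
    calc q = q ^ 1 := (pow_one q).symm
      _ ≤ q ^ n := pow_le_pow_right₀ (by linarith) this
  rcases h with h | ⟨h, hpos⟩
  · have h4 : q * q ≤ q ^ n := by
      calc q * q = q ^ 2 := (pow_two q).symm
        _ ≤ q ^ n := pow_le_pow_right₀ (by linarith) h
    have h5 : -(q^n) ≤ gaussSumForm Q := by rcases hG with hG | hG <;> nlinarith
    nlinarith
  · have h5 : gaussSumForm Q = q ^ n := by
      rcases hG with hG | hG
      · exact hG
      · nlinarith
    rw [h5] at h2
    nlinarith

/-- Average the sum over translates by W. For fixed v the sum over W vanishes unless v is orthogonal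
to W, and then every term is 1; the vector v = 0 makes the total strictly positive. -/
theorem gaussSumForm_pos_of_isTotallySingular [FiniteDimensional K V] {Q : QuadraticForm K V}
    (hQ : PolarSeparating Q)
    {n : ℕ} (hn : Module.finrank K V = 2 * n) (W : Submodule K V) (hW : IsTotallySingular Q W)
    (hWn : n ≤ Module.finrank K W) : 0 < gaussSumForm Q := by
  classical
  have : Finite V := Module.finite_of_finite K
  cases nonempty_fintype V
  have hnd := (polarSeparating_iff_nondegenerate Q).1 hQ
  -- W lies in its orthogonal complement, whose dimension is at most n, so the two coincide and
  -- every vector orthogonal to W is singular.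
  have hperp : ∀ v, (∀ w ∈ W, polar Q v w = 0) → Q v = 0 := by
    set W' := LinearMap.BilinForm.orthogonal Q.polarBilin W with hW'
    have hle : W ≤ W' := by
      intro x hx
      rw [hW', LinearMap.BilinForm.mem_orthogonal_iff]
      intro y hy
      have := hW _ (W.add_mem hy hx)
      rw [form_add, hW _ hy, hW _ hx] at this
      simpa using this
    have hfin := LinearMap.BilinForm.finrank_orthogonal hnd W
    have : W = W' := Submodule.eq_of_le_of_finrank_le hle (by rw [hfin]; omega)
    intro v hv
    apply hW
    rw [this, hW', LinearMap.BilinForm.mem_orthogonal_iff]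
    intro y hy
    change polar Q y v = 0
    rw [polar_comm, hv y hy]
  have h1 : ∑ w : W, ∑ v, artinSchreierChar K (Q (v + w)) = Fintype.card W * gaussSumForm Q := by
    have : ∀ w : W, ∑ v, artinSchreierChar K (Q (v + w)) = gaussSumForm Q := by
      intro w
      rw [gaussSumForm_eq_sum]
      exact Equiv.sum_comp (Equiv.addRight (w : V)) (fun v => artinSchreierChar K (Q v))
    simp [this]
  rw [Finset.sum_comm] at h1
  have h2 : ∀ v : V, ∑ w : W, artinSchreierChar K (Q (v + w)) =
      if (Q.polarBilin v).comp W.subtype = 0 then (Fintype.card W : ℤ) else 0 := by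
    intro v
    have : ∀ w : W, artinSchreierChar K (Q (v + w)) =
        artinSchreierChar K (Q v) * artinSchreierChar K ((Q.polarBilin v).comp W.subtype w) := by
      intro w
      rw [form_add, hW w.1 w.2, add_zero, AddChar.map_add_eq_mul]
      rfl
    simp_rw [this]
    rw [← Finset.mul_sum, sum_artinSchreierChar_comp_linearMap]
    split_ifs with h
    · rw [hperp v fun w hw => by simpa using LinearMap.congr_fun h ⟨w, hw⟩]
      simp
    · simp
  simp_rw [h2] at h1
  have hc : 0 < (Fintype.card W : ℤ) := by exact_mod_cast Fintype.card_pos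
  have h3 : 0 < ∑ v : V, if (Q.polarBilin v).comp W.subtype = 0 then (Fintype.card W : ℤ) else 0 := by
    apply Finset.sum_pos'
    · intro v _
      split_ifs <;> omega
    · refine ⟨0, Finset.mem_univ _, ?_⟩
      rw [if_pos (by simp)]
      exact hc
  rw [h1] at h3
  exact pos_of_mul_pos_right h3 hc.le

end GaussSum

/-! ### Binary quadratic forms -/

section Plane

variable {K : Type*} [Field K]

/-- The binary quadratic form `a x ^ 2 + x y + c y ^ 2`. -/
noncomputable def planeForm (a c : K) : QuadraticForm K (K × K) :=
  a • QuadraticMap.linMulLin (LinearMap.fst K K K) (LinearMap.fst K K K) +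
    QuadraticMap.linMulLin (LinearMap.fst K K K) (LinearMap.snd K K K) +
    c • QuadraticMap.linMulLin (LinearMap.snd K K K) (LinearMap.snd K K K)

theorem planeForm_apply (a c : K) (x : K × K) :
    planeForm a c x = a * (x.1 * x.1) + x.1 * x.2 + c * (x.2 * x.2) := by
  simp [planeForm]

variable [CharP K 2]

theorem polar_planeForm (a c : K) (x y : K × K) :
    polar (planeForm a c) x y = x.1 * y.2 + x.2 * y.1 := by
  simp only [polar, planeForm_apply, Prod.fst_add, Prod.snd_add]
  linear_combination (a * x.1 * y.1 + c * x.2 * y.2) * CharTwo.two_eq_zero (R := K)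

theorem polarSeparating_planeForm (a c : K) : PolarSeparating (planeForm a c) := by
  intro x hx
  have h1 := hx (1, 0)
  have h2 := hx (0, 1)
  simp only [polar_planeForm] at h1 h2
  ext
  · simpa using h2
  · simpa using h1

variable [Finite K]

/-- Since ψ(x²) = ψ(x), the value ψ(x² + xy) equals ψ(x(1 + y)), a character in x. Only y = 1
survives the summation over x. -/
theorem gaussSumForm_planeForm_one (c : K) :
    gaussSumForm (planeForm 1 c) = artinSchreierChar K c * Nat.card K := by
  classical
  cases nonempty_fintype K
  rw [gaussSumForm_eq_sum, Fintype.sum_prod_type, Finset.sum_comm]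
  have h : ∀ y : K, ∑ x : K, artinSchreierChar K (planeForm 1 c (x, y)) =
      if y = 1 then artinSchreierChar K c * Nat.card K else 0 := by
    intro y
    have h1 : ∀ x : K, artinSchreierChar K (planeForm 1 c (x, y)) =
        artinSchreierChar K (c * (y * y)) *
          artinSchreierChar K (LinearMap.mulRight K (1 + y) x) := by
      intro x
      rw [planeForm_apply, AddChar.map_add_eq_mul, AddChar.map_add_eq_mul, one_mul, ← pow_two,
        artinSchreierChar_sq, LinearMap.mulRight_apply, mul_add, mul_one, AddChar.map_add_eq_mul]
      ring
    simp_rw [h1]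
    rw [← Finset.mul_sum, sum_artinSchreierChar_comp_linearMap]
    by_cases hy : y = 1
    · subst hy
      rw [if_pos, if_pos rfl]
      · simp
      · ext; simp [CharTwo.add_self_eq_zero]
    · rw [if_neg, if_neg hy, mul_zero]
      intro h
      apply hy
      have := LinearMap.congr_fun h 1
      simp only [LinearMap.mulRight_apply, one_mul, LinearMap.zero_apply] at this
      exact (CharTwo.add_eq_zero.1 this).symm
  simp_rw [h]
  simp

/-- The substitution `x ↦ x + t y` changes the constant of a binary form by `t ^ 2 + t`. -/
noncomputable def planeFormShift (c t : K) :
    (planeForm 1 (c + (t ^ 2 + t))).IsometryEquiv (planeForm 1 c) where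
  toFun x := (x.1 + t * x.2, x.2)
  map_add' x y := by ext <;> simp; ring
  map_smul' r x := by ext <;> simp; ring
  invFun x := (x.1 - t * x.2, x.2)
  left_inv x := by simp
  right_inv x := by simp
  map_app' x := by
    simp only [planeForm_apply]
    linear_combination (t * x.1 * x.2) * CharTwo.two_eq_zero (R := K)

/-- Constants with the same character value differ by some t² + t, which the shift absorbs. -/
theorem planeForm_equivalent {c c' : K} (h : artinSchreierChar K c = artinSchreierChar K c') :
    (planeForm 1 c).Equivalent (planeForm 1 c') := by
  have h1 : artinSchreierChar K (c + c') = 1 := by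
    rw [AddChar.map_add_eq_mul, h, artinSchreierChar_mul_self]
  obtain ⟨t, ht⟩ := (artinSchreierChar_apply_eq_one_iff _).1 h1
  have : c' + (t ^ 2 + t) = c := by
    rw [ht]; linear_combination c' * CharTwo.two_eq_zero (R := K)
  rw [← this]
  exact ⟨planeFormShift c' t⟩

end Plane

/-! ### Splitting off planes and the classification of forms -/

section Splitting

variable {K : Type*} [Field K] {V : Type*} [AddCommGroup V] [Module K V]

/-- The orthogonal complement of two vectors. -/
def pairOrthogonal (Q : QuadraticForm K V) (e f : V) : Submodule K V :=
  LinearMap.ker (Q.polarBilin e) ⊓ LinearMap.ker (Q.polarBilin f)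

theorem mem_pairOrthogonal {Q : QuadraticForm K V} {e f v : V} :
    v ∈ pairOrthogonal Q e f ↔ polar Q e v = 0 ∧ polar Q f v = 0 := Iff.rfl

/-- The restriction of a quadratic form to a subspace. -/
noncomputable abbrev restrictForm (Q : QuadraticForm K V) (W : Submodule K V) :
    QuadraticForm K W :=
  Q.comp W.subtype

variable [CharP K 2]

/-- Splitting off a plane on which the polar form is nondegenerate. -/
noncomputable def planeSplitting (Q : QuadraticForm K V) {e f : V} (hef : polar Q e f = 1) :
    ((planeForm (Q e) (Q f)).prod (restrictForm Q (pairOrthogonal Q e f))).IsometryEquiv Q where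
  toFun x := x.1.1 • e + x.1.2 • f + x.2
  map_add' x y := by
    simp only [Prod.fst_add, Prod.snd_add, add_smul, Submodule.coe_add]; abel
  map_smul' r x := by
    simp only [Prod.smul_fst, Prod.smul_snd, smul_add, smul_smul, smul_eq_mul,
      Submodule.coe_smul, RingHom.id_apply]
  invFun v := ((polar Q f v, polar Q e v), ⟨v - (polar Q f v • e + polar Q e v • f), by
    have hfe : polar Q f e = 1 := by rw [polar_comm, hef]
    rw [mem_pairOrthogonal]
    constructor <;>
      simp [QuadraticMap.polar_sub_right, polar_add_right, polar_smul_right, hef, hfe,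
        CharTwo.two_eq_zero (R := K)]⟩)
  left_inv := by
    rintro ⟨⟨a, b⟩, ⟨w, hw⟩⟩
    have hfe : polar Q f e = 1 := by rw [polar_comm, hef]
    rw [mem_pairOrthogonal] at hw
    have h1 : polar Q f (a • e + b • f + w) = a := by
      simp [polar_add_right, polar_smul_right, hfe, CharTwo.two_eq_zero (R := K), hw.2]
    have h2 : polar Q e (a • e + b • f + w) = b := by
      simp [polar_add_right, polar_smul_right, hef, CharTwo.two_eq_zero (R := K), hw.1]
    ext
    · exact h1
    · exact h2
    · simp only [h1, h2]
      abel
  right_inv v := by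
    simp
  map_app' := by
    rintro ⟨⟨a, b⟩, ⟨w, hw⟩⟩
    rw [mem_pairOrthogonal] at hw
    have h1 : polar Q (a • e + b • f) w = 0 := by
      simp [polar_add_left, polar_smul_left, hw.1, hw.2]
    have h2 : polar Q (a • e) (b • f) = a * b := by
      simp [polar_smul_left, polar_smul_right, hef, mul_comm]
    simp only [form_add, h1, h2, QuadraticMap.map_smul, smul_eq_mul, QuadraticMap.prod_apply,
      planeForm_apply, QuadraticMap.comp_apply, Submodule.subtype_apply]
    ring

theorem finrank_pairOrthogonal [FiniteDimensional K V] (Q : QuadraticForm K V) {e f : V}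
    (hef : polar Q e f = 1) :
    Module.finrank K V = 2 + Module.finrank K (pairOrthogonal Q e f) := by
  rw [← (planeSplitting Q hef).toLinearEquiv.finrank_eq, Module.finrank_prod, Module.finrank_prod,
    Module.finrank_self]

theorem polarSeparating_pairOrthogonal {Q : QuadraticForm K V} (hQ : PolarSeparating Q) {e f : V}
    (hef : polar Q e f = 1) : PolarSeparating (restrictForm Q (pairOrthogonal Q e f)) :=
  (PolarSeparating.of_equiv (planeSplitting Q hef).symm hQ).of_prod_right

/-- If B(e, f) = 1, adding Q(f)e to f changes the value Q(f) by Q(f)B(f, e) = Q(f), hence to zero,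
and does not change B(e, f). -/
theorem exists_hyperbolic_partner {Q : QuadraticForm K V} (hQ : PolarSeparating Q) {e : V}
    (he : e ≠ 0) (hqe : Q e = 0) : ∃ f, Q f = 0 ∧ polar Q e f = 1 := by
  obtain ⟨f, hf⟩ := hQ.exists_polar_eq_one he
  refine ⟨f + Q f • e, ?_, ?_⟩
  · rw [form_add, QuadraticMap.map_smul, hqe, polar_smul_right, polar_comm, hf]
    simp [CharTwo.add_self_eq_zero]
  · rw [polar_add_right, hf, polar_smul_right, polar_self_eq_zero]; simp

theorem equivalent_of_finrank_eq_zero {V' : Type*} [AddCommGroup V'] [Module K V']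
    [FiniteDimensional K V] [FiniteDimensional K V']
    (Q : QuadraticForm K V) (Q' : QuadraticForm K V')
    (h : Module.finrank K V = 0) (h' : Module.finrank K V' = 0) : Q.Equivalent Q' := by
  have : Subsingleton V := Module.finrank_zero_iff.1 h
  have : Subsingleton V' := Module.finrank_zero_iff.1 h'
  exact ⟨{ LinearEquiv.ofFinrankEq V V' (h.trans h'.symm) with
    map_app' := fun x => by
      rw [Subsingleton.elim x 0]
      simp [Subsingleton.elim _ (0 : V')] }⟩

variable [Finite K]

theorem gaussSumForm_planeForm_zero : gaussSumForm (planeForm (0 : K) 0) = Nat.card K := by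
  have hfr : Module.finrank K (K × K) = 2 * 1 := by simp [Module.finrank_prod]
  have h := gaussSumForm_eq_or (polarSeparating_planeForm (0 : K) 0) hfr
  have h2 := gaussSumForm_pos_of_isTotallySingular (polarSeparating_planeForm (0 : K) 0) hfr
    (K ∙ ((1, 0) : K × K))
    (by
      intro x hx
      obtain ⟨a, rfl⟩ := Submodule.mem_span_singleton.1 hx
      simp [planeForm_apply])
    (by rw [finrank_span_singleton (by simp)])
  have : (0 : ℤ) < Nat.card K := by exact_mod_cast Nat.card_pos
  rcases h with h | h
  · simpa using h
  · rw [h] at h2; simp at h2; omega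

/-- A nondegenerate form of dimension at least four, or of plus type, splits off a hyperbolic
plane. -/
theorem exists_hyperbolic_pair [FiniteDimensional K V] {Q : QuadraticForm K V}
    (hQ : PolarSeparating Q) {n : ℕ}
    (hn : Module.finrank K V = 2 * n) (h : 2 ≤ n ∨ (1 ≤ n ∧ 0 < gaussSumForm Q)) :
    ∃ e f, Q e = 0 ∧ Q f = 0 ∧ polar Q e f = 1 := by
  have : Finite V := Module.finite_of_finite K
  obtain ⟨e, he, hqe⟩ := exists_singular hQ hn h
  obtain ⟨f, hf, hef⟩ := exists_hyperbolic_partner hQ he hqe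
  exact ⟨e, f, hqe, hf, hef⟩

theorem gaussSumForm_pairOrthogonal [FiniteDimensional K V] {Q : QuadraticForm K V} {e f : V}
    (he : Q e = 0) (hf : Q f = 0) (hef : polar Q e f = 1) :
    gaussSumForm Q = Nat.card K * gaussSumForm (restrictForm Q (pairOrthogonal Q e f)) := by
  have : Finite V := Module.finite_of_finite K
  rw [← gaussSumForm_congr (planeSplitting Q hef), gaussSumForm_prod, he, hf,
    gaussSumForm_planeForm_zero]

/-- A nondegenerate binary form is `x ^ 2 + x y + c y ^ 2`. -/
theorem exists_equivalent_planeForm [FiniteDimensional K V] {Q : QuadraticForm K V}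
    (hQ : PolarSeparating Q) (hn : Module.finrank K V = 2) :
    ∃ c, (planeForm 1 c).Equivalent Q := by
  obtain ⟨v, hv⟩ : ∃ v, Q v ≠ 0 := by
    by_contra! h
    have : Nontrivial V := Module.nontrivial_of_finrank_pos (R := K) (by omega)
    obtain ⟨x, hx⟩ := exists_ne (0 : V)
    exact hx (hQ x fun y => by simp [polar, h])
  obtain ⟨b, hb⟩ := exists_sq_eq (Q v)
  have hb0 : b ≠ 0 := by rintro rfl; exact hv (by simp [← hb])
  have h1 : Q (b⁻¹ • v) = 1 := by
    rw [QuadraticMap.map_smul, ← hb, smul_eq_mul]; field_simp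
  have h0 : b⁻¹ • v ≠ 0 := by intro h; rw [h, map_zero] at h1; exact zero_ne_one h1
  obtain ⟨w, hw⟩ := hQ.exists_polar_eq_one h0
  have h2 := planeSplitting Q hw
  rw [h1] at h2
  have h3 := finrank_pairOrthogonal Q hw
  have h4 : Subsingleton (pairOrthogonal Q (b⁻¹ • v) w) :=
    Module.finrank_zero_iff (R := K).1 (by omega)
  refine ⟨Q w, ⟨QuadraticMap.IsometryEquiv.trans ?_ h2⟩⟩
  exact
    { toFun := fun x => (x, 0)
      map_add' := fun x y => by simp
      map_smul' := fun r x => by simp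
      invFun := fun x => x.1
      left_inv := fun x => rfl
      right_inv := fun x => Prod.ext rfl (Subsingleton.elim _ _)
      map_app' := fun x => by simp }

/-- Nondegenerate quadratic forms of the same even dimension over a finite field of
characteristic two are classified by their character sums. -/
theorem equivalent_of_gaussSumForm_eq (n : ℕ) :
    ∀ {V : Type*} [AddCommGroup V] [Module K V] [FiniteDimensional K V]
      {V' : Type*} [AddCommGroup V'] [Module K V'] [FiniteDimensional K V']
      {Q : QuadraticForm K V} {Q' : QuadraticForm K V'},
      PolarSeparating Q → PolarSeparating Q' → Module.finrank K V = 2 * n →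
      Module.finrank K V' = 2 * n → gaussSumForm Q = gaussSumForm Q' → Q.Equivalent Q' := by
  induction n with
  | zero =>
    intro V _ _ _ V' _ _ _ Q Q' _ _ hn hn' _
    exact equivalent_of_finrank_eq_zero Q Q' hn hn'
  | succ n ih =>
    intro V _ _ _ V' _ _ _ Q Q' hQ hQ' hn hn' hG
    have hq : (0 : ℤ) < Nat.card K := by exact_mod_cast Nat.card_pos
    have : Finite V := Module.finite_of_finite K
    -- Hyperbolic planes are cancelled from both forms as long as a singular vector is guaranteed.
    -- What is left is a plane of nonpositive sum, where the constants c are compared through ψ.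
    by_cases h : 2 ≤ n + 1 ∨ (1 ≤ n + 1 ∧ 0 < gaussSumForm Q)
    · obtain ⟨e, f, he, hf, hef⟩ := exists_hyperbolic_pair hQ hn h
      obtain ⟨e', f', he', hf', hef'⟩ := exists_hyperbolic_pair hQ' hn' (by rwa [← hG])
      have h1 := ih (polarSeparating_pairOrthogonal hQ hef) (polarSeparating_pairOrthogonal hQ' hef')
        (by have := finrank_pairOrthogonal Q hef; omega)
        (by have := finrank_pairOrthogonal Q' hef'; omega)
        (by
          rw [gaussSumForm_pairOrthogonal he hf hef, gaussSumForm_pairOrthogonal he' hf' hef'] at hG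
          exact mul_left_cancel₀ hq.ne' hG)
      have h2 := planeSplitting Q hef
      have h2' := planeSplitting Q' hef'
      rw [he, hf] at h2
      rw [he', hf'] at h2'
      obtain ⟨i⟩ := h1
      exact ⟨(h2.symm.trans ((QuadraticMap.IsometryEquiv.refl _).prod i)).trans h2'⟩
    · obtain rfl : n = 0 := by omega
      obtain ⟨c, ⟨i⟩⟩ := exists_equivalent_planeForm hQ hn
      obtain ⟨c', ⟨i'⟩⟩ := exists_equivalent_planeForm hQ' hn'
      have : artinSchreierChar K c = artinSchreierChar K c' := by
        rw [← gaussSumForm_congr i, ← gaussSumForm_congr i', gaussSumForm_planeForm_one,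
          gaussSumForm_planeForm_one] at hG
        exact mul_right_cancel₀ hq.ne' hG
      obtain ⟨j⟩ := planeForm_equivalent this
      exact ⟨(i.symm.trans j).trans i'⟩

end Splitting

/-! ### Element orders of orthogonal groups -/

section Orders

variable {K : Type*} [Field K] {V : Type*} [AddCommGroup V] [Module K V]
  {V' : Type*} [AddCommGroup V'] [Module K V']

/-- An isometry of quadratic spaces induces an isomorphism of their orthogonal groups. -/
def generalOrthogonalGroupCongr {Q : QuadraticForm K V} {Q' : QuadraticForm K V'}
    (e : Q.IsometryEquiv Q') : generalOrthogonalGroup Q ≃* generalOrthogonalGroup Q' where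
  toFun g := ⟨(e.toLinearEquiv.symm.trans g.1).trans e.toLinearEquiv, fun x => by
    change Q' (e (g.1 (e.symm x))) = Q' x
    rw [QuadraticMap.IsometryEquiv.map_app, g.2, QuadraticMap.IsometryEquiv.map_app]⟩
  invFun g := ⟨(e.toLinearEquiv.trans g.1).trans e.toLinearEquiv.symm, fun x => by
    change Q (e.symm (g.1 (e x))) = Q x
    rw [QuadraticMap.IsometryEquiv.map_app, g.2, QuadraticMap.IsometryEquiv.map_app]⟩
  left_inv g := by ext x; simp
  right_inv g := by ext x; simp
  map_mul' g h := by ext x; simp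

theorem elementOrders_congr {G H : Type*} [Group G] [Group H] (e : G ≃* H) :
    elementOrders G = elementOrders H := by
  ext n
  constructor
  · rintro ⟨g, hg⟩
    exact ⟨e g, by rw [MulEquiv.orderOf_eq, hg]⟩
  · rintro ⟨g, hg⟩
    exact ⟨e.symm g, by rw [MulEquiv.orderOf_eq, hg]⟩

theorem mem_elementOrders_of_dvd {G : Type*} [Group G] {n m : ℕ} (hn : n ≠ 0)
    (h : n ∈ elementOrders G) (hm : m ∣ n) : m ∈ elementOrders G := by
  obtain ⟨g, rfl⟩ := h
  obtain ⟨k, hk⟩ := hm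
  have hk0 : k ≠ 0 := by rintro rfl; exact hn (by simpa using hk)
  refine ⟨g ^ k, ?_⟩
  rw [orderOf_pow_of_dvd hk0 (hk ▸ dvd_mul_left k m), hk,
    Nat.mul_div_cancel _ (Nat.pos_of_ne_zero hk0)]

/-- The inclusion of the orthogonal group into the ring of endomorphisms. -/
def generalOrthogonalGroupToEnd (Q : QuadraticForm K V) :
    generalOrthogonalGroup Q →* Module.End K V :=
  (LinearEquiv.automorphismGroup.toLinearMapMonoidHom).comp (generalOrthogonalGroup Q).subtype

theorem generalOrthogonalGroupToEnd_injective (Q : QuadraticForm K V) :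
    Function.Injective (generalOrthogonalGroupToEnd Q) := fun _ _ h =>
  Subtype.ext (LinearEquiv.toLinearMap_injective h)

theorem mem_elementOrders_of_orderOf_end {Q : QuadraticForm K V} (f : Module.End K V)
    (hf : ∀ x, Q (f x) = Q x) {N : ℕ} (hN : N ≠ 0) (h : orderOf f = N) :
    N ∈ elementOrders (generalOrthogonalGroup Q) := by
  have h1 : f ^ N = 1 := by rw [← h, pow_orderOf_eq_one]
  have h2 : f ^ (N - 1) * f = 1 := by
    rw [← pow_succ, Nat.sub_add_cancel (Nat.pos_of_ne_zero hN), h1]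
  have h3 : f * f ^ (N - 1) = 1 := by
    rw [← pow_succ', Nat.sub_add_cancel (Nat.pos_of_ne_zero hN), h1]
  let g : generalOrthogonalGroup Q := ⟨LinearEquiv.ofLinearMap f (f ^ (N - 1)) h3 h2, hf⟩
  refine ⟨g, ?_⟩
  rw [← orderOf_injective _ (generalOrthogonalGroupToEnd_injective Q), ← h]
  rfl

/-- The product of two isometry groups acts on the orthogonal sum. -/
def generalOrthogonalGroupProd (Q : QuadraticForm K V) (Q' : QuadraticForm K V') :
    generalOrthogonalGroup Q × generalOrthogonalGroup Q' →* generalOrthogonalGroup (Q.prod Q') where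
  toFun g := ⟨LinearEquiv.prodCongr g.1.1 g.2.1, fun x => by
    simp [QuadraticMap.prod_apply, g.1.2 x.1, g.2.2 x.2]⟩
  map_one' := rfl
  map_mul' _ _ := rfl

theorem generalOrthogonalGroupProd_injective (Q : QuadraticForm K V) (Q' : QuadraticForm K V') :
    Function.Injective (generalOrthogonalGroupProd Q Q') := by
  intro g h hgh
  have h1 : ∀ x : V × V', (g.1.1 x.1, g.2.1 x.2) = (h.1.1 x.1, h.2.1 x.2) := fun x =>
    LinearEquiv.congr_fun (congrArg Subtype.val hgh) x
  refine Prod.ext (Subtype.ext (LinearEquiv.ext fun x => ?_))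
    (Subtype.ext (LinearEquiv.ext fun x => ?_))
  · exact congrArg Prod.fst (h1 (x, 0))
  · exact congrArg Prod.snd (h1 (0, x))

end Orders

/-! ### Orders realized in a given type, and unipotent blocks -/

section Realizes

variable {K : Type*} [Field K] [CharP K 2] [Finite K] {V : Type*} [AddCommGroup V] [Module K V]

variable (K) in
/-- `N` is an element order of the orthogonal group of a nondegenerate form of type `ε` in
dimension `2 * n`. -/
def IsOrthogonalOrder (n : ℕ) (ε : ℤ) (N : ℕ) : Prop :=
  ∃ Q : QuadraticForm K (Fin (2 * n) → K), PolarSeparating Q ∧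
    gaussSumForm Q = ε * Nat.card K ^ n ∧ N ∈ elementOrders (generalOrthogonalGroup Q)

theorem IsOrthogonalOrder.of_form [FiniteDimensional K V] {Q : QuadraticForm K V}
    (hQ : PolarSeparating Q) {n : ℕ} {ε : ℤ} {N : ℕ} (hn : Module.finrank K V = 2 * n)
    (hG : gaussSumForm Q = ε * Nat.card K ^ n)
    (hN : N ∈ elementOrders (generalOrthogonalGroup Q)) : IsOrthogonalOrder K n ε N := by
  let e : (Fin (2 * n) → K) ≃ₗ[K] V := LinearEquiv.ofFinrankEq _ _ (by simp [hn])
  let i : Q.IsometryEquiv (Q.comp (e : (Fin (2 * n) → K) →ₗ[K] V)) :=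
    { e.symm with map_app' := fun x => by simp }
  exact ⟨_, hQ.of_equiv i, by rw [← gaussSumForm_congr i, hG],
    elementOrders_congr (generalOrthogonalGroupCongr i) ▸ hN⟩

theorem IsOrthogonalOrder.mem_elementOrders [FiniteDimensional K V] {Q : QuadraticForm K V}
    (hQ : PolarSeparating Q) {n : ℕ} {ε : ℤ} {N : ℕ} (hn : Module.finrank K V = 2 * n)
    (hG : gaussSumForm Q = ε * Nat.card K ^ n) (h : IsOrthogonalOrder K n ε N) :
    N ∈ elementOrders (generalOrthogonalGroup Q) := by
  obtain ⟨Q', hQ', hG', hN⟩ := h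
  obtain ⟨i⟩ := equivalent_of_gaussSumForm_eq n hQ' hQ (by simp) hn (by rw [hG, hG'])
  exact elementOrders_congr (generalOrthogonalGroupCongr i) ▸ hN

/-- Block isometries on an orthogonal sum: dimensions add, signs multiply, and the order is the
least common multiple. All later orders are assembled this way. -/
theorem IsOrthogonalOrder.lcm {n m : ℕ} {ε δ : ℤ} {N M : ℕ} (h : IsOrthogonalOrder K n ε N)
    (h' : IsOrthogonalOrder K m δ M) : IsOrthogonalOrder K (n + m) (ε * δ) (N.lcm M) := by
  obtain ⟨Q, hQ, hG, g, hg⟩ := h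
  obtain ⟨Q', hQ', hG', g', hg'⟩ := h'
  refine .of_form (hQ.prod hQ') (by simp [Module.finrank_prod]; ring) ?_
    ⟨generalOrthogonalGroupProd Q Q' (g, g'), ?_⟩
  · rw [gaussSumForm_prod, hG, hG']; ring
  · rw [orderOf_injective _ (generalOrthogonalGroupProd_injective Q Q'), Prod.orderOf, hg, hg']

theorem IsOrthogonalOrder.mul {n m : ℕ} {ε δ : ℤ} {N M : ℕ} (h : IsOrthogonalOrder K n ε N)
    (h' : IsOrthogonalOrder K m δ M) (hc : N.Coprime M) :
    IsOrthogonalOrder K (n + m) (ε * δ) (N * M) := by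
  rw [← hc.lcm_eq_mul]; exact h.lcm h'

theorem IsOrthogonalOrder.of_end [FiniteDimensional K V] {Q : QuadraticForm K V}
    (hQ : PolarSeparating Q) {n : ℕ} {ε : ℤ} {N : ℕ} (hn : Module.finrank K V = 2 * n)
    (hG : gaussSumForm Q = ε * Nat.card K ^ n) (f : Module.End K V)
    (hf : ∀ x, Q (f x) = Q x) (hN : N ≠ 0) (h : orderOf f = N) : IsOrthogonalOrder K n ε N :=
  .of_form hQ hn hG (mem_elementOrders_of_orderOf_end f hf hN h)

/-! ### Unipotent isometries -/

theorem isOrthogonalOrder_one_two {ε : ℤ} (hε : ε = 1 ∨ ε = -1) : IsOrthogonalOrder K 1 ε 2 := by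
  obtain ⟨c, hc⟩ := exists_artinSchreierChar_eq (K := K) hε
  have h2 := CharTwo.two_eq_zero (R := K)
  -- The reflection in the vector (1, 0), on which the form is 1.
  let f : Module.End K (K × K) :=
    { toFun := fun x => (x.1 + x.2, x.2)
      map_add' := fun x y => by ext <;> simp; ring
      map_smul' := fun r x => by ext <;> simp; ring }
  refine .of_end (polarSeparating_planeForm 1 c) (by simp [Module.finrank_prod])
    (by rw [gaussSumForm_planeForm_one, hc, pow_one]) f ?_ two_ne_zero ?_
  · rintro ⟨x, y⟩
    simp only [f, LinearMap.coe_mk, AddHom.coe_mk, planeForm_apply]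
    linear_combination (x * y + y * y) * h2
  · refine orderOf_eq_prime ?_ ?_
    · refine LinearMap.ext ?_
      rintro ⟨x, y⟩
      ext
      · simp only [f, pow_two, Module.End.mul_apply, LinearMap.coe_mk, AddHom.coe_mk,
          Module.End.one_apply]
        linear_combination y * h2
      · rfl
    · intro h
      have := congrArg Prod.fst (LinearMap.congr_fun h (0, 1))
      simp [f] at this

theorem isOrthogonalOrder_two_four {ε : ℤ} (hε : ε = 1 ∨ ε = -1) : IsOrthogonalOrder K 2 ε 4 := by
  obtain ⟨c, hc⟩ := exists_artinSchreierChar_eq (K := K) hε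
  have h2 := CharTwo.two_eq_zero (R := K)
  -- The reflection in (1, 0) of the second plane, followed by the Siegel transformation with
  -- singular vector (1, 0) of the first plane and a = (0, 1) in the second.
  let f : Module.End K ((K × K) × (K × K)) :=
    { toFun := fun x => ((x.1.1 + x.2.1 + x.2.2 + c * x.1.2, x.1.2), (x.2.1 + x.2.2, x.2.2 + x.1.2))
      map_add' := fun x y => by ext <;> simp <;> ring
      map_smul' := fun r x => by ext <;> simp <;> ring }
  have hf2 : ∀ x, (f * f) x = ((x.1.1 + x.2.2 + x.1.2, x.1.2), (x.2.1 + x.1.2, x.2.2)) := by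
    rintro ⟨⟨x, y⟩, ⟨z, w⟩⟩
    simp only [f, Module.End.mul_apply, LinearMap.coe_mk, AddHom.coe_mk, Prod.mk.injEq, and_true]
    refine ⟨?_, ?_, ?_⟩
    · linear_combination (z + w + c * y) * h2
    · linear_combination w * h2
    · linear_combination y * h2
  refine .of_end ((polarSeparating_planeForm 0 0).prod (polarSeparating_planeForm 1 c))
    (by simp [Module.finrank_prod])
    (by rw [gaussSumForm_prod, gaussSumForm_planeForm_zero, gaussSumForm_planeForm_one, hc]; ring)
    f ?_ four_ne_zero ?_
  · rintro ⟨⟨x, y⟩, ⟨z, w⟩⟩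
    simp only [f, LinearMap.coe_mk, AddHom.coe_mk, planeForm_apply, QuadraticMap.prod_apply]
    linear_combination (z * y + w * y + c * y * y + z * w + w * w + c * w * y) * h2
  · refine orderOf_eq_prime_pow (p := 2) (n := 1) ?_ ?_
    · intro h
      rw [pow_one, pow_two] at h
      have := congrArg (fun x => x.2.1) (LinearMap.congr_fun h ((0, 1), (0, 0)))
      rw [hf2] at this
      simp at this
    · refine LinearMap.ext ?_
      rintro ⟨⟨x, y⟩, ⟨z, w⟩⟩
      have : f ^ 2 ^ (1 + 1) = (f * f) * (f * f) := by noncomm_ring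
      rw [this, Module.End.mul_apply, hf2, hf2]
      simp only [Module.End.one_apply, Prod.mk.injEq, and_true]
      constructor
      · linear_combination (w + y) * h2
      · linear_combination y * h2

theorem isOrthogonalOrder_three_eight {ε : ℤ} (hε : ε = 1 ∨ ε = -1) :
    IsOrthogonalOrder K 3 ε 8 := by
  obtain ⟨c, hc⟩ := exists_artinSchreierChar_eq (K := K) hε
  have h2 := CharTwo.two_eq_zero (R := K)
  -- A Siegel transformation linking the two hyperbolic planes, with singular vector (1, 0) of the
  -- first and a = (0, 1) in the second, followed by the isometry of order four on the last two
  -- planes.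
  let f : Module.End K ((K × K) × ((K × K) × (K × K))) :=
    { toFun := fun x => ((x.1.1 + x.2.1.1, x.1.2),
        ((x.2.1.1 + x.2.2.1 + x.2.2.2 + c * (x.2.1.2 + x.1.2), x.2.1.2 + x.1.2),
          (x.2.2.1 + x.2.2.2, x.2.2.2 + x.2.1.2 + x.1.2)))
      map_add' := fun x y => by ext <;> simp <;> ring
      map_smul' := fun r x => by ext <;> simp <;> ring }
  have hf2 : ∀ x, (f * f) x =
      ((x.1.1 + x.2.2.1 + x.2.2.2 + c * (x.1.2 + x.2.1.2), x.1.2),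
        ((x.2.1.1 + x.2.2.2 + x.1.2 + x.2.1.2 + c * x.1.2, x.2.1.2),
          (x.2.2.1 + x.1.2 + x.2.1.2, x.2.2.2 + x.1.2))) := by
    rintro ⟨⟨x, y⟩, ⟨u, v⟩, ⟨z, w⟩⟩
    simp only [f, Module.End.mul_apply, LinearMap.coe_mk, AddHom.coe_mk, Prod.mk.injEq, and_true]
    refine ⟨?_, ⟨?_, ?_⟩, ?_, ?_⟩
    · linear_combination u * h2
    · linear_combination (z + w + c * v + c * y) * h2
    · linear_combination y * h2
    · linear_combination w * h2
    · linear_combination (v + y) * h2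
  have hf4 : ∀ x, ((f * f) * (f * f)) x =
      ((x.1.1 + x.2.1.2, x.1.2), ((x.2.1.1 + x.1.2, x.2.1.2), (x.2.2.1, x.2.2.2))) := by
    rintro ⟨⟨x, y⟩, ⟨u, v⟩, ⟨z, w⟩⟩
    rw [Module.End.mul_apply, hf2, hf2]
    simp only [Prod.mk.injEq, and_true]
    refine ⟨?_, ?_, ?_, ?_⟩
    · linear_combination (z + w + c * (y + v) + y) * h2
    · linear_combination (w + y + v + c * y) * h2
    · linear_combination (y + v) * h2
    · linear_combination y * h2
  refine .of_end ((polarSeparating_planeForm 0 0).prod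
      ((polarSeparating_planeForm 0 0).prod (polarSeparating_planeForm 1 c)))
    (by simp [Module.finrank_prod])
    (by
      rw [gaussSumForm_prod, gaussSumForm_prod, gaussSumForm_planeForm_zero,
        gaussSumForm_planeForm_one, hc]; ring)
    f ?_ (by norm_num) ?_
  · rintro ⟨⟨x, y⟩, ⟨u, v⟩, ⟨z, w⟩⟩
    simp only [f, LinearMap.coe_mk, AddHom.coe_mk, planeForm_apply, QuadraticMap.prod_apply]
    linear_combination (u * y + z * v + z * y + w * v + w * y + c * (v + y) * (v + y) + z * w +
      w * w + c * w * (v + y)) * h2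
  · refine orderOf_eq_prime_pow (p := 2) (n := 2) ?_ ?_
    · intro h
      have h4 : f ^ 2 ^ 2 = (f * f) * (f * f) := by noncomm_ring
      have := congrArg (fun x => x.2.1.1) (LinearMap.congr_fun h ((0, 1), (0, 0), (0, 0)))
      rw [h4, hf4] at this
      simp at this
    · refine LinearMap.ext ?_
      rintro ⟨⟨x, y⟩, ⟨u, v⟩, ⟨z, w⟩⟩
      have : f ^ 2 ^ (2 + 1) = ((f * f) * (f * f)) * ((f * f) * (f * f)) := by noncomm_ring
      rw [this, Module.End.mul_apply, hf4, hf4]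
      simp only [Module.End.one_apply, Prod.mk.injEq, and_true]
      constructor
      · linear_combination v * h2
      · linear_combination y * h2

end Realizes

/-! ### The hyperbolic space M* ⊕ M -/

section DualProd

variable {K : Type*} [Field K] {M : Type*} [AddCommGroup M] [Module K M]

theorem polar_dualProd (x y : Module.Dual K M × M) :
    polar (QuadraticForm.dualProd K M) x y = x.1 y.2 + y.1 x.2 := by
  simp [polar]; ring

theorem polarSeparating_dualProd : PolarSeparating (QuadraticForm.dualProd K M) := by
  intro x hx
  refine Prod.ext (LinearMap.ext fun m => ?_) ?_
  · simpa [polar_dualProd] using hx (0, m)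
  · refine (Module.forall_dual_apply_eq_zero_iff K x.2).1 fun f => ?_
    simpa [polar_dualProd] using hx (f, 0)

variable [FiniteDimensional K M]

theorem finrank_dualProd {n : ℕ} (h : Module.finrank K M = n) :
    Module.finrank K (Module.Dual K M × M) = 2 * n := by
  rw [Module.finrank_prod, Subspace.dual_finrank_eq, h]; ring

variable (K M) in
theorem isTotallySingular_dualProd :
    IsTotallySingular (QuadraticForm.dualProd K M) (LinearMap.range (LinearMap.inr K _ M)) := by
  rintro _ ⟨m, rfl⟩
  simp

theorem finrank_range_inr {n : ℕ} (h : Module.finrank K M = n) :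
    Module.finrank K (LinearMap.range (LinearMap.inr K (Module.Dual K M) M)) = n := by
  rw [LinearMap.finrank_range_of_inj LinearMap.inr_injective, h]

variable [CharP K 2] [Finite K]

theorem gaussSumForm_dualProd {n : ℕ} (h : Module.finrank K M = n) :
    gaussSumForm (QuadraticForm.dualProd K M) = Nat.card K ^ n := by
  have hn := finrank_dualProd h
  have : Finite (Module.Dual K M × M) := Module.finite_of_finite K
  have h1 := gaussSumForm_pos_of_isTotallySingular polarSeparating_dualProd hn _
    (isTotallySingular_dualProd K M) (finrank_range_inr h).ge
  have hq : (0 : ℤ) < Nat.card K := by exact_mod_cast Nat.card_pos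
  rcases gaussSumForm_eq_or polarSeparating_dualProd hn with h2 | h2
  · exact h2
  · have := pow_pos hq n
    omega

/-- The general linear group acts on `M* ⊕ M`. -/
def dualProdAction (M : Type*) [AddCommGroup M] [Module K M] :
    (M ≃ₗ[K] M) →* generalOrthogonalGroup (QuadraticForm.dualProd K M) where
  toFun f := ⟨(QuadraticForm.dualProdIsometry f).toLinearEquiv,
    (QuadraticForm.dualProdIsometry f).map_app⟩
  map_one' := rfl
  map_mul' _ _ := rfl

theorem dualProdAction_injective :
    Function.Injective (dualProdAction (K := K) M) := fun f g h => LinearEquiv.ext fun x =>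
  congrArg Prod.snd (LinearEquiv.congr_fun (congrArg Subtype.val h) ((0 : Module.Dual K M), x))

/-- The source of plus-type orders: the general linear group of M acts faithfully by isometries on
M* ⊕ M, where M is totally singular of half the dimension. -/
theorem isOrthogonalOrder_plus {n : ℕ} (hn : Module.finrank K M = n) (f : M ≃ₗ[K] M) :
    IsOrthogonalOrder K n 1 (orderOf f) :=
  .of_form polarSeparating_dualProd (finrank_dualProd hn)
    (by rw [gaussSumForm_dualProd hn, one_mul])
    ⟨dualProdAction M f, orderOf_injective _ dualProdAction_injective f⟩

end DualProd

/-! ### Minus type means negative character sum -/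

section MinusType

variable {K : Type*} [Field K] [CharP K 2] [Finite K] {V : Type*} [AddCommGroup V] [Module K V]

/-- With the value q^n the form would be isometric to M* ⊕ M by the classification, and M would give
a totally singular subspace of the forbidden dimension n. -/
theorem IsMinusType.gaussSumForm_eq [FiniteDimensional K V] {n : ℕ} {Q : QuadraticForm K V}
    (h : IsMinusType n Q) : gaussSumForm Q = -Nat.card K ^ n := by
  have hQ := (polarSeparating_iff_nondegenerate Q).2 h.nondegenerate
  have : Finite V := Module.finite_of_finite K
  refine (gaussSumForm_eq_or hQ h.finrank_eq).resolve_left fun hG => ?_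
  have hM : Module.finrank K (Fin n → K) = n := by simp
  obtain ⟨i⟩ := equivalent_of_gaussSumForm_eq n (polarSeparating_dualProd (K := K)) hQ
    (finrank_dualProd hM) h.finrank_eq (by rw [gaussSumForm_dualProd hM, hG])
  have h1 := h.finrank_lt ((LinearMap.range (LinearMap.inr K (Module.Dual K (Fin n → K)) _)).map
    i.toLinearEquiv.toLinearMap) (by
      rintro _ ⟨x, hx, rfl⟩
      change Q (i x) = 0
      rw [QuadraticMap.IsometryEquiv.map_app]
      exact isTotallySingular_dualProd K (Fin n → K) x hx)
  rw [LinearEquiv.finrank_map_eq i.toLinearEquiv, finrank_range_inr hM] at h1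
  exact lt_irrefl _ h1

theorem isMinusType_of_gaussSumForm_neg [FiniteDimensional K V] {n : ℕ} {Q : QuadraticForm K V}
    (hQ : PolarSeparating Q) (hn : Module.finrank K V = 2 * n) (hG : gaussSumForm Q < 0)
    (hW : ∃ W : Submodule K V, IsTotallySingular Q W ∧ Module.finrank K W + 1 = n) :
    IsMinusType n Q where
  finrank_eq := hn
  nondegenerate := (polarSeparating_iff_nondegenerate Q).1 hQ
  exists_totallySingular := hW
  finrank_lt W hW := by
    by_contra! h
    exact (gaussSumForm_pos_of_isTotallySingular hQ hn W hW h).not_gt hG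

end MinusType

/-! ### Cyclic tori from extension fields -/

section FieldElements

variable (K : Type*) [Field K] [CharP K 2] [Finite K]

theorem exists_orderOf_eq_card_sub_one (F : Type*) [Field F] [Finite F] :
    ∃ g : Fˣ, orderOf g = Nat.card F - 1 := by
  obtain ⟨g, hg⟩ := IsCyclic.exists_generator (α := Fˣ)
  refine ⟨g, ?_⟩
  rw [orderOf_eq_card_of_forall_mem_zpowers hg, Nat.card_units]

theorem isOrthogonalOrder_plus_card_sub_one {n : ℕ} (hn : n ≠ 0) :
    IsOrthogonalOrder K n 1 (Nat.card K ^ n - 1) := by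
  have : NeZero n := ⟨hn⟩
  have : Fact (Nat.Prime 2) := ⟨Nat.prime_two⟩
  let F := FiniteField.Extension K 2 n
  obtain ⟨g, hg⟩ := exists_orderOf_eq_card_sub_one F
  let φ : Fˣ →* (F ≃ₗ[K] F) := DistribMulAction.toModuleAut K F
  have hφ : Function.Injective φ := fun a b h => by
    have := LinearEquiv.congr_fun h 1
    simpa [φ, Units.smul_def, Units.ext_iff] using this
  have := isOrthogonalOrder_plus (FiniteField.finrank_extension K 2 n) (φ g)
  rwa [orderOf_injective φ hφ, hg, FiniteField.natCard_extension] at this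

section NormForm

variable {K} {E : Type*} [Field E] [Algebra K E]

/-- The quadratic form `x ↦ ℓ (x * σ x)`. -/
noncomputable def normForm (σ : E →ₐ[K] E) (l : E →ₗ[K] K) : QuadraticForm K E :=
  LinearMap.BilinMap.toQuadraticMap (((LinearMap.mul K E).compl₂ σ.toLinearMap).compr₂ l)

omit [CharP K 2] [Finite K] in
theorem normForm_apply (σ : E →ₐ[K] E) (l : E →ₗ[K] K) (x : E) :
    normForm σ l x = l (x * σ x) := by
  simp [normForm]

omit [CharP K 2] [Finite K] in
theorem polar_normForm (σ : E →ₐ[K] E) (l : E →ₗ[K] K) (x y : E) :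
    polar (normForm σ l) x y = l (x * σ y + y * σ x) := by
  rw [polar, normForm_apply, normForm_apply, normForm_apply, ← map_sub, ← map_sub, map_add]
  ring_nf

end NormForm

/-- Nonempty fibres of u ↦ u^N are cosets of the kernel, which contains t and so has size divisible
by N. This congruence fixes the sign of the norm form's character sum. -/
theorem dvd_sum_of_pow_invariant {G : Type*} [CommGroup G] [Fintype G] (N : ℕ) (t : G)
    (ht : orderOf t = N) (φ : G → ℤ) : (N : ℤ) ∣ ∑ u : G, φ (u ^ N) := by
  classical
  rw [Finset.sum_comp φ (fun u : G => u ^ N)]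
  refine Finset.dvd_sum fun b hb => ?_
  obtain ⟨a, -, rfl⟩ := Finset.mem_image.1 hb
  rw [nsmul_eq_mul]
  refine Dvd.dvd.mul_right ?_ _
  have h1 := MonoidHom.card_fiber_eq_of_mem_range (powMonoidHom N : G →* G)
    (x := a ^ N) (y := 1) ⟨a, rfl⟩ ⟨1, by simp⟩
  have h2 : orderOf (⟨t, by simp [← ht, pow_orderOf_eq_one]⟩ : (powMonoidHom N : G →* G).ker) ∣
      Nat.card (powMonoidHom N : G →* G).ker := orderOf_dvd_natCard _
  rw [Subgroup.orderOf_mk, ht] at h2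
  have h3 : Nat.card (powMonoidHom N : G →* G).ker =
      (Finset.univ.filter fun g : G => (powMonoidHom N : G →* G) g = 1).card := by
    rw [Nat.card_eq_fintype_card]
    exact Fintype.card_of_subtype _ fun x => by simp
  rw [h3, ← h1] at h2
  exact_mod_cast h2

/-- On the field E of order q^(2n), with σ the map x ↦ x^(q^n), the form l(x σ(x)) is preserved by
multiplication by elements of norm x σ(x) = 1, which form a cyclic group of order q^n + 1. -/
theorem isOrthogonalOrder_minus_card_add_one {n : ℕ} (hn : n ≠ 0) :
    IsOrthogonalOrder K n (-1) (Nat.card K ^ n + 1) := by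
  classical
  have : NeZero (2 * n) := ⟨by omega⟩
  have : Fact (Nat.Prime 2) := ⟨Nat.prime_two⟩
  let E := FiniteField.Extension K 2 (2 * n)
  have : CharP E 2 := charP_of_injective_algebraMap (algebraMap K E).injective 2
  have hfr : Module.finrank K E = 2 * n := FiniteField.finrank_extension K 2 (2 * n)
  set q := Nat.card K with hq
  have hq2 : 2 ≤ q := Finite.one_lt_card
  have hqn : 2 ≤ q ^ n := hq2.trans (Nat.le_self_pow hn q)
  have hcard : Nat.card E = q ^ n * q ^ n := by
    rw [FiniteField.natCard_extension, two_mul, pow_add]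
  have hsub : (q ^ n + 1) * (q ^ n - 1) = q ^ n * q ^ n - 1 := by
    rw [← Nat.sq_sub_sq, pow_two, one_pow]
  let σ : E →ₐ[K] E := (FiniteField.Extension.frob K 2 (2 * n) ^ n : _ ≃ₐ[K] _)
  have hσ : ∀ x : E, σ x = x ^ q ^ n := fun x => FiniteField.Extension.frob_iterate_apply K 2 _ n
  have hσσ : ∀ x : E, σ (σ x) = x := fun x => by
    rw [hσ, hσ, ← pow_mul, ← hcard]
    cases nonempty_fintype E
    rw [Nat.card_eq_fintype_card, FiniteField.pow_card]
  obtain ⟨g, hg⟩ := exists_orderOf_eq_card_sub_one E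
  rw [hcard] at hg
  -- If σ fixed the generator g, its order q^(2n) - 1 would divide q^n - 1. A functional l not
  -- vanishing on g + σ(g) then makes the form nondegenerate, since B(x, σ(g/x)) = l(g + σ(g)).
  have hz : (g : E) + σ g ≠ 0 := by
    intro h
    rw [CharTwo.add_eq_zero, hσ] at h
    have h1 : g ^ (q ^ n - 1) = 1 := by
      have : g * g ^ (q ^ n - 1) = g := by
        rw [← pow_succ', Nat.sub_add_cancel (by omega)]
        ext
        simpa using h.symm
      simpa using this
    have h2 := Nat.le_of_dvd (by omega) (orderOf_dvd_of_pow_eq_one h1)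
    rw [hg, ← hsub] at h2
    have : 0 < q ^ n - 1 := by omega
    nlinarith
  obtain ⟨l, hl⟩ : ∃ l : E →ₗ[K] K, l ((g : E) + σ g) ≠ 0 := by
    by_contra! h
    exact hz ((Module.forall_dual_apply_eq_zero_iff K _).1 h)
  have hsep : PolarSeparating (normForm σ l) := by
    intro x hx
    by_contra hx0
    apply hl
    rw [← hx (σ (g / x)), polar_normForm, hσσ, mul_div_cancel₀ _ hx0, mul_comm (σ _), ← map_mul,
      mul_div_cancel₀ _ hx0]
  set t : Eˣ := g ^ (q ^ n - 1) with ht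
  have htord : orderOf t = q ^ n + 1 := by
    rw [ht, orderOf_pow_of_dvd (by omega) (by rw [hg, ← hsub]; exact dvd_mul_left _ _), hg, ← hsub,
      Nat.mul_div_cancel _ (by omega)]
  -- The form depends on x only through x^(q^n + 1), so the sum is congruent to 1 modulo q^n + 1. Of
  -- ±q^n only the negative value qualifies, because 0 < q^n - 1 < q^n + 1.
  have hG : gaussSumForm (normForm σ l) = -1 * (q : ℤ) ^ n := by
    cases nonempty_fintype E
    have hdvd := dvd_sum_of_pow_invariant (q ^ n + 1) t htord
      (fun u : Eˣ => artinSchreierChar K (l (u : E)))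
    have h1 : gaussSumForm (normForm σ l) =
        1 + ∑ u : Eˣ, artinSchreierChar K (l ((u ^ (q ^ n + 1) : Eˣ) : E)) := by
      rw [gaussSumForm_eq_sum, ← Finset.add_sum_erase _ _ (Finset.mem_univ (0 : E))]
      congr 1
      · simp
      · symm
        refine Finset.sum_bij (fun u _ => (u : E)) (fun u _ => by simp)
          (fun u _ v _ h => Units.ext h) (fun x hx => ?_) (fun u _ => ?_)
        · exact ⟨Units.mk0 x (by simpa using hx), Finset.mem_univ _, rfl⟩
        · rw [normForm_apply, hσ, Units.val_pow_eq_pow_val, pow_succ']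
    rcases gaussSumForm_eq_or hsep hfr with h | h
    · exfalso
      rw [← hq] at h
      rw [h] at h1
      rw [eq_sub_of_add_eq' h1.symm] at hdvd
      have h2 := Int.le_of_dvd (by have : (2 : ℤ) ≤ (q : ℤ) ^ n := by exact_mod_cast hqn
                                   omega) hdvd
      push_cast at h2
      omega
    · rw [h]; ring
  refine .of_end hsep hfr hG (Algebra.lmul K E (t : E)) (fun x => ?_) (by omega) ?_
  · have h1 : (t : E) * σ t = 1 := by
      rw [hσ, ← pow_succ', ← Units.val_pow_eq_pow_val, ← htord, pow_orderOf_eq_one, Units.val_one]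
    rw [normForm_apply, normForm_apply, Algebra.coe_lmul_eq_mul, LinearMap.mul_apply', map_mul σ]
    congr 1
    linear_combination (x * σ x) * h1
  · rw [← htord, ← orderOf_units]
    exact orderOf_injective (Algebra.lmul K E : E →* Module.End K E) Algebra.lmul_injective _

end FieldElements

/-! ### Orbits of eigenvalues under inversion and Frobenius -/

section EigenvalueOrbits

variable {F : Type*} [Field F] [CharP F 2]

open Classical in
/-- A finite multiset of nonzero elements of a field that is stable under inversion and under
`x ↦ x ^ q`, with multiplicities. -/
structure IsReciprocalMultiset (q : ℕ) (M : Multiset F) : Prop where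
  zero_notMem : (0 : F) ∉ M
  count_inv : ∀ x, M.count x⁻¹ = M.count x
  count_pow : ∀ x, M.count (x ^ q) = M.count x

/-- A finite set of nonzero elements, of size `2 * d`, stable under inversion and `x ↦ x ^ q`, all
of whose elements satisfy `x ^ q ^ d = x⁻¹`, or all of whose elements satisfy `x ^ q ^ d = x`. -/
structure IsReciprocalOrbit (q d : ℕ) (O : Finset F) : Prop where
  card_eq : O.card = 2 * d
  pos : 0 < d
  one_notMem : (1 : F) ∉ O
  inv_mem : ∀ x, x⁻¹ ∈ O ↔ x ∈ O
  pow_mem : ∀ x, x ^ q ∈ O ↔ x ∈ O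
  pow_eq : (∀ x ∈ O, x ^ (q ^ d + 1) = 1) ∨ (∀ x ∈ O, x ^ (q ^ d - 1) = 1)

theorem iterate_pow_eq (q i : ℕ) (x : F) : (fun y : F => y ^ q)^[i] x = x ^ q ^ i := by
  rw [pow_iterate]

open Function Classical in
-- If the Frobenius orbit of x contains x⁻¹ = x^(q^d), its length is 2d and y^(q^d) = y⁻¹ on it.
-- Otherwise it is disjoint from the orbit of inverses, d is its length, and y^(q^d) = y on the
-- union.
theorem exists_reciprocalOrbit {q : ℕ} (hq : Injective fun y : F => y ^ q) {x : F}
    (hx0 : x ≠ 0) (hx1 : x ≠ 1) (hx : x ∈ periodicPts fun y : F => y ^ q) :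
    ∃ d O, IsReciprocalOrbit q d O ∧ x ∈ O ∧
      ∀ y ∈ O, (∃ i, y = x ^ q ^ i) ∨ (∃ i, y = (x ^ q ^ i)⁻¹) := by
  set φ : F → F := fun y => y ^ q with hφ
  set p := minimalPeriod φ x with hp
  have hp0 : 0 < p := minimalPeriod_pos_of_mem_periodicPts hx
  have hq0 : q ≠ 0 := by
    rintro rfl
    exact zero_ne_one (hq (by simp : (0 : F) ^ 0 = 1 ^ 0))
  -- In characteristic two x² = 1 forces x = 1.
  have hinv : x ≠ x⁻¹ := by
    intro h
    have : x ^ 2 = 1 ^ 2 := by rw [pow_two]; nth_rw 2 [h]; rw [mul_inv_cancel₀ hx0, one_pow]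
    exact hx1 (CharTwo.sq_injective this)
  have hit : ∀ i, x ^ q ^ i = φ^[i] x := fun i => (iterate_pow_eq q i x).symm
  have hper : x ^ q ^ p = x := by rw [hit, hp, iterate_minimalPeriod]
  let O₁ : Finset F := (Finset.range p).image fun i => x ^ q ^ i
  have hO₁card : O₁.card = p := by
    rw [Finset.card_image_of_injOn, Finset.card_range]
    intro i hi j hj hij
    simp only [hit] at hij
    exact iterate_injOn_Iio_minimalPeriod (by simpa using hi) (by simpa using hj) hij
  have hmem : ∀ y, y ∈ O₁ ↔ ∃ i, y = x ^ q ^ i := by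
    intro y
    simp only [O₁, Finset.mem_image, Finset.mem_range]
    constructor
    · rintro ⟨i, -, rfl⟩; exact ⟨i, rfl⟩
    · rintro ⟨i, rfl⟩
      refine ⟨i % p, Nat.mod_lt _ hp0, ?_⟩
      rw [hit, hit, hp, iterate_mod_minimalPeriod_eq]
  have hO₁pow : ∀ y, y ^ q ∈ O₁ ↔ y ∈ O₁ := by
    intro y
    rw [hmem, hmem]
    constructor
    · rintro ⟨i, hi⟩
      refine ⟨i + (p - 1), hq ?_⟩
      change y ^ q = (x ^ q ^ (i + (p - 1))) ^ q
      rw [hi, ← pow_mul, ← pow_succ, add_assoc, Nat.sub_add_cancel hp0, pow_add, mul_comm, pow_mul,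
        hper]
    · rintro ⟨i, rfl⟩
      exact ⟨i + 1, by rw [← pow_mul, pow_succ]⟩
  have hone : ∀ i, x ^ q ^ i ≠ 1 := by
    intro i hi
    have := hq.iterate i (a₁ := x) (a₂ := 1)
    change φ^[i] x = φ^[i] 1 → x = 1 at this
    rw [← hit, hi, iterate_pow_eq, one_pow] at this
    exact hx1 (this rfl)
  by_cases hcase : x⁻¹ ∈ O₁
  · obtain ⟨d, hdp, hd⟩ := Finset.mem_image.1 hcase
    rw [Finset.mem_range] at hdp
    have hd0 : d ≠ 0 := by rintro rfl; exact hinv (by simpa using hd)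
    have hdd : x ^ q ^ (d + d) = x := by rw [pow_add, pow_mul, hd, inv_pow, hd, inv_inv]
    have h2d : p ∣ d + d := by
      rw [hp]
      apply IsPeriodicPt.minimalPeriod_dvd
      change φ^[d + d] x = x
      rw [← hit, hdd]
    -- The period p divides 2d while 0 < d < p, so the quotient 2d/p can only be 1.
    have hpd : p = 2 * d := by
      obtain ⟨k, hk⟩ := h2d
      have : k = 1 := by
        rcases k with _ | _ | k
        · omega
        · rfl
        · exfalso; nlinarith
      rw [this] at hk; omega
    refine ⟨d, O₁, ⟨by rw [hO₁card, hpd], Nat.pos_of_ne_zero hd0, ?_, ?_, hO₁pow, Or.inl ?_⟩, ?_,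
      fun y hy => Or.inl ((hmem y).1 hy)⟩
    · rw [hmem]; rintro ⟨i, hi⟩; exact hone i hi.symm
    · have : ∀ y, y ∈ O₁ → y⁻¹ ∈ O₁ := by
        intro y hy
        obtain ⟨i, rfl⟩ := (hmem y).1 hy
        rw [hmem]
        exact ⟨d + i, by rw [pow_add, pow_mul, hd, inv_pow]⟩
      exact fun y => ⟨fun h => by simpa using this _ h, this y⟩
    · intro y hy
      obtain ⟨i, rfl⟩ := (hmem y).1 hy
      have : (x ^ q ^ i) ^ (q ^ d) = (x ^ q ^ i)⁻¹ := by
        rw [← pow_mul, mul_comm, pow_mul, hd, inv_pow]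
      rw [pow_succ, this, inv_mul_cancel₀ (pow_ne_zero _ hx0)]
    · rw [hmem]; exact ⟨0, by simp⟩
  · let O₂ : Finset F := O₁.image fun y => y⁻¹
    have hmem2 : ∀ y, y ∈ O₂ ↔ y⁻¹ ∈ O₁ := by
      intro y
      simp only [O₂, Finset.mem_image]
      constructor
      · rintro ⟨z, hz, rfl⟩; simpa using hz
      · intro h; exact ⟨_, h, inv_inv y⟩
    have hdisj : Disjoint O₁ O₂ := by
      rw [Finset.disjoint_left]
      intro y hy hy2
      rw [hmem2, hmem] at hy2
      obtain ⟨i, rfl⟩ := (hmem y).1 hy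
      obtain ⟨j, hj⟩ := hy2
      apply hcase
      rw [hmem]
      -- Completing i to a multiple of the period carries a relation between conjugates back to x
      -- itself.
      have h1 : ∃ k, i + k = p * (i + 1) := ⟨p * (i + 1) - i, by
        have : i ≤ p * (i + 1) := by nlinarith
        omega⟩
      obtain ⟨k, hk⟩ := h1
      have h2 : x ^ q ^ (i + k) = x := by
        rw [hk, hit]
        exact (isPeriodicPt_minimalPeriod φ x).mul_const (i + 1)
      refine ⟨j + k, ?_⟩
      rw [pow_add, pow_mul, ← hj, inv_pow, ← pow_mul, ← pow_add, h2]
    refine ⟨p, O₁ ∪ O₂, ⟨?_, hp0, ?_, ?_, ?_, Or.inr ?_⟩, ?_, ?_⟩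
    · rw [Finset.card_union_of_disjoint hdisj, Finset.card_image_of_injective _ inv_injective,
        hO₁card, two_mul]
    · rw [Finset.mem_union, hmem2, inv_one, or_self, hmem]
      rintro ⟨i, hi⟩; exact hone i hi.symm
    · intro y
      rw [Finset.mem_union, Finset.mem_union, hmem2, hmem2, inv_inv, or_comm]
    · intro y
      rw [Finset.mem_union, Finset.mem_union, hmem2, hmem2, ← inv_pow, hO₁pow, hO₁pow]
    · have : ∀ y ∈ O₁, y ^ (q ^ p - 1) = 1 := by
        intro y hy
        obtain ⟨i, rfl⟩ := (hmem y).1 hy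
        have h1 : (x ^ q ^ i) ^ q ^ p = x ^ q ^ i := by
          rw [← pow_mul, mul_comm, pow_mul, hper]
        have h2 : x ^ q ^ i ≠ 0 := pow_ne_zero _ hx0
        have h3 : 0 < q ^ p := Nat.pos_of_ne_zero (pow_ne_zero _ hq0)
        refine mul_right_cancel₀ h2 ?_
        rw [← pow_succ, Nat.sub_add_cancel h3, h1, one_mul]
      intro y hy
      rcases Finset.mem_union.1 hy with hy | hy
      · exact this y hy
      · have := this _ ((hmem2 y).1 hy)
        rwa [inv_pow, inv_eq_one] at this
    · rw [Finset.mem_union, hmem]; exact Or.inl ⟨0, by simp⟩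
    · intro y hy
      rcases Finset.mem_union.1 hy with hy | hy
      · exact Or.inl ((hmem y).1 hy)
      · obtain ⟨i, hi⟩ := (hmem _).1 ((hmem2 y).1 hy)
        exact Or.inr ⟨i, by rw [← hi, inv_inv]⟩

namespace IsReciprocalMultiset

variable {q : ℕ} {M : Multiset F}

open Function Classical

theorem count_pow_iterate (h : IsReciprocalMultiset q M) (x : F) (i : ℕ) :
    M.count (x ^ q ^ i) = M.count x := by
  induction i with
  | zero => simp
  | succ i ih => rw [pow_succ, pow_mul, h.count_pow, ih]

/-- All iterates of x stay in the finite support of M, so two coincide, and injectivity of the power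
map moves the coincidence back to x. -/
theorem mem_periodicPts (h : IsReciprocalMultiset q M) (hq : Injective fun y : F => y ^ q) {x : F}
    (hx : x ∈ M) : x ∈ periodicPts fun y : F => y ^ q := by
  let f : ℕ → {y // y ∈ M.toFinset} := fun i => ⟨x ^ q ^ i, by
    rw [Multiset.mem_toFinset, ← Multiset.count_pos, h.count_pow_iterate x, Multiset.count_pos]
    exact hx⟩
  have key : ∀ i j, i < j → f i = f j → x ∈ periodicPts fun y : F => y ^ q := by
    intro i j hij hf
    have hf' : x ^ q ^ i = x ^ q ^ j := congrArg Subtype.val hf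
    refine ⟨j - i, by omega, hq.iterate i ?_⟩
    rw [← iterate_add_apply, Nat.add_sub_cancel' hij.le, iterate_pow_eq, iterate_pow_eq, hf']
  obtain ⟨i, j, hij, hf⟩ := Finite.exists_ne_map_eq_of_infinite f
  rcases lt_or_gt_of_ne hij with h1 | h1
  · exact key i j h1 hf
  · exact key j i h1 hf.symm

/-- The elements of a reciprocal multiset outside an orbit. -/
theorem filter_notMem (h : IsReciprocalMultiset q M) {d : ℕ} {O : Finset F}
    (hO : IsReciprocalOrbit q d O) : IsReciprocalMultiset q (M.filter (· ∉ O)) where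
  zero_notMem := fun h0 => h.zero_notMem (Multiset.mem_of_mem_filter h0)
  count_inv x := by
    simp only [Multiset.count_filter, h.count_inv, hO.inv_mem]
  count_pow x := by
    simp only [Multiset.count_filter, h.count_pow, hO.pow_mem]

/-- A reciprocal multiset with an element other than `1` splits off an orbit of constant
multiplicity. -/
theorem exists_orbit (h : IsReciprocalMultiset q M) (hq : Injective fun y : F => y ^ q) {x : F}
    (hx : x ∈ M) (hx1 : x ≠ 1) : ∃ d O, IsReciprocalOrbit q d O ∧ x ∈ O ∧
      (∀ y ∈ O, M.count y = M.count x) ∧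
      Multiset.card M = 2 * d * M.count x + Multiset.card (M.filter (· ∉ O)) := by
  have hx0 : x ≠ 0 := by rintro rfl; exact h.zero_notMem hx
  obtain ⟨d, O, hO, hxO, hall⟩ := exists_reciprocalOrbit hq hx0 hx1 (h.mem_periodicPts hq hx)
  have hcount : ∀ y ∈ O, M.count y = M.count x := by
    intro y hy
    rcases hall y hy with ⟨i, rfl⟩ | ⟨i, rfl⟩
    · exact h.count_pow_iterate x i
    · rw [h.count_inv, h.count_pow_iterate x i]
  refine ⟨d, O, hO, hxO, hcount, ?_⟩
  have h1 : Multiset.card (M.filter (· ∈ O)) = 2 * d * M.count x := by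
    rw [← Multiset.sum_count_eq_card (s := O) fun a ha => (Multiset.mem_filter.1 ha).2,
      ← hO.card_eq, ← smul_eq_mul, ← Finset.sum_const]
    refine Finset.sum_congr rfl fun y hy => ?_
    rw [Multiset.count_filter_of_pos hy, hcount y hy]
  rw [← h1, ← Multiset.card_add, Multiset.filter_add_not]

end IsReciprocalMultiset

end EigenvalueOrbits

/-! ### A list of orders in minus type, dimension eight -/

section MinusOrders

variable (K : Type*) [Field K] [CharP K 2] [Finite K]

/-- `n` divides an element order of the orthogonal group of a form of minus type in
dimension eight. -/
def DvdMinusOrder (n : ℕ) : Prop := ∃ N, N ≠ 0 ∧ IsOrthogonalOrder K 4 (-1) N ∧ n ∣ N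

variable {K}

theorem IsOrthogonalOrder.dvdMinusOrder {n : ℕ} (hn : n ≠ 0) (h : IsOrthogonalOrder K 4 (-1) n) :
    DvdMinusOrder K n := ⟨n, hn, h, dvd_rfl⟩

theorem DvdMinusOrder.of_dvd {n m : ℕ} (h : DvdMinusOrder K n) (hm : m ∣ n) :
    DvdMinusOrder K m := by
  obtain ⟨N, h0, hN, hd⟩ := h
  exact ⟨N, h0, hN, hm.trans hd⟩

variable (K) in
theorem even_natCard : Even (Nat.card K) := by
  cases nonempty_fintype K
  rw [Nat.card_eq_fintype_card, Nat.even_iff, 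
    ← FiniteField.even_card_iff_char_two]
  exact ringChar.eq K 2

theorem coprime_add_one_sub_one {a : ℕ} (ha : Even a) (h0 : a ≠ 0) :
    (a + 1).Coprime (a - 1) := by
  obtain ⟨b, rfl⟩ := Nat.exists_eq_succ_of_ne_zero h0
  rw [Nat.succ_eq_add_one, Nat.add_sub_cancel]
  have hodd : Odd b := by
    rcases Nat.even_or_odd b with h | h
    · exact absurd ha (by simp [h, Nat.even_add_one])
    · exact h
  have h1 : b + 1 + 1 = 2 + b := by ring
  rw [h1, Nat.coprime_add_self_left]
  exact Nat.coprime_two_left.2 hodd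

section Arithmetic

variable {q : ℕ} (hq : Even q) (h0 : q ≠ 0)
include hq h0

theorem odd_pow_add_one {d : ℕ} (hd : d ≠ 0) : Odd (q ^ d + 1) :=
  (hq.pow_of_ne_zero hd).add_one

theorem odd_pow_sub_one {d : ℕ} (hd : d ≠ 0) : Odd (q ^ d - 1) :=
  Nat.Even.sub_odd (Nat.one_le_pow _ _ (by omega)) (hq.pow_of_ne_zero hd) odd_one

omit hq h0 in
theorem add_one_mul_sub_one_pow (d : ℕ) : (q ^ d + 1) * (q ^ d - 1) = q ^ (2 * d) - 1 := by
  rw [← Nat.sq_sub_sq, one_pow, ← pow_mul, mul_comm]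

end Arithmetic

variable (K)

theorem natCard_ne_zero : Nat.card K ≠ 0 := Nat.card_pos.ne'

theorem pow_sub_one_ne_zero {d : ℕ} (hd : d ≠ 0) : Nat.card K ^ d - 1 ≠ 0 := by
  have : 2 ≤ Nat.card K := Finite.one_lt_card
  have := this.trans (Nat.le_self_pow hd (Nat.card K))
  omega

theorem dvdMinusOrder_four_plus : DvdMinusOrder K (Nat.card K ^ 4 + 1) :=
  (isOrthogonalOrder_minus_card_add_one K four_ne_zero).dvdMinusOrder (by omega)

theorem IsOrthogonalOrder.mul_eight {n m : ℕ} {ε δ : ℤ} {N M : ℕ} (h : IsOrthogonalOrder K n ε N)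
    (h' : IsOrthogonalOrder K m δ M) (hc : N.Coprime M) (hnm : n + m = 4) (hs : ε * δ = -1)
    (hN : N ≠ 0) (hM : M ≠ 0) : DvdMinusOrder K (N * M) := by
  have := h.mul h' hc
  rw [hnm, hs] at this
  exact this.dvdMinusOrder (mul_ne_zero hN hM)

theorem coprime_two_pow_of_odd {N : ℕ} (h : Odd N) (k : ℕ) : N.Coprime (2 ^ k) :=
  (Nat.coprime_two_right.2 h).pow_right k

/-- The torus of order q⁴ - 1 acting on M* ⊕ M has plus type. The coprime factorization (q² + 1)(q²
- 1) realizes the same order on a minus and a plus space of dimension four. -/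
theorem dvdMinusOrder_four_minus : DvdMinusOrder K (Nat.card K ^ 4 - 1) := by
  rw [← add_one_mul_sub_one_pow 2]
  exact (isOrthogonalOrder_minus_card_add_one K two_ne_zero).mul_eight K
    (isOrthogonalOrder_plus_card_sub_one K two_ne_zero)
    (coprime_add_one_sub_one ((even_natCard K).pow_of_ne_zero two_ne_zero)
      (pow_ne_zero _ (natCard_ne_zero K))) rfl rfl (by omega) (pow_sub_one_ne_zero K two_ne_zero)

theorem Nat.sub_one_dvd_pow_sub_one' (a d : ℕ) : a - 1 ∣ a ^ d - 1 := by
  simpa using Nat.sub_dvd_pow_sub_pow a 1 d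

theorem dvdMinusOrder_three_plus_one_minus : DvdMinusOrder K ((Nat.card K ^ 3 + 1) * (Nat.card K ^ 1 - 1)) :=
  (isOrthogonalOrder_minus_card_add_one K three_ne_zero).mul_eight K
    (isOrthogonalOrder_plus_card_sub_one K one_ne_zero)
    ((coprime_add_one_sub_one ((even_natCard K).pow_of_ne_zero three_ne_zero)
      (pow_ne_zero _ (natCard_ne_zero K))).of_dvd_right (by
        rw [pow_one]; exact Nat.sub_one_dvd_pow_sub_one' _ 3))
    rfl rfl (by omega) (pow_sub_one_ne_zero K one_ne_zero)

theorem add_one_dvd_pow_three_add_one (a : ℕ) : a + 1 ∣ a ^ 3 + 1 := by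
  simpa using Odd.nat_add_dvd_pow_add_pow a 1 (n := 3) (by decide)

theorem dvdMinusOrder_three_minus_one_plus : DvdMinusOrder K ((Nat.card K ^ 3 - 1) * (Nat.card K ^ 1 + 1)) :=
  (isOrthogonalOrder_plus_card_sub_one K three_ne_zero).mul_eight K
    (isOrthogonalOrder_minus_card_add_one K one_ne_zero)
    ((coprime_add_one_sub_one ((even_natCard K).pow_of_ne_zero three_ne_zero)
      (pow_ne_zero _ (natCard_ne_zero K))).symm.of_dvd_right (by
        rw [pow_one]; exact add_one_dvd_pow_three_add_one _))
    rfl rfl (pow_sub_one_ne_zero K three_ne_zero) (by omega)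

/-- An element of order `Nat.card K ^ d + 1` combines with a unipotent element on the complement. -/
theorem dvdMinusOrder_plus_mul {d m k : ℕ} (hd : d ≠ 0) (hm : IsOrthogonalOrder K m 1 (2 ^ k))
    (h4 : d + m = 4) : DvdMinusOrder K ((Nat.card K ^ d + 1) * 2 ^ k) :=
  (isOrthogonalOrder_minus_card_add_one K hd).mul_eight K hm
    (coprime_two_pow_of_odd (odd_pow_add_one (even_natCard K) (natCard_ne_zero K) hd) k)
    h4 rfl (by omega) (by positivity)

theorem dvdMinusOrder_minus_mul {d m k : ℕ} (hd : d ≠ 0) (hm : IsOrthogonalOrder K m (-1) (2 ^ k))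
    (h4 : d + m = 4) : DvdMinusOrder K ((Nat.card K ^ d - 1) * 2 ^ k) :=
  (isOrthogonalOrder_plus_card_sub_one K hd).mul_eight K hm
    (coprime_two_pow_of_odd (odd_pow_sub_one (even_natCard K) (natCard_ne_zero K) hd) k)
    h4 rfl (pow_sub_one_ne_zero K hd) (by positivity)

theorem dvdMinusOrder_three {m : ℕ} (hm : m = Nat.card K ^ 3 + 1 ∨ m = Nat.card K ^ 3 - 1) :
    DvdMinusOrder K (m * 2 ^ 1) := by
  rcases hm with rfl | rfl
  · exact dvdMinusOrder_plus_mul K three_ne_zero (isOrthogonalOrder_one_two (Or.inl rfl)) rfl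
  · exact dvdMinusOrder_minus_mul K three_ne_zero (isOrthogonalOrder_one_two (Or.inr rfl)) rfl

theorem dvdMinusOrder_two {m : ℕ} (hm : m = Nat.card K ^ 2 + 1 ∨ m = Nat.card K ^ 2 - 1) :
    DvdMinusOrder K (m * 2 ^ 2) := by
  rcases hm with rfl | rfl
  · exact dvdMinusOrder_plus_mul K two_ne_zero (isOrthogonalOrder_two_four (Or.inl rfl)) rfl
  · exact dvdMinusOrder_minus_mul K two_ne_zero (isOrthogonalOrder_two_four (Or.inr rfl)) rfl

theorem dvdMinusOrder_one {m : ℕ} (hm : m = Nat.card K ^ 1 + 1 ∨ m = Nat.card K ^ 1 - 1) :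
    DvdMinusOrder K (m * 2 ^ 3) := by
  rcases hm with rfl | rfl
  · exact dvdMinusOrder_plus_mul K one_ne_zero (isOrthogonalOrder_three_eight (Or.inl rfl)) rfl
  · exact dvdMinusOrder_minus_mul K one_ne_zero (isOrthogonalOrder_three_eight (Or.inr rfl)) rfl

theorem dvdMinusOrder_two_one {m : ℕ} (hm : m = Nat.card K ^ 1 + 1 ∨ m = Nat.card K ^ 1 - 1) :
    DvdMinusOrder K ((Nat.card K ^ 2 + 1) * m * 2 ^ 1) := by
  have hdvd : m ∣ Nat.card K ^ 2 - 1 := by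
    have := add_one_mul_sub_one_pow (q := Nat.card K) 1
    rw [mul_one] at this
    rw [← this]
    rcases hm with rfl | rfl
    · exact dvd_mul_right _ _
    · exact dvd_mul_left _ _
  have hc : (Nat.card K ^ 2 + 1).Coprime m :=
    (coprime_add_one_sub_one ((even_natCard K).pow_of_ne_zero two_ne_zero)
      (pow_ne_zero _ (natCard_ne_zero K))).of_dvd_right hdvd
  have hodd : Odd m := by
    rcases hm with rfl | rfl
    · exact odd_pow_add_one (even_natCard K) (natCard_ne_zero K) one_ne_zero
    · exact odd_pow_sub_one (even_natCard K) (natCard_ne_zero K) one_ne_zero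
  have hm0 : m ≠ 0 := by rintro rfl; exact absurd hodd (by decide)
  -- The unipotent plane is given the same sign ε as the plane carrying m, so together they have
  -- plus type and q² + 1 supplies the minus sign.
  obtain ⟨ε, hε, h1⟩ : ∃ ε : ℤ, (ε = 1 ∨ ε = -1) ∧ IsOrthogonalOrder K 1 ε m := by
    rcases hm with rfl | rfl
    · exact ⟨-1, Or.inr rfl, isOrthogonalOrder_minus_card_add_one K one_ne_zero⟩
    · exact ⟨1, Or.inl rfl, isOrthogonalOrder_plus_card_sub_one K one_ne_zero⟩
  have h2 : IsOrthogonalOrder K (1 + 1) (ε * ε) (m * 2 ^ 1) :=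
    h1.mul (isOrthogonalOrder_one_two hε) (coprime_two_pow_of_odd hodd 1)
  have hεε : ε * ε = 1 := by rcases hε with rfl | rfl <;> rfl
  rw [hεε] at h2
  rw [mul_assoc]
  exact (isOrthogonalOrder_minus_card_add_one K two_ne_zero).mul_eight K h2
    (hc.mul_right (coprime_two_pow_of_odd
      (odd_pow_add_one (even_natCard K) (natCard_ne_zero K) two_ne_zero) 1))
    rfl rfl (by omega) (by positivity)

end MinusOrders

/-! ### Case analysis of eight eigenvalues -/

section Enumeration

open Function Classical

variable {F : Type*} [Field F] [CharP F 2]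

theorem pow_eq_one_of_dvd_of_pow_eq_one {G : Type*} [Monoid G] {x : G} {a m : ℕ} (h : x ^ a = 1)
    (hd : a ∣ m) : x ^ m = 1 := by
  obtain ⟨k, rfl⟩ := hd
  rw [pow_mul, h, one_pow]

omit [CharP F 2] in
theorem count_filter_notMem {M : Multiset F} {O : Finset F} {y : F} (hy : y ∉ O) :
    (M.filter (· ∉ O)).count y = M.count y :=
  Multiset.count_filter_of_pos (p := (· ∉ O)) hy

omit [CharP F 2] in
theorem count_filter_le {M : Multiset F} {O : Finset F} {c b : ℕ} (hO : ∀ y ∈ O, M.count y = c)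
    (hc : c ≤ b) (h : ∀ y, (M.filter (· ∉ O)).count y ≤ b) (y : F) : M.count y ≤ b := by
  by_cases hy : y ∈ O
  · rw [hO y hy]; exact hc
  · have := h y
    rwa [count_filter_notMem hy] at this

theorem pow_eq_one_of_filter {M : Multiset F} {O : Finset F} {m : ℕ} (hO : ∀ y ∈ O, y ^ m = 1)
    (h : ∀ y ∈ M.filter (· ∉ O), y ^ m = 1) (y : F) (hy : y ∈ M) : y ^ m = 1 := by
  by_cases hyO : y ∈ O
  · exact hO y hyO
  · exact h y (Multiset.mem_filter.2 ⟨hy, hyO⟩)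

theorem IsReciprocalOrbit.exists_pow_eq {q d : ℕ} {O : Finset F} (h : IsReciprocalOrbit q d O) :
    ∃ m, (m = q ^ d + 1 ∨ m = q ^ d - 1) ∧ ∀ x ∈ O, x ^ m = 1 := by
  rcases h.pow_eq with h | h
  · exact ⟨_, Or.inl rfl, h⟩
  · exact ⟨_, Or.inr rfl, h⟩

theorem dvd_sq_sub_one {q m : ℕ} (hm : m = q ^ 1 + 1 ∨ m = q ^ 1 - 1) : m ∣ q ^ 2 - 1 := by
  have := add_one_mul_sub_one_pow (q := q) 1
  rw [mul_one] at this
  rw [← this]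
  rcases hm with rfl | rfl
  · exact dvd_mul_right _ _
  · exact dvd_mul_left _ _

variable (K : Type*) [Field K] [CharP K 2] [Finite K]

/-- A bound on the exponent and multiplicities of `M` by an element order in minus type. -/
def HasMinusExponent (M : Multiset F) : Prop :=
  ∃ m k, (∀ x ∈ M, x ^ m = 1) ∧ (∀ x, M.count x ≤ 2 ^ k) ∧ DvdMinusOrder K (m * 2 ^ k)

variable {K} {M : Multiset F}

theorem card_two_cases {q : ℕ} (h : IsReciprocalMultiset q M) (hq : Injective fun y : F => y ^ q)
    (hM : Multiset.card M = 2) : (∀ x ∈ M, x = 1) ∨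
      ∃ m, (m = q ^ 1 + 1 ∨ m = q ^ 1 - 1) ∧ (∀ x ∈ M, x ^ m = 1) ∧ ∀ x, M.count x ≤ 1 := by
  by_cases h1 : ∀ x ∈ M, x = 1
  · exact Or.inl h1
  right
  push Not at h1
  obtain ⟨x, hx, hx1⟩ := h1
  obtain ⟨d, O, hO, hxO, hc, hcard⟩ := h.exists_orbit hq hx hx1
  have hcx : 0 < M.count x := Multiset.count_pos.2 hx
  have hd := hO.pos
  rw [hM] at hcard
  have hdc : d * M.count x ≤ 1 := by nlinarith
  have hd1 : d = 1 := by nlinarith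
  have hc1 : M.count x = 1 := by nlinarith
  have h0 : M.filter (· ∉ O) = 0 := by
    rw [← Multiset.card_eq_zero]
    rw [hd1, hc1] at hcard; omega
  subst hd1
  obtain ⟨m, hm, hpow⟩ := hO.exists_pow_eq
  refine ⟨m, hm, pow_eq_one_of_filter hpow (by simp [h0]),
    count_filter_le hc hc1.le (by simp [h0])⟩

/-- An orbit with d ≥ 3 takes at least six of the eight eigenvalues, so it has multiplicity one and
at most a pair remains. -/
theorem hasMinusExponent_of_four (h : IsReciprocalMultiset (Nat.card K) M) {d : ℕ} {O : Finset F}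
    (hO : IsReciprocalOrbit (Nat.card K) d O) {x : F} (hx : x ∈ M)
    (hc : ∀ y ∈ O, M.count y = M.count x)
    (hcard : Multiset.card M = 2 * d * M.count x + Multiset.card (M.filter (· ∉ O)))
    (hM : Multiset.card M = 8) (hd : 3 ≤ d) (hq : Injective fun y : F => y ^ Nat.card K) :
    HasMinusExponent K M := by
  have hcx : 0 < M.count x := Multiset.count_pos.2 hx
  rw [hM] at hcard
  have hdc : d * M.count x ≤ 4 := by nlinarith
  have hd4 : d ≤ 4 := by nlinarith
  have hc1 : M.count x = 1 := by nlinarith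
  rw [hc1] at hcard hc
  obtain ⟨m, hm, hpow⟩ := hO.exists_pow_eq
  obtain rfl | rfl : d = 4 ∨ d = 3 := by omega
  · have h0 : M.filter (· ∉ O) = 0 := by
      rw [← Multiset.card_eq_zero]; omega
    refine ⟨m, 0, pow_eq_one_of_filter hpow (by simp [h0]),
      count_filter_le hc (by norm_num) (by simp [h0]), ?_⟩
    rw [pow_zero, mul_one]
    rcases hm with rfl | rfl
    · exact dvdMinusOrder_four_plus K
    · exact dvdMinusOrder_four_minus K
  · have hM' : Multiset.card (M.filter (· ∉ O)) = 2 := by omega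
    rcases card_two_cases (h.filter_notMem hO) hq hM' with h1 | ⟨m', hm', hpow', hc'⟩
    · refine ⟨m, 1, pow_eq_one_of_filter hpow fun y hy => by rw [h1 y hy, one_pow],
        count_filter_le hc (by norm_num) fun y => ?_, dvdMinusOrder_three K hm⟩
      exact (Multiset.count_le_card _ _).trans hM'.le
    · have key : ∀ n, m ∣ n → m' ∣ n → DvdMinusOrder K n → HasMinusExponent K M := by
        intro n h1 h2 h3
        refine ⟨n, 0, pow_eq_one_of_filter
          (fun y hy => pow_eq_one_of_dvd_of_pow_eq_one (hpow y hy) h1)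
          (fun y hy => pow_eq_one_of_dvd_of_pow_eq_one (hpow' y hy) h2),
          count_filter_le hc (by norm_num) hc', by rwa [pow_zero, mul_one]⟩
      -- When q³ ± 1 meets q ± 1 with equal signs the blocks would have plus type, but then m'
      -- divides m, and m divides an order obtained with opposite signs.
      rcases hm with rfl | rfl <;> rcases hm' with rfl | rfl
      · refine key _ dvd_rfl ?_ ((dvdMinusOrder_three_plus_one_minus K).of_dvd (dvd_mul_right _ _))
        rw [pow_one]; exact add_one_dvd_pow_three_add_one _
      · exact key _ (dvd_mul_right _ _) (dvd_mul_left _ _) (dvdMinusOrder_three_plus_one_minus K)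
      · exact key _ (dvd_mul_right _ _) (dvd_mul_left _ _) (dvdMinusOrder_three_minus_one_plus K)
      · refine key _ dvd_rfl ?_ ((dvdMinusOrder_three_minus_one_plus K).of_dvd (dvd_mul_right _ _))
        rw [pow_one]; exact Nat.sub_one_dvd_pow_sub_one' _ 3

/-- The orbit already has minus type, so the remaining four eigenvalues need a plus-type partner.
The cases depend on whether they are all 1, all simple, or include a repeated value together with
another eigenvalue or orbit. -/
theorem hasMinusExponent_of_two (h : IsReciprocalMultiset (Nat.card K) M) {O : Finset F}
    (hO : IsReciprocalOrbit (Nat.card K) 2 O) {x : F} (hx : x ∈ M)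
    (hc : ∀ y ∈ O, M.count y = M.count x)
    (hcard : Multiset.card M = 2 * 2 * M.count x + Multiset.card (M.filter (· ∉ O)))
    (hM : Multiset.card M = 8) (hq : Injective fun y : F => y ^ Nat.card K)
    (hpow : ∀ y ∈ O, y ^ (Nat.card K ^ 2 + 1) = 1) :
    HasMinusExponent K M := by
  have hcx : 0 < M.count x := Multiset.count_pos.2 hx
  rw [hM] at hcard
  obtain hc2 | hc1 : M.count x = 2 ∨ M.count x = 1 := by omega
  · rw [hc2] at hcard hc
    have h0 : M.filter (· ∉ O) = 0 := by
      rw [← Multiset.card_eq_zero]; omega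
    exact ⟨_, 1, pow_eq_one_of_filter hpow (by simp [h0]),
      count_filter_le hc (by norm_num) (by simp [h0]),
      (dvdMinusOrder_two K (Or.inl rfl)).of_dvd (mul_dvd_mul_left _ (by norm_num))⟩
  rw [hc1] at hcard hc
  have h' := h.filter_notMem hO
  set M' := M.filter (· ∉ O) with hM'def
  have hM' : Multiset.card M' = 4 := by omega
  by_cases hall : ∀ y ∈ M', y = 1
  · exact ⟨_, 2, pow_eq_one_of_filter hpow fun y hy => by rw [hall y hy, one_pow],
      count_filter_le hc (by norm_num) fun y => (Multiset.count_le_card _ _).trans hM'.le,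
      dvdMinusOrder_two K (Or.inl rfl)⟩
  have h41 : Nat.card K ^ 4 - 1 = (Nat.card K ^ 2 + 1) * (Nat.card K ^ 2 - 1) :=
    (add_one_mul_sub_one_pow 2).symm
  by_cases h2 : ∀ y ∈ M', M'.count y ≤ 1
  -- Without repetition no factor of two is needed. Every remaining orbit has d ≤ 2, so its exponent
  -- divides q⁴ - 1.
  · have hle : ∀ y, M'.count y ≤ 1 := fun y => by
      by_cases hy : y ∈ M'
      · exact h2 y hy
      · rw [Multiset.count_eq_zero_of_notMem hy]; omega
    refine ⟨Nat.card K ^ 4 - 1, 0, pow_eq_one_of_filter (O := O) (fun y hy => ?_) (fun y hy => ?_),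
      count_filter_le hc (by norm_num) hle, by
        rw [pow_zero, mul_one]; exact dvdMinusOrder_four_minus K⟩
    · exact pow_eq_one_of_dvd_of_pow_eq_one (hpow y hy) (h41 ▸ dvd_mul_right _ _)
    · by_cases hy1 : y = 1
      · rw [hy1, one_pow]
      obtain ⟨d, O', hO', hyO', hc', hcard'⟩ := h'.exists_orbit hq hy hy1
      have hcy : 0 < M'.count y := Multiset.count_pos.2 hy
      rw [hM'] at hcard'
      have hd0 := hO'.pos
      have hd2 : d ≤ 2 := by nlinarith
      obtain ⟨m, hm, hpow'⟩ := hO'.exists_pow_eq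
      refine pow_eq_one_of_dvd_of_pow_eq_one (hpow' y hyO') ?_
      rw [h41]
      obtain rfl | rfl : d = 2 ∨ d = 1 := by omega
      · rcases hm with rfl | rfl
        · exact dvd_mul_right _ _
        · exact dvd_mul_left _ _
      · exact (dvd_sq_sub_one hm).mul_left _
  push Not at h2
  obtain ⟨z, hz, hcz⟩ := h2
  have key : ∀ m : ℕ, (m = Nat.card K ^ 1 + 1 ∨ m = Nat.card K ^ 1 - 1) →
      (∀ y ∈ M', y ^ m = 1) → (∀ y, M'.count y ≤ 2) → HasMinusExponent K M := by
    intro m hm hpow' hc'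
    exact ⟨(Nat.card K ^ 2 + 1) * m, 1, pow_eq_one_of_filter
      (fun y hy => pow_eq_one_of_dvd_of_pow_eq_one (hpow y hy) (dvd_mul_right _ _))
      (fun y hy => pow_eq_one_of_dvd_of_pow_eq_one (hpow' y hy) (dvd_mul_left _ _)),
      count_filter_le hc (by norm_num) hc', dvdMinusOrder_two_one K hm⟩
  by_cases hz1 : z = 1
  · push Not at hall
    obtain ⟨y, hy, hy1⟩ := hall
    obtain ⟨d, O', hO', hyO', hc', hcard'⟩ := h'.exists_orbit hq hy hy1
    have hcy : 0 < M'.count y := Multiset.count_pos.2 hy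
    rw [hM'] at hcard'
    have h3 : 2 ≤ (M'.filter (· ∉ O')).count z := by
      rw [count_filter_notMem (by rw [hz1]; exact hO'.one_notMem)]; omega
    have h4 := Multiset.count_le_card z (M'.filter (· ∉ O'))
    have hd0 := hO'.pos
    have hd1 : d = 1 := by nlinarith
    have hc1 : M'.count y = 1 := by nlinarith
    subst hd1
    rw [hc1] at hcard' hc'
    obtain ⟨m, hm, hpow'⟩ := hO'.exists_pow_eq
    have h5 : ∀ w ∈ M'.filter (· ∉ O'), z = w :=
      Multiset.count_eq_card.1 (by omega)
    refine key m hm (pow_eq_one_of_filter hpow' fun w hw => ?_)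
      (count_filter_le hc' (by norm_num) fun w => (Multiset.count_le_card _ _).trans (by omega))
    rw [← h5 w hw, hz1, one_pow]
  · obtain ⟨d, O', hO', hzO', hc', hcard'⟩ := h'.exists_orbit hq hz hz1
    rw [hM'] at hcard'
    have hd0 := hO'.pos
    have hd1 : d = 1 := by nlinarith
    have hc2 : M'.count z = 2 := by nlinarith
    subst hd1
    rw [hc2] at hcard' hc'
    have h0 : M'.filter (· ∉ O') = 0 := by
      rw [← Multiset.card_eq_zero]; omega
    obtain ⟨m, hm, hpow'⟩ := hO'.exists_pow_eq
    exact key m hm (pow_eq_one_of_filter hpow' (by simp [h0]))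
      (count_filter_le hc' le_rfl (by simp [h0]))

/-- The exponent 4(q² - 1) works unless a multiplicity exceeds four. Only the eigenvalue 1 can be
that frequent, since any other brings along its inverse; then at most one simple pair differs from
1. -/
theorem hasMinusExponent_of_one (h : IsReciprocalMultiset (Nat.card K) M)
    (hM : Multiset.card M = 8) (hq : Injective fun y : F => y ^ Nat.card K)
    (hpow : ∀ y ∈ M, y ^ (Nat.card K ^ 2 - 1) = 1) : HasMinusExponent K M := by
  by_cases h4 : ∀ y, M.count y ≤ 4
  · exact ⟨_, 2, hpow, h4, dvdMinusOrder_two K (Or.inr rfl)⟩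
  push Not at h4
  obtain ⟨z, hz⟩ := h4
  have hzM : z ∈ M := Multiset.count_pos.1 (by omega)
  have hz1 : z = 1 := by
    by_contra hz1
    obtain ⟨d, O, hO, hzO, hc, hcard⟩ := h.exists_orbit hq hzM hz1
    have := hO.pos
    nlinarith
  subst hz1
  by_cases hall : ∀ y ∈ M, y = 1
  · exact ⟨_, 3, fun y hy => by rw [hall y hy, one_pow],
      fun y => (Multiset.count_le_card _ _).trans hM.le, dvdMinusOrder_one K (Or.inl rfl)⟩
  push Not at hall
  obtain ⟨y, hy, hy1⟩ := hall
  obtain ⟨d, O, hO, hyO, hc, hcard⟩ := h.exists_orbit hq hy hy1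
  have hcy : 0 < M.count y := Multiset.count_pos.2 hy
  have hd0 := hO.pos
  have h' := h.filter_notMem hO
  set M' := M.filter (· ∉ O) with hM'def
  have h5 : 5 ≤ M'.count 1 := by
    rw [hM'def, count_filter_notMem hO.one_notMem]; omega
  have h6 := Multiset.count_le_card 1 M'
  have hd1 : d = 1 := by nlinarith
  have hc1 : M.count y = 1 := by nlinarith
  subst hd1
  rw [hc1] at hcard hc
  have hall' : ∀ w ∈ M', w = 1 := by
    intro w hw
    by_contra hw1
    obtain ⟨d', O', hO', hwO', hc', hcard'⟩ := h'.exists_orbit hq hw hw1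
    have hcw : 0 < M'.count w := Multiset.count_pos.2 hw
    have h7 := Multiset.count_le_card 1 (M'.filter (· ∉ O'))
    rw [count_filter_notMem hO'.one_notMem] at h7
    have := hO'.pos
    nlinarith
  obtain ⟨m, hm, hpow'⟩ := hO.exists_pow_eq
  exact ⟨m, 3, pow_eq_one_of_filter hpow' fun w hw => by rw [hall' w hw, one_pow],
    fun w => (Multiset.count_le_card _ _).trans hM.le, dvdMinusOrder_one K hm⟩

/-- Orbits with d = 1, and those with d = 2 killed by q² - 1, consist of (q² - 1)-th roots of unity.
An eigenvalue that is not such a root lies in an orbit with d ≥ 3, or with d = 2 and exponent q² +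
1. -/
theorem IsReciprocalMultiset.hasMinusExponent (h : IsReciprocalMultiset (Nat.card K) M)
    (hM : Multiset.card M = 8) (hq : Injective fun y : F => y ^ Nat.card K) :
    HasMinusExponent K M := by
  by_cases hpow : ∀ y ∈ M, y ^ (Nat.card K ^ 2 - 1) = 1
  · exact hasMinusExponent_of_one h hM hq hpow
  push Not at hpow
  obtain ⟨x, hx, hx2⟩ := hpow
  have hx1 : x ≠ 1 := by rintro rfl; exact hx2 (one_pow _)
  obtain ⟨d, O, hO, hxO, hc, hcard⟩ := h.exists_orbit hq hx hx1
  by_cases hd : 3 ≤ d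
  · exact hasMinusExponent_of_four h hO hx hc hcard hM hd hq
  have hd0 := hO.pos
  obtain rfl | rfl : d = 1 ∨ d = 2 := by omega
  · obtain ⟨m, hm, hpow⟩ := hO.exists_pow_eq
    exact absurd (pow_eq_one_of_dvd_of_pow_eq_one (hpow x hxO) (dvd_sq_sub_one hm)) hx2
  · rcases hO.pow_eq with hpow | hpow
    · exact hasMinusExponent_of_two h hO hx hc hcard hM hq hpow
    · exact absurd (hpow x hxO) hx2

end Enumeration

/-! ### From symplectic matrices to eigenvalue multisets -/

section SymplecticOrders

open Polynomial

theorem roots_reverse_prod_X_sub_C {F : Type*} [Field F] (s : Multiset F) (h0 : (0 : F) ∉ s) :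
    ((s.map (X - C ·)).prod).reverse.roots = s.map (·⁻¹) := by
  have hone : (1 : F[X]).reverse = 1 := by simpa using reverse_C (1 : F)
  induction s using Multiset.induction with
  | empty => simp [hone]
  | cons a s ih =>
    have ha : a ≠ 0 := fun h => h0 (by simp [h])
    have h1 : (X - C a : F[X]).reverse = C (-a) * X + C 1 := by
      have : (X - C a : F[X]) = C (-a) + 1 * X := by simp; ring
      rw [this, reverse_C_add, reverse_mul_X, hone, one_mul, natDegree_X, pow_one, C_1]
    have h2 : (s.map (X - C ·)).prod.reverse ≠ 0 := by
      rw [Ne, reverse_eq_zero]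
      exact (monic_multisetProd_X_sub_C s).ne_zero
    have h3 : (X - C a : F[X]).reverse ≠ 0 := by
      rw [Ne, reverse_eq_zero]
      exact X_sub_C_ne_zero a
    rw [Multiset.map_cons, Multiset.prod_cons, reverse_mul_of_domain, roots_mul (mul_ne_zero h3 h2),
      ih fun h => h0 (Multiset.mem_cons_of_mem h), h1, roots_C_mul_X_add_C _ (neg_ne_zero.2 ha),
      Multiset.map_cons, Multiset.singleton_add]
    congr 1
    rw [mul_one, inv_neg, neg_neg]

variable {l : Type*} [DecidableEq l] [Fintype l]

/-- The inverse of A is conjugate under J to the transpose of A, so A and A⁻¹ have the same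
characteristic polynomial. Passing to the inverse reverses it up to the determinant, which is 1, and
a sign, which is trivial in even size. -/
theorem reverse_charpoly_of_mem_symplecticGroup {F : Type*} [Field F]
    {A : Matrix (l ⊕ l) (l ⊕ l) F} (hA : A ∈ Matrix.symplecticGroup l F) :
    A.charpoly.reverse = A.charpoly := by
  have hdet : A.det = 1 := SymplecticGroup.det_eq_one hA
  have hu : IsUnit A := (Matrix.isUnit_iff_isUnit_det A).2 (by rw [hdet]; exact isUnit_one)
  have h1 := Matrix.charpoly_inv A hu
  have hJ : Matrix.J l F * -Matrix.J l F = 1 := by rw [mul_neg, Matrix.J_squared, neg_neg]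
  have hJ' : -Matrix.J l F * Matrix.J l F = 1 := by rw [neg_mul, Matrix.J_squared, neg_neg]
  let u : (Matrix (l ⊕ l) (l ⊕ l) F)ˣ := ⟨-Matrix.J l F, Matrix.J l F, hJ', hJ⟩
  have h2 : A⁻¹ = u.val * A.transpose * (u⁻¹).val := by
    have := SymplecticGroup.coe_inv' ⟨A, hA⟩
    rw [← this]
    rfl
  have h3 : A⁻¹.charpoly = A.charpoly := by
    rw [h2, Matrix.coe_units_inv, Matrix.charpoly_units_conj, Matrix.charpoly_transpose]
  rw [h3, hdet, ← Matrix.reverse_charpoly] at h1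
  have h4 : (-1 : F[X]) ^ Fintype.card (l ⊕ l) = 1 := by
    rw [Fintype.card_sum, ← two_mul, pow_mul]; simp
  rw [h4] at h1
  simpa using h1.symm

variable {K : Type*} [Field K] [CharP K 2] [Finite K]

/-- Stability under inversion comes from the palindromic characteristic polynomial, stability under
x ↦ x^q from its coefficients lying in K. -/
theorem isReciprocalMultiset_roots_charpoly {F : Type*} [Field F] [IsAlgClosed F] [Algebra K F]
    {A : Matrix (l ⊕ l) (l ⊕ l) K} (hA : A ∈ Matrix.symplecticGroup l K) :
    IsReciprocalMultiset (Nat.card K) (A.charpoly.map (algebraMap K F)).roots := by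
  classical
  set p := A.charpoly.map (algebraMap K F) with hp
  have hmonic : p.Monic := A.charpoly_monic.map _
  have hsplit : p.Splits := IsAlgClosed.splits p
  have hpA : (A.map (algebraMap K F)).charpoly = p := Matrix.charpoly_map A (algebraMap K F)
  have hrev : p.reverse = p := by
    rw [← hpA]
    exact reverse_charpoly_of_mem_symplecticGroup (SymplecticGroup.map_mem hA (algebraMap K F))
  have hprod : (p.roots.map (X - C ·)).prod = p :=
    prod_multiset_X_sub_C_of_monic_of_roots_card_eq hmonic (splits_iff_card_roots.1 hsplit)
  have h0 : (0 : F) ∉ p.roots := by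
    intro h
    have h1 : p.eval 0 = 0 := (mem_roots'.1 h).2
    rw [← coeff_zero_eq_eval_zero, ← hrev, coeff_zero_reverse, hmonic.leadingCoeff] at h1
    exact one_ne_zero h1
  have hinv : p.roots.map (·⁻¹) = p.roots := by
    rw [← roots_reverse_prod_X_sub_C _ h0, hprod, hrev]
  cases nonempty_fintype K
  have hfrob : p.roots.map (· ^ Nat.card K) = p.roots := by
    have h1 := hsplit.roots_map (FiniteField.frobeniusAlgHom K F : F →+* F)
    rw [hp, Polynomial.map_map, AlgHom.comp_algebraMap, ← hp] at h1
    conv_rhs => rw [h1]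
    rw [Nat.card_eq_fintype_card]
    rfl
  have hqinj : Function.Injective fun x : F => x ^ Nat.card K := by
    rw [Nat.card_eq_fintype_card]
    exact (FiniteField.frobeniusAlgHom K F).toRingHom.injective
  refine ⟨h0, fun x => ?_, fun x => ?_⟩
  · conv_lhs => rw [← hinv]
    rw [Multiset.count_map_eq_count' _ _ inv_injective]
  · conv_lhs => rw [← hfrob]
    rw [Multiset.count_map_eq_count' _ _ hqinj]

/-- In characteristic two X^(m·2^k) - 1 = (X^m - 1)^(2^k), so every m-th root of unity is a root of
multiplicity at least 2^k. The characteristic polynomial therefore divides it, and Cayley–Hamilton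
applies. -/
theorem pow_eq_one_of_roots_charpoly {n : Type*} [DecidableEq n] [Fintype n]
    {F : Type*} [Field F] [IsAlgClosed F] [Algebra K F] [CharP F 2] [DecidableEq F]
    (A : Matrix n n K) {m k : ℕ} (hm : m ≠ 0)
    (hpow : ∀ x ∈ (A.charpoly.map (algebraMap K F)).roots, x ^ m = 1)
    (hcount : ∀ x, (A.charpoly.map (algebraMap K F)).roots.count x ≤ 2 ^ k) :
    A ^ (m * 2 ^ k) = 1 := by
  have h1 : (X ^ (m * 2 ^ k) - 1 : F[X]) = (X ^ m - 1) ^ 2 ^ k := by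
    rw [sub_pow_char_pow, one_pow, pow_mul]
  have hne : (X ^ m - 1 : F[X]) ≠ 0 := by
    have := (monic_X_pow_sub_C (1 : F) hm).ne_zero
    rwa [C_1] at this
  have h2 : A.charpoly ∣ X ^ (m * 2 ^ k) - 1 := by
    rw [← Polynomial.map_dvd_map' (algebraMap K F)]
    rw [Polynomial.map_sub, Polynomial.map_pow, map_X, Polynomial.map_one, h1]
    refine (IsAlgClosed.splits _).dvd_of_roots_le_roots
      (A.charpoly_monic.map _).ne_zero ?_
    rw [roots_pow, Multiset.le_iff_count]
    intro x
    by_cases hx : x ∈ (A.charpoly.map (algebraMap K F)).roots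
    · refine (hcount x).trans ?_
      rw [Multiset.count_nsmul]
      refine Nat.le_mul_of_pos_right _ (Multiset.count_pos.2 ?_)
      rw [mem_roots hne]
      simp [hpow x hx]
    · rw [Multiset.count_eq_zero_of_notMem hx]
      exact Nat.zero_le _
  obtain ⟨r, hr⟩ := h2
  have h3 := congrArg (aeval A) hr
  rw [map_mul, Matrix.aeval_self_charpoly, zero_mul, map_sub, map_pow, aeval_X, map_one,
    sub_eq_zero] at h3
  exact h3

theorem dvdMinusOrder_orderOf_symplecticGroup (A : Matrix.symplecticGroup (Fin 4) K) :
    DvdMinusOrder K (orderOf A) := by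
  classical
  let F := AlgebraicClosure K
  have : CharP F 2 := charP_of_injective_algebraMap (algebraMap K F).injective 2
  have hqinj : Function.Injective fun x : F => x ^ Nat.card K := by
    cases nonempty_fintype K
    rw [Nat.card_eq_fintype_card]
    exact (FiniteField.frobeniusAlgHom K F).toRingHom.injective
  have hM := isReciprocalMultiset_roots_charpoly (F := F) A.2
  have hcard : Multiset.card (A.1.charpoly.map (algebraMap K F)).roots = 8 := by
    rw [splits_iff_card_roots.1 (IsAlgClosed.splits _), natDegree_map,
      Matrix.charpoly_natDegree_eq_dim]
    simp
  obtain ⟨m, k, hpow, hcount, hd⟩ := hM.hasMinusExponent hcard hqinj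
  have hm : m ≠ 0 := by
    rintro rfl
    obtain ⟨N, hN, -, hdvd⟩ := hd
    rw [zero_mul] at hdvd
    exact hN (Nat.eq_zero_of_zero_dvd hdvd)
  refine hd.of_dvd (orderOf_dvd_of_pow_eq_one (Subtype.ext ?_))
  exact pow_eq_one_of_roots_charpoly (F := F) A.1 hm hpow (by convert hcount)

theorem elementOrders_symplecticGroup_subset {V : Type*} [AddCommGroup V] [Module K V]
    [FiniteDimensional K V] {Q : QuadraticForm K V} (hQ : IsMinusType 4 Q) :
    elementOrders (Matrix.symplecticGroup (Fin 4) K) ⊆ elementOrders (generalOrthogonalGroup Q) := by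
  rintro _ ⟨A, rfl⟩
  obtain ⟨N, hN, hmin, hdvd⟩ := dvdMinusOrder_orderOf_symplecticGroup A
  refine mem_elementOrders_of_dvd hN ?_ hdvd
  exact hmin.mem_elementOrders ((polarSeparating_iff_nondegenerate Q).2 hQ.nondegenerate)
    hQ.finrank_eq (by rw [hQ.gaussSumForm_eq]; ring)

end SymplecticOrders

/-! ### A model form inside the symplectic space -/

section Model

variable {K : Type*} [Field K]

variable (K) in
/-- Coordinates of a symplectic space grouped into planes. -/
def planeCoordinates (n : ℕ) : (Fin n ⊕ Fin n → K) ≃ₗ[K] (Fin n → K × K) where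
  toFun x i := (x (Sum.inl i), x (Sum.inr i))
  map_add' _ _ := rfl
  map_smul' _ _ := rfl
  invFun y := Sum.elim (fun i => (y i).1) fun i => (y i).2
  left_inv x := by ext (i | i) <;> rfl
  right_inv y := rfl

/-- The orthogonal sum of `x ^ 2 + x y + c y ^ 2` and `n` hyperbolic planes. -/
noncomputable def modelForm (n : ℕ) (c : K) :
    QuadraticForm K (Fin (n + 1) ⊕ Fin (n + 1) → K) :=
  (QuadraticMap.pi (Fin.cons (planeForm 1 c) fun _ => planeForm 0 0 :
    Fin (n + 1) → QuadraticForm K (K × K))).comp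
    (planeCoordinates K (n + 1)).toLinearMap

theorem modelForm_apply (n : ℕ) (c : K) (x : Fin (n + 1) ⊕ Fin (n + 1) → K) :
    modelForm n c x = planeForm 1 c (x (Sum.inl 0), x (Sum.inr 0)) +
      ∑ i : Fin n, x (Sum.inl i.succ) * x (Sum.inr i.succ) := by
  simp [modelForm, QuadraticMap.pi_apply, Fin.sum_univ_succ, planeCoordinates, planeForm_apply]

variable [CharP K 2]

/-- The coordinates are arranged so that the polar form is the standard J on the nose, the sign in J
being immaterial in characteristic two; isometries are then literally symplectic matrices. -/
theorem polar_modelForm (n : ℕ) (c : K) (x y : Fin (n + 1) ⊕ Fin (n + 1) → K) :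
    polar (modelForm n c) x y = x ⬝ᵥ (Matrix.J (Fin (n + 1)) K).mulVec y := by
  have h1 : ∀ i : Fin n, (x (Sum.inl i.succ) + y (Sum.inl i.succ)) *
      (x (Sum.inr i.succ) + y (Sum.inr i.succ)) = x (Sum.inl i.succ) * x (Sum.inr i.succ) +
      y (Sum.inl i.succ) * y (Sum.inr i.succ) + (x (Sum.inl i.succ) * y (Sum.inr i.succ) +
      x (Sum.inr i.succ) * y (Sum.inl i.succ)) := fun i => by ring
  have h2 := polar_planeForm 1 c (x (Sum.inl 0), x (Sum.inr 0)) (y (Sum.inl 0), y (Sum.inr 0))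
  have h3 : (Matrix.J (Fin (n + 1)) K).mulVec y =
      Sum.elim (fun i => y (Sum.inr i)) fun i => y (Sum.inl i) := by
    conv_lhs => rw [← Sum.elim_comp_inl_inr y]
    rw [Matrix.J, Matrix.fromBlocks_mulVec]
    ext (i | i) <;> simp [Matrix.neg_mulVec, CharTwo.neg_eq]
  rw [h3]
  simp only [polar, modelForm_apply, Pi.add_apply, h1, Finset.sum_add_distrib, dotProduct,
    Fintype.sum_sum_type, Sum.elim_inl, Sum.elim_inr, Fin.sum_univ_succ] at h2 ⊢
  simp only [Prod.mk_add_mk] at h2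
  linear_combination h2

theorem polarSeparating_modelForm (n : ℕ) (c : K) : PolarSeparating (modelForm n c) := by
  intro x hx
  have h1 : x = (Matrix.J (Fin (n + 1)) K).mulVec ((Matrix.J (Fin (n + 1)) K).mulVec x) := by
    rw [Matrix.mulVec_mulVec, Matrix.J_squared, CharTwo.neg_eq, Matrix.one_mulVec]
  refine dotProduct_eq_zero _ fun y => ?_
  have := hx ((Matrix.J (Fin (n + 1)) K).mulVec y)
  rwa [polar_modelForm, Matrix.mulVec_mulVec, Matrix.J_squared, CharTwo.neg_eq,
    Matrix.one_mulVec] at this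

omit [CharP K 2] in
theorem polar_generalOrthogonalGroup {V : Type*} [AddCommGroup V] [Module K V]
    {Q : QuadraticForm K V} (g : generalOrthogonalGroup Q) (x y : V) :
    polar Q (g.1 x) (g.1 y) = polar Q x y := by
  rw [polar, ← map_add, g.2, g.2, g.2, polar]

/-- The inclusion of the orthogonal group of the model form into the symplectic group. -/
noncomputable def modelToSymplectic (n : ℕ) (c : K) :
    generalOrthogonalGroup (modelForm n c) →* Matrix.symplecticGroup (Fin (n + 1)) K where
  toFun g := ⟨LinearMap.toMatrix' g.1.toLinearMap, by
    rw [SymplecticGroup.mem_iff']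
    have h : ∀ x y, polar (modelForm n c) (g.1 x) (g.1 y) = polar (modelForm n c) x y :=
      fun x y => polar_generalOrthogonalGroup g x y
    simp only [polar_modelForm] at h
    have hA : ∀ x, (LinearMap.toMatrix' g.1.toLinearMap).mulVec x = g.1 x := fun x => by
      rw [LinearMap.toMatrix'_mulVec]; rfl
    refine Matrix.ext fun i j => ?_
    have key : ∀ N : Matrix (Fin (n + 1) ⊕ Fin (n + 1)) (Fin (n + 1) ⊕ Fin (n + 1)) K,
        (Pi.single i 1) ⬝ᵥ N.mulVec (Pi.single j 1) = N i j := by simp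
    refine (key _).symm.trans (Eq.trans ?_ (key (Matrix.J (Fin (n + 1)) K)))
    rw [← Matrix.mulVec_mulVec, ← Matrix.mulVec_mulVec,
      Matrix.dotProduct_mulVec _ (Matrix.transpose _), Matrix.vecMul_transpose, hA, hA]
    exact h _ _⟩
  map_one' := by ext1; exact LinearMap.toMatrix'_one
  map_mul' g h := by ext1; exact LinearMap.toMatrix'_mul _ _

theorem modelToSymplectic_injective (n : ℕ) (c : K) :
    Function.Injective (modelToSymplectic n c) := fun g h hgh =>
  Subtype.ext (LinearEquiv.toLinearMap_injective
    (LinearMap.toMatrix'.injective (congrArg Subtype.val hgh)))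

theorem modelToSymplectic_not_surjective (n : ℕ) (c : K) :
    ¬ Function.Surjective (modelToSymplectic (n + 1) c) := by
  intro h
  obtain ⟨g, hg⟩ := h ⟨Matrix.fromBlocks 1 1 0 1, by
    rw [SymplecticGroup.mem_iff', Matrix.J]
    simp [Matrix.fromBlocks_transpose, Matrix.fromBlocks_multiply]⟩
  have hA : ∀ x, (Matrix.fromBlocks 1 1 0 1 : Matrix (Fin (n + 2) ⊕ Fin (n + 2)) _ K).mulVec x =
      g.1 x := fun x => by
    have hg' : LinearMap.toMatrix' g.1.toLinearMap = Matrix.fromBlocks 1 1 0 1 :=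
      congrArg Subtype.val hg
    rw [← hg']
    exact LinearMap.toMatrix'_mulVec _ _
  -- A singular basis vector of a hyperbolic plane is sent to the sum of the two basis vectors of
  -- that plane, on which the form is 1.
  have h1 := g.2 (Pi.single (Sum.inr 1) 1)
  rw [← hA, modelForm_apply, modelForm_apply] at h1
  simp [planeForm_apply, Matrix.fromBlocks_apply₁₂, Fin.sum_univ_succ] at h1
  have h2 : ∀ i : Fin n, (1 : Matrix (Fin (n + 2)) (Fin (n + 2)) K) i.succ.succ 1 = 0 := fun i =>
    Matrix.one_apply_ne (by rw [← Fin.succ_zero_eq_one]; simp [Fin.ext_iff])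
  have h3 : (1 : Matrix (Fin (n + 2)) (Fin (n + 2)) K) (Fin.succ 0) 1 = 1 := by
    rw [Fin.succ_zero_eq_one]; exact Matrix.one_apply_eq _
  simp [h2, h3] at h1

variable [Finite K]

theorem artinSchreierChar_sum {ι : Type*} (s : Finset ι) (f : ι → K) :
    artinSchreierChar K (∑ i ∈ s, f i) = ∏ i ∈ s, artinSchreierChar K (f i) := by
  classical
  induction s using Finset.induction with
  | empty => simp
  | insert i s hi ih => rw [Finset.sum_insert hi, Finset.prod_insert hi, AddChar.map_add_eq_mul, ih]

theorem gaussSumForm_modelForm (n : ℕ) (c : K) :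
    gaussSumForm (modelForm n c) = artinSchreierChar K c * Nat.card K ^ (n + 1) := by
  classical
  cases nonempty_fintype K
  let Qs : Fin (n + 1) → QuadraticForm K (K × K) := Fin.cons (planeForm 1 c) fun _ => planeForm 0 0
  have h1 : gaussSumForm (modelForm n c) = gaussSumForm (QuadraticMap.pi Qs) :=
    gaussSumForm_congr { planeCoordinates K (n + 1) with map_app' := fun x => rfl }
  have h2 : gaussSumForm (QuadraticMap.pi Qs) = ∏ i, gaussSumForm (Qs i) := by
    simp_rw [gaussSumForm_eq_sum]
    rw [Finset.prod_univ_sum, Fintype.piFinset_univ]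
    refine Finset.sum_congr rfl fun x _ => ?_
    rw [QuadraticMap.pi_apply, artinSchreierChar_sum]
  rw [h1, h2, Fin.prod_univ_succ]
  simp only [Qs, Fin.cons_zero, Fin.cons_succ, gaussSumForm_planeForm_one,
    gaussSumForm_planeForm_zero, Finset.prod_const, Finset.card_univ, Fintype.card_fin]
  ring

theorem isMinusType_modelForm (n : ℕ) {c : K} (hc : artinSchreierChar K c = -1) :
    IsMinusType (n + 1) (modelForm n c) := by
  refine isMinusType_of_gaussSumForm_neg (polarSeparating_modelForm n c) (by simp; ring) ?_ ?_
  · have : (0 : ℤ) < Nat.card K := by exact_mod_cast Nat.card_pos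
    rw [gaussSumForm_modelForm, hc]
    have := pow_pos this (n + 1)
    linarith
  -- The first coordinates of the n hyperbolic planes span a totally singular subspace.
  · let f : (Fin n → K) →ₗ[K] (Fin (n + 1) ⊕ Fin (n + 1) → K) :=
      { toFun := fun x => Sum.elim (Fin.cons 0 x) 0
        map_add' := fun x y => by
          ext (i | i)
          · refine Fin.cases ?_ (fun i => ?_) i <;> simp
          · simp
        map_smul' := fun r x => by
          ext (i | i)
          · refine Fin.cases ?_ (fun i => ?_) i <;> simp
          · simp }
    refine ⟨LinearMap.range f, ?_, ?_⟩
    · rintro _ ⟨x, rfl⟩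
      simp [f, modelForm_apply, planeForm_apply]
    · rw [LinearMap.finrank_range_of_inj, Module.finrank_fin_fun]
      intro x y hxy
      ext i
      simpa [f] using congrFun hxy (Sum.inl i.succ)

theorem elementOrders_subset_symplecticGroup {V : Type*} [AddCommGroup V] [Module K V]
    [FiniteDimensional K V] {n : ℕ} {Q : QuadraticForm K V} (hQ : IsMinusType (n + 1) Q) :
    elementOrders (generalOrthogonalGroup Q) ⊆
      elementOrders (Matrix.symplecticGroup (Fin (n + 1)) K) := by
  obtain ⟨c, hc⟩ := exists_artinSchreierChar_eq_neg_one (K := K)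
  obtain ⟨i⟩ := equivalent_of_gaussSumForm_eq (n + 1)
    ((polarSeparating_iff_nondegenerate Q).2 hQ.nondegenerate) (polarSeparating_modelForm n c)
    hQ.finrank_eq (by simp; ring) (by rw [hQ.gaussSumForm_eq, gaussSumForm_modelForm, hc]; ring)
  rw [elementOrders_congr (generalOrthogonalGroupCongr i)]
  rintro _ ⟨g, rfl⟩
  exact ⟨modelToSymplectic n c g, orderOf_injective _ (modelToSymplectic_injective n c) g⟩

/-- The symplectic group is not a section of the orthogonal group of minus type. -/
theorem not_hasOnlyNonabelianFactor_modelForm (n : ℕ) (c : K) :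
    ¬ HasOnlyNonabelianFactor (generalOrthogonalGroup (modelForm (n + 1) c))
      (Matrix.symplecticGroup (Fin (n + 2)) K) := by
  rintro ⟨s, i, ⟨e⟩, -, -⟩
  have hfinS : Finite (Matrix.symplecticGroup (Fin (n + 2)) K) := inferInstance
  have hfin : Finite (generalOrthogonalGroup (modelForm (n + 1) c)) :=
    Finite.of_injective _ (modelToSymplectic_injective (n + 1) c)
  -- A factor is a quotient of a subgroup, hence no larger than the group. If it were the symplectic
  -- group, the injective map into that group would be bijective.
  have h1 : Nat.card (s.factor i) ≤ Nat.card (generalOrthogonalGroup (modelForm (n + 1) c)) :=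
    (Nat.card_le_card_of_surjective _ Quotient.mk_surjective).trans
      (Nat.card_le_card_of_injective _ Subtype.val_injective)
  rw [Nat.card_congr e.toEquiv] at h1
  have h2 := (Nat.bijective_iff_injective_and_card (modelToSymplectic (n + 1) c)).2
    ⟨modelToSymplectic_injective (n + 1) c,
      le_antisymm (Nat.card_le_card_of_injective _ (modelToSymplectic_injective (n + 1) c)) h1⟩
  exact modelToSymplectic_not_surjective n c h2.2

end Model

/-! ### Reflections and Siegel transformations -/

section Isometries

open scoped commutatorElement

variable {K : Type*} [Field K] [CharP K 2] {V : Type*} [AddCommGroup V] [Module K V]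

/-- The reflection (orthogonal transvection) in a vector `v`; it is the identity if `v` is
singular. -/
def orthogonalReflection (Q : QuadraticForm K V) (v : V) : generalOrthogonalGroup Q :=
  ⟨LinearEquiv.ofInvolutive
    { toFun := fun x => x + ((Q v)⁻¹ * polar Q v x) • v
      map_add' := fun x y => by rw [polar_add_right]; module
      map_smul' := fun r x => by
        rw [polar_smul_right, smul_eq_mul, RingHom.id_apply]; module }
    (by
      intro x
      change x + ((Q v)⁻¹ * polar Q v x) • v +
        ((Q v)⁻¹ * polar Q v (x + ((Q v)⁻¹ * polar Q v x) • v)) • v = x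
      rw [polar_add_right, polar_smul_right, polar_self_eq_zero, smul_zero, add_zero]
      linear_combination (norm := module) (CharTwo.two_eq_zero (R := K)) •
        (((Q v)⁻¹ * polar Q v x) • v)), by
    intro x
    change Q (x + ((Q v)⁻¹ * polar Q v x) • v) = Q x
    rw [form_add, QuadraticMap.map_smul, polar_smul_right, smul_eq_mul, smul_eq_mul,
      polar_comm Q x v]
    by_cases hv : Q v = 0
    · simp [hv]
    · field_simp
      linear_combination (polar Q v x ^ 2) * CharTwo.two_eq_zero (R := K)⟩

theorem orthogonalReflection_apply (Q : QuadraticForm K V) (v x : V) :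
    (orthogonalReflection Q v).1 x = x + ((Q v)⁻¹ * polar Q v x) • v := rfl

theorem orthogonalReflection_apply_of_polar_eq_zero {Q : QuadraticForm K V} {v x : V}
    (h : polar Q v x = 0) : (orthogonalReflection Q v).1 x = x := by
  rw [orthogonalReflection_apply, h, mul_zero, zero_smul, add_zero]

theorem orthogonalReflection_mul_self (Q : QuadraticForm K V) (v : V) :
    orthogonalReflection Q v * orthogonalReflection Q v = 1 :=
  Subtype.ext (LinearEquiv.ext fun x =>
    (orthogonalReflection Q v).1.symm_apply_apply x)

theorem orthogonalReflection_add_apply {Q : QuadraticForm K V} {x y : V} (h : Q x = Q y)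
    (hxy : polar Q x y ≠ 0) : (orthogonalReflection Q (x + y)).1 x = y := by
  have h1 : Q (x + y) = polar Q x y := by
    rw [form_add, h, CharTwo.add_self_eq_zero, zero_add]
  rw [orthogonalReflection_apply, h1, polar_add_left, polar_self_eq_zero, zero_add,
    polar_comm Q y x, inv_mul_cancel₀ hxy, one_smul]
  linear_combination (norm := module) (CharTwo.two_eq_zero (R := K)) • x

theorem orthogonalReflection_smul {Q : QuadraticForm K V} {c : K} (hc : c ≠ 0) (v : V) :
    orthogonalReflection Q (c • v) = orthogonalReflection Q v := by
  refine Subtype.ext (LinearEquiv.ext fun x => ?_)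
  rw [orthogonalReflection_apply, orthogonalReflection_apply, QuadraticMap.map_smul,
    polar_smul_left, smul_eq_mul, smul_eq_mul, smul_smul]
  congr 2
  by_cases hv : Q v = 0
  · simp [hv]
  · field_simp

/-- The Siegel transformation `x ↦ x + B(a,x) u + B(u,x) a + Q(a) B(u,x) u` attached to a singular
vector `u` and a vector `a` orthogonal to `u`. -/
def siegel {Q : QuadraticForm K V} {u a : V} (hu : Q u = 0) (ha : polar Q u a = 0) :
    generalOrthogonalGroup Q :=
  ⟨LinearEquiv.ofInvolutive
    { toFun := fun x => x + polar Q a x • u + polar Q u x • a + (Q a * polar Q u x) • u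
      map_add' := fun x y => by rw [polar_add_right, polar_add_right]; module
      map_smul' := fun r x => by
        rw [polar_smul_right, polar_smul_right, smul_eq_mul, smul_eq_mul, RingHom.id_apply]
        module }
    (by
      have ha' : polar Q a u = 0 := by rw [polar_comm, ha]
      have haa : polar Q a a = 0 := polar_self_eq_zero Q a
      have huu : polar Q u u = 0 := polar_self_eq_zero Q u
      intro x
      simp only [LinearMap.coe_mk, AddHom.coe_mk, polar_add_right, polar_smul_right, ha, ha', haa,
        huu, smul_zero, add_zero]
      linear_combination (norm := module) (CharTwo.two_eq_zero (R := K)) •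
        (polar Q a x • u + polar Q u x • a + (Q a * polar Q u x) • u)), by
    intro x
    change Q (x + polar Q a x • u + polar Q u x • a + (Q a * polar Q u x) • u) = Q x
    have ha' : polar Q a u = 0 := by rw [polar_comm, ha]
    have huu : polar Q u u = 0 := polar_self_eq_zero Q u
    simp only [form_add, QuadraticMap.map_smul, polar_smul_right, polar_add_left, polar_smul_left,
      hu, ha, ha', huu, smul_eq_mul]
    rw [polar_comm Q x a, polar_comm Q x u]
    linear_combination (polar Q u x * polar Q a x + polar Q u x ^ 2 * Q a) *
      CharTwo.two_eq_zero (R := K)⟩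

section Siegel

variable {Q : QuadraticForm K V} {u a b : V}

theorem siegel_apply (hu : Q u = 0) (ha : polar Q u a = 0) (x : V) :
    (siegel hu ha).1 x =
      x + polar Q a x • u + polar Q u x • a + (Q a * polar Q u x) • u := rfl

theorem siegel_apply_of_polar_eq_zero (hu : Q u = 0) (ha : polar Q u a = 0) {x : V}
    (h : polar Q u x = 0) : (siegel hu ha).1 x = x + polar Q a x • u := by
  rw [siegel_apply, h]; simp

theorem polar_add_eq_zero (ha : polar Q u a = 0) (hb : polar Q u b = 0) :
    polar Q u (a + b) = 0 := by rw [polar_add_right, ha, hb, add_zero]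

theorem siegel_mul_siegel (hu : Q u = 0) (ha : polar Q u a = 0) (hb : polar Q u b = 0) :
    siegel hu ha * siegel hu hb = siegel hu (polar_add_eq_zero ha hb) := by
  have ha' : polar Q a u = 0 := by rw [polar_comm, ha]
  have huu : polar Q u u = 0 := polar_self_eq_zero Q u
  refine Subtype.ext (LinearEquiv.ext fun x => ?_)
  change (siegel hu ha).1 ((siegel hu hb).1 x) = _
  rw [siegel_apply, siegel_apply, siegel_apply]
  simp only [polar_add_right, polar_smul_right, polar_add_left, form_add, ha, hb, ha', huu,
    smul_eq_mul, mul_zero, add_zero]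
  module

theorem siegel_mul_self (hu : Q u = 0) (ha : polar Q u a = 0) : siegel hu ha * siegel hu ha = 1 :=
  Subtype.ext (LinearEquiv.ext fun x => (siegel hu ha).1.symm_apply_apply x)

theorem siegel_inv (hu : Q u = 0) (ha : polar Q u a = 0) : (siegel hu ha)⁻¹ = siegel hu ha :=
  inv_eq_of_mul_eq_one_left (siegel_mul_self hu ha)

theorem siegel_comm (hu : Q u = 0) (ha : polar Q u a = 0) (hb : polar Q u b = 0) :
    siegel hu ha * siegel hu hb = siegel hu hb * siegel hu ha := by
  rw [siegel_mul_siegel, siegel_mul_siegel]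
  congr 1
  exact add_comm a b

theorem siegel_conj (g : generalOrthogonalGroup Q) (hu : Q u = 0) (ha : polar Q u a = 0) :
    g * siegel hu ha * g⁻¹ = siegel (Q := Q) (u := g.1 u) (a := g.1 a) (by rw [g.2, hu])
      (by rw [polar_generalOrthogonalGroup, ha]) := by
  rw [mul_inv_eq_iff_eq_mul]
  refine Subtype.ext (LinearEquiv.ext fun x => ?_)
  change g.1 ((siegel hu ha).1 x) = g.1 x + polar Q (g.1 a) (g.1 x) • g.1 u +
    polar Q (g.1 u) (g.1 x) • g.1 a + (Q (g.1 a) * polar Q (g.1 u) (g.1 x)) • g.1 u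
  rw [siegel_apply]
  simp only [map_add, map_smul, polar_generalOrthogonalGroup]
  rw [g.2]

theorem siegel_zero_left (hu : Q (0 : V) = 0) (ha : polar Q 0 a = 0) : siegel hu ha = 1 := by
  refine Subtype.ext (LinearEquiv.ext fun x => ?_)
  rw [siegel_apply]
  simp

theorem siegel_smul_left (c : K) (hu : Q u = 0) (hu' : Q (c • u) = 0)
    (ha' : polar Q (c • u) a = 0) (ha'' : polar Q u (c • a) = 0) :
    siegel hu' ha' = siegel hu ha'' := by
  refine Subtype.ext (LinearEquiv.ext fun x => ?_)
  rw [siegel_apply, siegel_apply]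
  simp only [polar_smul_left, QuadraticMap.map_smul, smul_eq_mul]
  module

theorem siegel_add_smul (c : K) (hu : Q u = 0) (ha : polar Q u a = 0)
    (ha' : polar Q u (c • u + a) = 0) : siegel hu ha' = siegel hu ha := by
  refine Subtype.ext (LinearEquiv.ext fun x => ?_)
  rw [siegel_apply, siegel_apply]
  have hua : polar Q (c • u) a = 0 := by rw [polar_smul_left, ha, smul_zero]
  simp only [polar_smul_left, polar_add_left, form_add, QuadraticMap.map_smul, smul_eq_mul, hu, hua]
  linear_combination (norm := module) (CharTwo.two_eq_zero (R := K)) • ((c * polar Q u x) • u)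

/-- When both vectors are singular the formula is symmetric in them. This allows the commutator to
be rewritten with either vector as centre. -/
theorem siegel_symm {s : V} (hu : Q u = 0) (hs : Q s = 0) (h : polar Q u s = 0)
    (h' : polar Q s u = 0) : siegel hu h = siegel hs h' := by
  refine Subtype.ext (LinearEquiv.ext fun x => ?_)
  rw [siegel_apply, siegel_apply, hu, hs]
  module

/-- The commutator formula for Siegel transformations of a totally singular line. -/
theorem siegel_commutator {s : V} (hu : Q u = 0) (hs : Q s = 0) (hus : polar Q u s = 0)
    (ha : polar Q u a = 0) (hsa : polar Q s a = 0) (hub : polar Q u b = 0) (hb : polar Q s b = 0)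
    (hab : polar Q a b = 1) : ⁅siegel hu ha, siegel hs hb⁆ = siegel hu hus := by
  have has : polar Q a s = 0 := by rw [polar_comm, hsa]
  have hsu : polar Q s u = 0 := by rw [polar_comm, hus]
  have h1 : (siegel hu ha).1 s = s := by
    rw [siegel_apply_of_polar_eq_zero _ _ hus, has, zero_smul, add_zero]
  have h2 : (siegel hu ha).1 b = b + u := by
    rw [siegel_apply_of_polar_eq_zero _ _ hub, hab, one_smul]
  -- Conjugation fixes the centre s and replaces b by b + u; multiplying by the transformation of b
  -- again leaves the parameter u.
  rw [commutatorElement_def, siegel_conj, siegel_inv]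
  simp only [h1, h2]
  rw [siegel_symm hu hs hus hsu, siegel_mul_siegel]
  have h3 : b + u + b = u := by linear_combination (norm := module) (CharTwo.two_eq_zero (R := K)) • b
  congr 1

/-- The Siegel transformations of `u` are transitive on the singular vectors `v` with
`B(u,v) = 1`. -/
theorem siegel_apply_eq {v w : V} (hu : Q u = 0) (hv : Q v = 0) (hw : Q w = 0)
    (huv : polar Q u v = 1) (huvw : polar Q u (v + w) = 0) :
    (siegel hu huvw).1 v = w := by
  rw [siegel_apply, huv, polar_add_left, polar_self_eq_zero, form_add, hv, hw, polar_comm Q w v]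
  linear_combination (norm := module) (CharTwo.two_eq_zero (R := K)) • (v + polar Q v w • u)

/-- The product of two reflections in orthogonal vectors of the same norm. -/
theorem orthogonalReflection_mul_of_polar_eq_zero {v w : V} (hv : Q v = 1) (hw : Q w = 1)
    (hvw : polar Q v w = 0) (hu : Q (v + w) = 0) (ha : polar Q (v + w) v = 0) :
    orthogonalReflection Q v * orthogonalReflection Q w = siegel hu ha := by
  refine Subtype.ext (LinearEquiv.ext fun x => ?_)
  change (orthogonalReflection Q v).1 ((orthogonalReflection Q w).1 x) = _
  rw [orthogonalReflection_apply, orthogonalReflection_apply, siegel_apply, hv, hw]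
  simp only [polar_add_right, polar_add_left, polar_smul_right, hvw, inv_one, one_mul, smul_zero,
    add_zero]
  linear_combination (norm := module) (CharTwo.two_eq_zero (R := K)) •
    (-(polar Q v x) • (v + w) - polar Q w x • v)

end Siegel

end Isometries

/-! ### Auxiliary vectors and extension of isometries -/

section Existence

variable {K : Type*} [Field K] [CharP K 2] {V : Type*} [AddCommGroup V] [Module K V]
  {Q : QuadraticForm K V}

/-- Two singular vectors are both nonorthogonal to some singular vector. -/
theorem exists_singular_polar_ne_zero (hQ : PolarSeparating Q) {x y : V} (hx : x ≠ 0) (hy : y ≠ 0)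
    (hqx : Q x = 0) (hqy : Q y = 0) (hxy : polar Q x y = 0) :
    ∃ z, z ≠ 0 ∧ Q z = 0 ∧ polar Q x z ≠ 0 ∧ polar Q y z ≠ 0 := by
  suffices h : ∃ z, Q z = 0 ∧ polar Q x z ≠ 0 ∧ polar Q y z ≠ 0 by
    obtain ⟨z, h1, h2, h3⟩ := h
    refine ⟨z, ?_, h1, h2, h3⟩
    rintro rfl
    exact h2 (by simp)
  obtain ⟨f, hf, hxf⟩ := exists_hyperbolic_partner hQ hx hqx
  obtain ⟨f', hf', hyf'⟩ := exists_hyperbolic_partner hQ hy hqy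
  by_cases h1 : polar Q y f = 0
  · by_cases h2 : polar Q x f' = 0
    -- The multiple of x cancels Q(f + f') = B(f, f'), because B(x, f + f') = 1.
    · refine ⟨f + f' + polar Q f f' • x, ?_, ?_, ?_⟩
      · rw [form_add, form_add, hf, hf', QuadraticMap.map_smul, hqx, polar_smul_right,
          polar_add_left, polar_comm Q f x, hxf, polar_comm Q f' x, h2]
        simp only [smul_eq_mul]
        linear_combination polar Q f f' * CharTwo.two_eq_zero (R := K)
      · rw [polar_add_right, polar_add_right, polar_smul_right, hxf, h2, polar_self_eq_zero]
        simp
      · rw [polar_add_right, polar_add_right, polar_smul_right, hyf', h1, polar_comm Q y x, hxy]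
        simp
    · exact ⟨f', hf', h2, by rw [hyf']; exact one_ne_zero⟩
  · exact ⟨f, hf, by rw [hxf]; exact one_ne_zero, h1⟩

theorem finrank_ker_polar [FiniteDimensional K V] (Q : QuadraticForm K V) (v : V) :
    Module.finrank K V ≤ Module.finrank K (LinearMap.ker (Q.polarBilin v)) + 1 := by
  have h1 := LinearMap.finrank_range_add_finrank_ker (Q.polarBilin v)
  have h2 := Submodule.finrank_le (LinearMap.range (Q.polarBilin v))
  rw [Module.finrank_self] at h2
  omega

theorem finrank_le_pairOrthogonal_add_two [FiniteDimensional K V] (Q : QuadraticForm K V)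
    (v w : V) : Module.finrank K V ≤ Module.finrank K (pairOrthogonal Q v w) + 2 := by
  have h1 := finrank_ker_polar Q v
  have h2 := finrank_ker_polar Q w
  have h3 := Submodule.finrank_sup_add_finrank_inf_eq (LinearMap.ker (Q.polarBilin v))
    (LinearMap.ker (Q.polarBilin w))
  have h4 := Submodule.finrank_le (LinearMap.ker (Q.polarBilin v) ⊔ LinearMap.ker (Q.polarBilin w))
  rw [pairOrthogonal]
  omega

theorem PolarSeparating.exists_ne_zero [Nontrivial V] (hQ : PolarSeparating Q) : ∃ z, Q z ≠ 0 := by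
  by_contra! h
  obtain ⟨x, hx⟩ := exists_ne (0 : V)
  exact hx (hQ x fun y => by simp [polar, h])

/-- The subgroup generated by the reflections. -/
def reflectionSubgroup (Q : QuadraticForm K V) : Subgroup (generalOrthogonalGroup Q) :=
  Subgroup.closure {g | ∃ v, Q v ≠ 0 ∧ g = orthogonalReflection Q v}

theorem orthogonalReflection_mem {v : V} (hv : Q v ≠ 0) :
    orthogonalReflection Q v ∈ reflectionSubgroup Q :=
  Subgroup.subset_closure ⟨v, hv, rfl⟩

theorem exists_reflection_map {x y : V} (hqx : Q x = 0) (hqy : Q y = 0) (hxy : polar Q x y ≠ 0) :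
    Q (x + y) ≠ 0 ∧ (orthogonalReflection Q (x + y)).1 x = y :=
  ⟨by rwa [form_add, hqx, hqy, zero_add, zero_add],
    orthogonalReflection_add_apply (by rw [hqx, hqy]) hxy⟩

theorem exists_mem_reflectionSubgroup_map (hQ : PolarSeparating Q) {x y : V} (hx : x ≠ 0)
    (hy : y ≠ 0) (hqx : Q x = 0) (hqy : Q y = 0) : ∃ g ∈ reflectionSubgroup Q, g.1 x = y := by
  by_cases hxy : polar Q x y = 0
  · obtain ⟨z, hz, hqz, hxz, hyz⟩ := exists_singular_polar_ne_zero hQ hx hy hqx hqy hxy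
    obtain ⟨h1, h2⟩ := exists_reflection_map hqx hqz hxz
    obtain ⟨h3, h4⟩ := exists_reflection_map hqz hqy (by rwa [polar_comm])
    refine ⟨_, mul_mem (orthogonalReflection_mem h3) (orthogonalReflection_mem h1), ?_⟩
    change (orthogonalReflection Q (z + y)).1 ((orthogonalReflection Q (x + z)).1 x) = y
    rw [h2, h4]
  · obtain ⟨h1, h2⟩ := exists_reflection_map hqx hqy hxy
    exact ⟨_, orthogonalReflection_mem h1, h2⟩

/-- Elements of the orthogonal group agreeing on a hyperbolic pair and its complement are equal. -/
theorem generalOrthogonalGroup_ext_pair {e f : V} (hef : polar Q e f = 1)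
    {g h : generalOrthogonalGroup Q} (he : g.1 e = h.1 e) (hf : g.1 f = h.1 f)
    (hW : ∀ w ∈ pairOrthogonal Q e f, g.1 w = h.1 w) : g = h := by
  refine Subtype.ext (LinearEquiv.ext fun x => ?_)
  obtain ⟨⟨⟨a, b⟩, w⟩, rfl⟩ := (planeSplitting Q hef).toLinearEquiv.surjective x
  change g.1 (a • e + b • f + (w : V)) = h.1 (a • e + b • f + (w : V))
  simp only [map_add, map_smul, he, hf, hW w.1 w.2]

/-- Extension of isometries of the complement of a hyperbolic pair. -/
noncomputable def extendIsometry {e f : V} (hef : polar Q e f = 1) :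
    generalOrthogonalGroup (restrictForm Q (pairOrthogonal Q e f)) →* generalOrthogonalGroup Q :=
  ((generalOrthogonalGroupCongr (planeSplitting Q hef)).toMonoidHom.comp
    (generalOrthogonalGroupProd _ _)).comp (MonoidHom.inr _ _)

theorem extendIsometry_apply {e f : V} (hef : polar Q e f = 1)
    (h : generalOrthogonalGroup (restrictForm Q (pairOrthogonal Q e f))) (a b : K)
    (w : pairOrthogonal Q e f) :
    (extendIsometry hef h).1 (a • e + b • f + (w : V)) = a • e + b • f + (h.1 w : V) := by
  have h1 : (a • e + b • f + (w : V)) = (planeSplitting Q hef).toLinearEquiv ((a, b), w) := rfl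
  rw [h1]
  change (planeSplitting Q hef).toLinearEquiv ((generalOrthogonalGroupProd _ _ (1, h)).1
    ((planeSplitting Q hef).toLinearEquiv.symm _)) = _
  rw [LinearEquiv.symm_apply_apply]
  rfl

theorem extendIsometry_left {e f : V} (hef : polar Q e f = 1)
    (h : generalOrthogonalGroup (restrictForm Q (pairOrthogonal Q e f))) :
    (extendIsometry hef h).1 e = e := by
  simpa using extendIsometry_apply hef h 1 0 0

theorem extendIsometry_right {e f : V} (hef : polar Q e f = 1)
    (h : generalOrthogonalGroup (restrictForm Q (pairOrthogonal Q e f))) :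
    (extendIsometry hef h).1 f = f := by
  simpa using extendIsometry_apply hef h 0 1 0

theorem extendIsometry_coe {e f : V} (hef : polar Q e f = 1)
    (h : generalOrthogonalGroup (restrictForm Q (pairOrthogonal Q e f)))
    (w : pairOrthogonal Q e f) : (extendIsometry hef h).1 w = h.1 w := by
  simpa using extendIsometry_apply hef h 0 0 w

theorem extendIsometry_orthogonalReflection {e f : V} (hef : polar Q e f = 1)
    (v : pairOrthogonal Q e f) :
    extendIsometry hef (orthogonalReflection _ v) = orthogonalReflection Q (v : V) := by
  have hv := mem_pairOrthogonal.1 v.2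
  refine generalOrthogonalGroup_ext_pair hef ?_ ?_ fun w hw => ?_
  · rw [extendIsometry_left, orthogonalReflection_apply_of_polar_eq_zero]
    rw [polar_comm, hv.1]
  · rw [extendIsometry_right, orthogonalReflection_apply_of_polar_eq_zero]
    rw [polar_comm, hv.2]
  · exact extendIsometry_coe hef _ ⟨w, hw⟩

/-- An isometry fixing a hyperbolic pair is an extension of an isometry of the complement. -/
theorem exists_extendIsometry_eq {e f : V} (hef : polar Q e f = 1) {g : generalOrthogonalGroup Q}
    (he : g.1 e = e) (hf : g.1 f = f) : ∃ h, extendIsometry hef h = g := by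
  have hmap : ∀ (k : generalOrthogonalGroup Q), k.1 e = e → k.1 f = f →
      ∀ w ∈ pairOrthogonal Q e f, k.1 w ∈ pairOrthogonal Q e f := by
    intro k hke hkf w hw
    rw [mem_pairOrthogonal] at hw ⊢
    constructor
    · nth_rw 1 [← hke]; rw [polar_generalOrthogonalGroup, hw.1]
    · nth_rw 1 [← hkf]; rw [polar_generalOrthogonalGroup, hw.2]
  have he' : (g⁻¹).1 e = e := by
    nth_rw 1 [← he]; exact g.1.symm_apply_apply e
  have hf' : (g⁻¹).1 f = f := by
    nth_rw 1 [← hf]; exact g.1.symm_apply_apply f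
  let h : generalOrthogonalGroup (restrictForm Q (pairOrthogonal Q e f)) :=
    ⟨LinearEquiv.ofLinearMap (g.1.toLinearMap.restrict (hmap g he hf))
      ((g⁻¹).1.toLinearMap.restrict (hmap g⁻¹ he' hf'))
      (by ext w; exact g.1.apply_symm_apply w.1) (by ext w; exact g.1.symm_apply_apply w.1),
      fun w => g.2 w⟩
  refine ⟨h, generalOrthogonalGroup_ext_pair hef ?_ ?_ fun w hw => ?_⟩
  · rw [extendIsometry_left, he]
  · rw [extendIsometry_right, hf]
  · exact extendIsometry_coe hef h ⟨w, hw⟩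

variable [Finite K] [FiniteDimensional K V]

theorem exists_mem_form_ne_zero (hQ : PolarSeparating Q) {n : ℕ}
    (hn : Module.finrank K V = 2 * n) (hG : gaussSumForm Q < 0) (U : Submodule K V)
    (hU : n ≤ Module.finrank K U) : ∃ z ∈ U, Q z ≠ 0 := by
  by_contra! h
  exact (gaussSumForm_pos_of_isTotallySingular hQ hn U h hU).not_gt hG

theorem exists_orthogonal_nonsingular (hQ : PolarSeparating Q) {n : ℕ}
    (hn : Module.finrank K V = 2 * n) (hG : gaussSumForm Q < 0) (h0 : 1 ≤ n) (v : V) :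
    ∃ z, polar Q v z = 0 ∧ Q z ≠ 0 := by
  obtain ⟨z, hz, hz'⟩ := exists_mem_form_ne_zero hQ hn hG (LinearMap.ker (Q.polarBilin v))
    (by have := finrank_ker_polar Q v; omega)
  exact ⟨z, hz, hz'⟩

theorem exists_orthogonal_pair_nonsingular (hQ : PolarSeparating Q) {n : ℕ}
    (hn : Module.finrank K V = 2 * n) (hG : gaussSumForm Q < 0) (h0 : 2 ≤ n) (v w : V) :
    ∃ z, polar Q v z = 0 ∧ polar Q w z = 0 ∧ Q z ≠ 0 := by
  obtain ⟨z, hz, hz'⟩ := exists_mem_form_ne_zero hQ hn hG (pairOrthogonal Q v w)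
    (by have := finrank_le_pairOrthogonal_add_two Q v w; omega)
  exact ⟨z, hz.1, hz.2, hz'⟩

/-- In an anisotropic plane the reflections generate the orthogonal group. -/
theorem reflectionSubgroup_eq_top_of_finrank_two (hQ : PolarSeparating Q)
    (hn : Module.finrank K V = 2) (hani : ∀ x, Q x = 0 → x = 0) : reflectionSubgroup Q = ⊤ := by
  have : Nontrivial V := Module.nontrivial_of_finrank_pos (R := K) (by omega)
  obtain ⟨v, hv⟩ := exists_ne (0 : V)
  have hqv : Q v ≠ 0 := fun h => hv (hani v h)
  -- An isometry fixing v sends w to w + cv, and invariance of the form gives c(cQ(v) + 1) = 0. So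
  -- it is the identity or the reflection in v.
  have key : ∀ g : generalOrthogonalGroup Q, g.1 v = v → g ∈ reflectionSubgroup Q := by
    intro g hg
    obtain ⟨w, hw⟩ := hQ.exists_polar_eq_one hv
    have hsub : Subsingleton (pairOrthogonal Q v w) := by
      have := finrank_pairOrthogonal Q hw
      exact Module.finrank_zero_iff (R := K).1 (by omega)
    have hW : ∀ x ∈ pairOrthogonal Q v w, x = 0 := fun x hx =>
      congrArg Subtype.val (Subsingleton.elim (⟨x, hx⟩ : pairOrthogonal Q v w) 0)
    have h1 : polar Q v (g.1 w) = 1 := by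
      nth_rw 1 [← hg]; rw [polar_generalOrthogonalGroup, hw]
    set c := polar Q w (g.1 w) with hc
    have h2 : g.1 w = c • v + w := by
      have h0 : g.1 w + c • v + w = 0 := by
        refine hW _ (mem_pairOrthogonal.2 ⟨?_, ?_⟩)
        · rw [polar_add_right, polar_add_right, h1, polar_smul_right, polar_self_eq_zero, hw,
            smul_zero, add_zero, CharTwo.add_self_eq_zero]
        · rw [polar_add_right, polar_add_right, polar_smul_right, polar_comm Q w v, hw, ← hc,
            polar_self_eq_zero, smul_eq_mul, mul_one, add_zero, CharTwo.add_self_eq_zero]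
      linear_combination (norm := module) h0 - (CharTwo.two_eq_zero (R := K)) • (c • v + w)
    have h3 : c * (c * Q v + 1) = 0 := by
      have := g.2 w
      rw [h2, form_add, QuadraticMap.map_smul, polar_smul_left, hw, smul_eq_mul, smul_eq_mul] at this
      linear_combination this
    rcases mul_eq_zero.1 h3 with h4 | h4
    · have : g = 1 := generalOrthogonalGroup_ext_pair hw hg (by rw [h2, h4]; simp)
        fun x hx => by rw [hW x hx, map_zero, map_zero]
      rw [this]; exact one_mem _
    · have h5 : c = (Q v)⁻¹ := by
        rw [CharTwo.add_eq_zero] at h4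
        exact eq_inv_of_mul_eq_one_left h4
      have : g = orthogonalReflection Q v := generalOrthogonalGroup_ext_pair hw
        (by rw [hg, orthogonalReflection_apply_of_polar_eq_zero (polar_self_eq_zero Q v)])
        (by rw [h2, h5, orthogonalReflection_apply, hw, mul_one, add_comm])
        fun x hx => by rw [hW x hx, map_zero, map_zero]
      rw [this]; exact orthogonalReflection_mem hqv
  rw [eq_top_iff]
  intro g _
  by_cases hg : g.1 v = v
  · exact key g hg
  have h1 : v + g.1 v ≠ 0 := by
    intro h
    apply hg
    linear_combination (norm := module) h - (CharTwo.two_eq_zero (R := K)) • v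
  have h2 : Q (v + g.1 v) ≠ 0 := fun h => h1 (hani _ h)
  have h3 : polar Q (g.1 v) v ≠ 0 := by
    rw [form_add, g.2, CharTwo.add_self_eq_zero, zero_add, polar_comm] at h2
    exact h2
  have h4 := orthogonalReflection_add_apply (g.2 v) h3
  rw [add_comm] at h4
  have h5 := key (orthogonalReflection Q (v + g.1 v) * g) h4
  exact (Subgroup.mul_mem_cancel_left _ (orthogonalReflection_mem h2)).1 h5

end Existence

/-! ### Generation by reflections -/

section Generation

variable {K : Type*} [Field K] [CharP K 2] [Finite K]

theorem gaussSumForm_pairOrthogonal_neg {V : Type*} [AddCommGroup V] [Module K V]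
    [FiniteDimensional K V] {Q : QuadraticForm K V} {e f : V} (he : Q e = 0) (hf : Q f = 0)
    (hef : polar Q e f = 1) (hG : gaussSumForm Q < 0) :
    gaussSumForm (restrictForm Q (pairOrthogonal Q e f)) < 0 := by
  rw [gaussSumForm_pairOrthogonal he hf hef] at hG
  have : (0 : ℤ) < Nat.card K := by exact_mod_cast Nat.card_pos
  by_contra! h
  nlinarith

/-- The orthogonal group of a form of minus type is generated by reflections. -/
theorem reflectionSubgroup_eq_top (n : ℕ) :
    ∀ {V : Type*} [AddCommGroup V] [Module K V] [FiniteDimensional K V] {Q : QuadraticForm K V},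
      PolarSeparating Q → Module.finrank K V = 2 * n → gaussSumForm Q < 0 →
      reflectionSubgroup Q = ⊤ := by
  induction n with
  | zero =>
    intro V _ _ _ Q _ hn _
    have : Subsingleton V := Module.finrank_zero_iff (R := K).1 (by omega)
    rw [eq_top_iff]
    intro g _
    have : g = 1 := Subtype.ext (LinearEquiv.ext fun x => Subsingleton.elim _ _)
    rw [this]
    exact one_mem _
  | succ n ih =>
    intro V _ _ _ Q hQ hn hG
    by_cases hani : ∀ x, Q x = 0 → x = 0
    · have : Finite V := Module.finite_of_finite K
      have hn1 : n = 0 := by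
        by_contra h0
        obtain ⟨x, hx, hqx⟩ := exists_singular hQ hn (Or.inl (by omega))
        exact hx (hani x hqx)
      subst hn1
      exact reflectionSubgroup_eq_top_of_finrank_two hQ hn hani
    push Not at hani
    obtain ⟨e, he, he0⟩ := hani
    obtain ⟨f, hf, hef⟩ := exists_hyperbolic_partner hQ he0 he
    have hf0 : f ≠ 0 := by
      rintro rfl
      simp at hef
    have hQW := polarSeparating_pairOrthogonal hQ hef
    have hnW : Module.finrank K (pairOrthogonal Q e f) = 2 * n := by
      have := finrank_pairOrthogonal Q hef
      omega
    have hGW := gaussSumForm_pairOrthogonal_neg he hf hef hG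
    have hn0 : 1 ≤ n := by
      by_contra h
      have := gaussSumForm_pos_of_isTotallySingular hQW hnW ⊥ (by
        intro x hx
        rw [Submodule.mem_bot] at hx
        rw [hx, map_zero]) (by omega)
      omega
    -- The reflection in g(f) + f moves g(f) back to f and still fixes e, so the product is an
    -- isometry of the complement and the induction hypothesis applies.
    have key : ∀ g : generalOrthogonalGroup Q, g.1 e = e → polar Q f (g.1 f) ≠ 0 →
        g ∈ reflectionSubgroup Q := by
      intro g hge hgf
      have hqgf : Q (g.1 f) = 0 := by rw [g.2, hf]
      obtain ⟨h1, h2⟩ := exists_reflection_map hqgf hf (by rwa [polar_comm])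
      have h3 : (orthogonalReflection Q (g.1 f + f)).1 e = e := by
        apply orthogonalReflection_apply_of_polar_eq_zero
        rw [polar_comm, polar_add_right, hef]
        nth_rw 1 [← hge]
        rw [polar_generalOrthogonalGroup, hef, CharTwo.add_self_eq_zero]
      obtain ⟨h, hh⟩ := exists_extendIsometry_eq hef
        (g := orthogonalReflection Q (g.1 f + f) * g) (by
          change (orthogonalReflection Q (g.1 f + f)).1 (g.1 e) = e
          rw [hge, h3]) h2
      rw [← Subgroup.mul_mem_cancel_left _ (orthogonalReflection_mem h1), ← hh]
      have h4 : h ∈ reflectionSubgroup (restrictForm Q (pairOrthogonal Q e f)) := by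
        rw [ih hQW hnW hGW]; trivial
      have h5 : reflectionSubgroup (restrictForm Q (pairOrthogonal Q e f)) ≤
          (reflectionSubgroup Q).comap (extendIsometry hef) := by
        rw [reflectionSubgroup, Subgroup.closure_le]
        rintro _ ⟨v, hv, rfl⟩
        change extendIsometry hef (orthogonalReflection _ v) ∈ reflectionSubgroup Q
        rw [extendIsometry_orthogonalReflection]
        exact orthogonalReflection_mem hv
      exact h5 h4
    have key2 : ∀ g : generalOrthogonalGroup Q, g.1 e = e → g ∈ reflectionSubgroup Q := by
      intro g hge
      by_cases hgf : polar Q f (g.1 f) = 0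
      · obtain ⟨b, hb, hqb⟩ : ∃ b : pairOrthogonal Q e f, polar Q (g.1 f) b = 0 ∧ Q b ≠ 0 := by
          obtain ⟨b, hb, hqb⟩ := exists_mem_form_ne_zero hQW hnW hGW
            (LinearMap.ker ((Q.polarBilin (g.1 f)).comp (pairOrthogonal Q e f).subtype)) (by
              have h1 := LinearMap.finrank_range_add_finrank_ker
                ((Q.polarBilin (g.1 f)).comp (pairOrthogonal Q e f).subtype)
              have h2 := Submodule.finrank_le (LinearMap.range
                ((Q.polarBilin (g.1 f)).comp (pairOrthogonal Q e f).subtype))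
              rw [Module.finrank_self] at h2
              omega)
          exact ⟨b, hb, hqb⟩
        have hbW := mem_pairOrthogonal.1 b.2
        have hbe : polar Q (b : V) e = 0 := by rw [polar_comm, hbW.1]
        have hegf : polar Q e (g.1 f) = 1 := by
          nth_rw 1 [← hge]; rw [polar_generalOrthogonalGroup, hef]
        -- The vector `b + Q(b) e` gives a reflection moving `g f` off `f`.
        set s : V := b + Q b • e with hs
        have hqs : Q s = Q b := by
          rw [hs, form_add, QuadraticMap.map_smul, he, polar_smul_right, hbe]; simp
        have h1 : (orthogonalReflection Q s).1 e = e := by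
          apply orthogonalReflection_apply_of_polar_eq_zero
          rw [hs, polar_add_left, polar_smul_left, hbe, polar_self_eq_zero]; simp
        have h2 : polar Q s (g.1 f) = Q b := by
          rw [hs, polar_add_left, polar_smul_left, polar_comm Q (b : V), hb, hegf]; simp
        have h3 : polar Q f s = Q b := by
          rw [hs, polar_add_right, polar_smul_right, hbW.2, polar_comm Q f e, hef]; simp
        have h4 := key (orthogonalReflection Q s * g) (by
          change (orthogonalReflection Q s).1 (g.1 e) = e
          rw [hge, h1]) (by
          change polar Q f ((orthogonalReflection Q s).1 (g.1 f)) ≠ 0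
          rw [orthogonalReflection_apply, polar_add_right, polar_smul_right, hgf, h2, h3, hqs,
            inv_mul_cancel₀ hqb, one_smul, zero_add]
          exact hqb)
        exact (Subgroup.mul_mem_cancel_left _ (orthogonalReflection_mem (by rwa [hqs]))).1 h4
      · exact key g hge hgf
    rw [eq_top_iff]
    intro g _
    obtain ⟨r, hr, hre⟩ := exists_mem_reflectionSubgroup_map hQ (x := g.1 e) (y := e)
      (by simpa using he0) he0 (by rw [g.2, he]) he
    exact (Subgroup.mul_mem_cancel_left _ hr).1 (key2 (r * g) hre)

end Generation

/-! ### The group generated by Siegel transformations -/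

section SiegelSubgroup

variable {K : Type*} [Field K] [Finite K] [CharP K 2] {V : Type*} [AddCommGroup V] [Module K V]
  {Q : QuadraticForm K V}

/-- The subgroup generated by the Siegel transformations. -/
def siegelSubgroup (Q : QuadraticForm K V) : Subgroup (generalOrthogonalGroup Q) :=
  Subgroup.closure {g | ∃ (u a : V) (hu : Q u = 0) (ha : polar Q u a = 0), g = siegel hu ha}

theorem siegel_mem {u a : V} (hu : Q u = 0) (ha : polar Q u a = 0) :
    siegel hu ha ∈ siegelSubgroup Q :=
  Subgroup.subset_closure ⟨u, a, hu, ha, rfl⟩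

instance siegelSubgroup_normal : (siegelSubgroup Q).Normal := by
  refine ⟨fun n hn g => ?_⟩
  have h : siegelSubgroup Q ≤ (siegelSubgroup Q).comap (MulAut.conj g).toMonoidHom := by
    rw [siegelSubgroup, Subgroup.closure_le]
    rintro _ ⟨u, a, hu, ha, rfl⟩
    change g * siegel hu ha * g⁻¹ ∈ siegelSubgroup Q
    rw [siegel_conj]
    exact siegel_mem _ _
  exact h hn

theorem siegel_zero_right {u : V} (hu : Q u = 0) (h : polar Q u 0 = 0) : siegel hu h = 1 := by
  rw [siegel_symm hu (map_zero Q) h (by rw [polar_comm, h]), siegel_zero_left]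

theorem siegel_eq_mul {u a b c : V} (hu : Q u = 0) (ha : polar Q u a = 0) (hb : polar Q u b = 0)
    (hc : polar Q u c = 0) (h : a = b + c) : siegel hu ha = siegel hu hb * siegel hu hc := by
  subst h
  rw [siegel_mul_siegel]

section Perfect

variable [FiniteDimensional K V]

/-- Two hyperbolic planes containing u and s use four dimensions. From dimension six on, their
complement contains a, b with B(a, b) = 1, and the commutator formula yields the given
transformation. -/
theorem siegel_mem_commutator_of_singular (hQ : PolarSeparating Q)
    (hn : 6 ≤ Module.finrank K V) {u f : V} (hu : Q u = 0) (huf : polar Q u f = 1)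
    (s : pairOrthogonal Q u f) (hs : Q s = 0) :
    siegel hu s.2.1 ∈ ⁅siegelSubgroup Q, siegelSubgroup Q⁆ := by
  by_cases hs0 : s = 0
  · subst hs0
    have : siegel hu (0 : pairOrthogonal Q u f).2.1 = 1 := siegel_zero_right hu _
    rw [this]
    exact one_mem _
  have hW := polarSeparating_pairOrthogonal hQ huf
  obtain ⟨t, ht, hst⟩ := exists_hyperbolic_partner hW hs0 hs
  have h1 := finrank_pairOrthogonal Q huf
  have h2 := finrank_pairOrthogonal (restrictForm Q (pairOrthogonal Q u f)) hst
  have : Nontrivial (pairOrthogonal (restrictForm Q (pairOrthogonal Q u f)) s t) :=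
    Module.nontrivial_of_finrank_pos (R := K) (by omega)
  obtain ⟨a, ha⟩ := exists_ne (0 : pairOrthogonal (restrictForm Q (pairOrthogonal Q u f)) s t)
  obtain ⟨b, hab⟩ := (polarSeparating_pairOrthogonal hW hst).exists_polar_eq_one ha
  have h := siegel_commutator (Q := Q) (u := u) (s := s) (a := (a : pairOrthogonal Q u f))
    (b := (b : pairOrthogonal Q u f)) hu hs s.2.1 a.1.2.1 a.2.1 b.1.2.1 b.2.1 hab
  rw [← h]
  exact Subgroup.commutator_mem_commutator (siegel_mem _ _) (siegel_mem _ _)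

/-- The group generated by the Siegel transformations is perfect. -/
theorem siegelSubgroup_le_commutator (hQ : PolarSeparating Q) {n : ℕ}
    (hn : Module.finrank K V = 2 * n) (h3 : 3 ≤ n) :
    siegelSubgroup Q ≤ ⁅siegelSubgroup Q, siegelSubgroup Q⁆ := by
  conv_lhs => rw [siegelSubgroup]
  rw [Subgroup.closure_le]
  rintro _ ⟨u, a, hu, ha, rfl⟩
  change siegel hu ha ∈ _
  by_cases hu0 : u = 0
  · subst hu0
    rw [siegel_zero_left]
    exact one_mem _
  obtain ⟨f, -, huf⟩ := exists_hyperbolic_partner hQ hu0 hu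
  have huu : polar Q u u = 0 := polar_self_eq_zero Q u
  have hfu : polar Q f u = 1 := by rw [polar_comm, huf]
  have hw : a + polar Q f a • u ∈ pairOrthogonal Q u f := by
    rw [mem_pairOrthogonal]
    simp only [polar_add_right, polar_smul_right, ha, huu, hfu, smul_eq_mul]
    simp [CharTwo.add_self_eq_zero]
  obtain ⟨w, hw'⟩ : ∃ w : pairOrthogonal Q u f, (w : V) = a + polar Q f a • u := ⟨⟨_, hw⟩, rfl⟩
  have hwa : siegel hu ha = siegel hu w.2.1 := by
    rw [← siegel_add_smul (polar Q f a) hu ha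
      (by rw [polar_add_right, polar_smul_right, huu, ha]; simp)]
    congr 1
    rw [hw', add_comm]
  rw [hwa]
  have hWn := finrank_pairOrthogonal Q huf
  obtain ⟨e, g, he, hg, heg⟩ := exists_hyperbolic_pair (polarSeparating_pairOrthogonal hQ huf)
    (n := n - 1) (by omega) (Or.inl (by omega))
  obtain ⟨p, hp⟩ : ∃ p, polar Q (w : V) (e : V) = p := ⟨_, rfl⟩
  obtain ⟨r, hr⟩ : ∃ r, polar Q (w : V) (g : V) = r := ⟨_, rfl⟩
  have he' : Q (e : V) = 0 := he
  have hg' : Q (g : V) = 0 := hg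
  have heg' : polar Q (e : V) (g : V) = 1 := heg
  -- The vector w is written as a sum of the singular vectors w + αe + βg, αe and βg. The value of Q
  -- at the first is Q(w) + αp + β(α + r); the choice α = r + 1 makes the coefficient of β equal to
  -- 1, and β is then solved for.
  set α := r + 1 with hα
  set β := p + Q (w : V) + p * r with hβ
  have hsing : Q ((w + (α • e + β • g) : pairOrthogonal Q u f) : V) = 0 := by
    simp only [Submodule.coe_add, Submodule.coe_smul, form_add, polar_add_right, polar_smul_left,
      polar_smul_right, QuadraticMap.map_smul, he', hg', hp, hr, heg', smul_eq_mul, hα, hβ]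
    linear_combination (Q (w : V) + r * p + p + r * Q (w : V) + r ^ 2 * p + r * p) *
      CharTwo.two_eq_zero (R := K)
  rw [siegel_eq_mul hu w.2.1 (w + (α • e + β • g)).2.1 (α • e + β • g).2.1 (by
      refine congrArg Subtype.val (?_ : w = w + (α • e + β • g) + (α • e + β • g))
      linear_combination (norm := module) -(CharTwo.two_eq_zero (R := K)) • (α • e + β • g)),
    siegel_eq_mul hu (α • e + β • g).2.1 (α • e).2.1 (β • g).2.1 rfl]
  have h6 : 6 ≤ Module.finrank K V := by omega
  refine mul_mem ?_ (mul_mem ?_ ?_)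
  · exact siegel_mem_commutator_of_singular hQ h6 hu huf _ hsing
  · exact siegel_mem_commutator_of_singular hQ h6 hu huf _ (by
      rw [Submodule.coe_smul, QuadraticMap.map_smul, he', smul_zero])
  · exact siegel_mem_commutator_of_singular hQ h6 hu huf _ (by
      rw [Submodule.coe_smul, QuadraticMap.map_smul, hg', smul_zero])

theorem exists_normalize {v : V} (hv : Q v ≠ 0) :
    ∃ c : K, c ≠ 0 ∧ Q (c • v) = 1 := by
  obtain ⟨c, hc⟩ := exists_sq_eq (Q v)⁻¹
  refine ⟨c, ?_, ?_⟩
  · rintro rfl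
    rw [zero_pow two_ne_zero, eq_comm, inv_eq_zero] at hc
    exact hv hc
  · rw [QuadraticMap.map_smul, smul_eq_mul, ← pow_two, hc, inv_mul_cancel₀ hv]

theorem orthogonalReflection_mul_mem_of_polar_eq_zero {v w : V} (hv : Q v = 1) (hw : Q w = 1)
    (hvw : polar Q v w = 0) :
    orthogonalReflection Q v * orthogonalReflection Q w ∈ siegelSubgroup Q := by
  rw [orthogonalReflection_mul_of_polar_eq_zero hv hw hvw
    (by rw [form_add, hv, hw, hvw, add_zero, CharTwo.add_self_eq_zero])
    (by rw [polar_add_left, polar_self_eq_zero, polar_comm, hvw, add_zero])]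
  exact siegel_mem _ _

/-- After rescaling to norm one, the reflection in a third vector orthogonal to both is inserted
twice. Each of the two resulting products is a Siegel transformation. -/
theorem orthogonalReflection_mul_mem (hQ : PolarSeparating Q) {n : ℕ}
    (hn : Module.finrank K V = 2 * n) (hG : gaussSumForm Q < 0) (h2 : 2 ≤ n) {v w : V}
    (hv : Q v ≠ 0) (hw : Q w ≠ 0) :
    orthogonalReflection Q v * orthogonalReflection Q w ∈ siegelSubgroup Q := by
  obtain ⟨c, hc, hcv⟩ := exists_normalize hv
  obtain ⟨d, hd, hdw⟩ := exists_normalize hw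
  rw [← orthogonalReflection_smul hc v, ← orthogonalReflection_smul hd w]
  obtain ⟨z, hvz, hwz, hz⟩ := exists_orthogonal_pair_nonsingular hQ hn hG h2 (c • v) (d • w)
  obtain ⟨b, hb, hbz⟩ := exists_normalize hz
  have h := mul_mem
    (orthogonalReflection_mul_mem_of_polar_eq_zero hcv hbz
      (by rw [polar_smul_right, hvz, smul_zero]))
    (orthogonalReflection_mul_mem_of_polar_eq_zero hbz hdw
      (by rw [polar_smul_left, polar_comm, hwz, smul_zero]))
  rwa [mul_assoc, ← mul_assoc (orthogonalReflection Q (b • z)), orthogonalReflection_mul_self,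
    one_mul] at h

/-- The group generated by the Siegel transformations has index at most two. -/
theorem exists_mem_or_mul_mem_siegelSubgroup (hQ : PolarSeparating Q) {n : ℕ}
    (hn : Module.finrank K V = 2 * n) (hG : gaussSumForm Q < 0) (h2 : 2 ≤ n) :
    ∃ r : generalOrthogonalGroup Q, ∀ g, g ∈ siegelSubgroup Q ∨ g * r ∈ siegelSubgroup Q := by
  have : Nontrivial V := Module.nontrivial_of_finrank_pos (R := K) (by omega)
  obtain ⟨z, hz⟩ := hQ.exists_ne_zero
  refine ⟨orthogonalReflection Q z, fun g => ?_⟩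
  have hg : g ∈ reflectionSubgroup Q := by rw [reflectionSubgroup_eq_top n hQ hn hG]; trivial
  rw [reflectionSubgroup] at hg
  have key : ∀ (v : V), Q v ≠ 0 → ∀ g, (g ∈ siegelSubgroup Q ∨
      g * orthogonalReflection Q z ∈ siegelSubgroup Q) →
      (orthogonalReflection Q v * g ∈ siegelSubgroup Q ∨
        orthogonalReflection Q v * g * orthogonalReflection Q z ∈ siegelSubgroup Q) := by
    rintro v hv g (hg | hg)
    · right
      have h1 := (siegelSubgroup_normal (Q := Q)).conj_mem g hg (orthogonalReflection Q v)
      have h3 := mul_mem h1 (orthogonalReflection_mul_mem hQ hn hG h2 hv hz)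
      simpa [mul_assoc] using h3
    · left
      have h1 := (siegelSubgroup_normal (Q := Q)).conj_mem _ hg (orthogonalReflection Q v)
      have h3 := mul_mem h1 (orthogonalReflection_mul_mem hQ hn hG h2 hv hz)
      have h4 := orthogonalReflection_mul_self Q z
      have h5 := orthogonalReflection_mul_self Q v
      have h6 : orthogonalReflection Q v * (g * orthogonalReflection Q z) *
          (orthogonalReflection Q v)⁻¹ * (orthogonalReflection Q v * orthogonalReflection Q z) =
          orthogonalReflection Q v * g := by
        calc _ = orthogonalReflection Q v * g *
              (orthogonalReflection Q z * orthogonalReflection Q z) := by group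
          _ = _ := by rw [h4, mul_one]
      rwa [h6] at h3
  induction hg using Subgroup.closure_induction_left with
  | one => exact Or.inl (one_mem _)
  | mul_left x hx y _ ih =>
    obtain ⟨v, hv, rfl⟩ := hx
    exact key v hv y ih
  | inv_mul_cancel x hx y _ ih =>
    obtain ⟨v, hv, rfl⟩ := hx
    rw [inv_eq_of_mul_eq_one_left (orthogonalReflection_mul_self Q v)]
    exact key v hv y ih

/-- The quotient by the Siegel group has at most two elements, hence is abelian; conversely the
Siegel group is perfect. -/
theorem omegaGroup_eq_siegelSubgroup (hQ : PolarSeparating Q) {n : ℕ}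
    (hn : Module.finrank K V = 2 * n) (hG : gaussSumForm Q < 0) (h3 : 3 ≤ n) :
    omegaGroup Q = siegelSubgroup Q := by
  apply le_antisymm
  · obtain ⟨r, hr⟩ := exists_mem_or_mul_mem_siegelSubgroup hQ hn hG (by omega)
    apply Subgroup.Normal.quotient_commutative_iff_commutator_le.1
    have key : ∀ q : generalOrthogonalGroup Q ⧸ siegelSubgroup Q,
        q = 1 ∨ q = (QuotientGroup.mk r)⁻¹ := by
      intro q
      obtain ⟨g, rfl⟩ := QuotientGroup.mk_surjective q
      refine (hr g).imp (QuotientGroup.eq_one_iff g).2 fun h => ?_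
      rw [eq_inv_iff_mul_eq_one, ← QuotientGroup.mk_mul]
      exact (QuotientGroup.eq_one_iff _).2 h
    refine ⟨⟨fun a b => ?_⟩⟩
    rcases key a with rfl | rfl <;> rcases key b with rfl | rfl <;> simp
  · exact (siegelSubgroup_le_commutator hQ hn h3).trans
      (Subgroup.commutator_mono le_top le_top)

end Perfect

end SiegelSubgroup

/-! ### Simplicity by Iwasawa's argument -/

section Simplicity

variable {K : Type*} [Field K] [Finite K] [CharP K 2] {V : Type*} [AddCommGroup V] [Module K V]
  [FiniteDimensional K V] {Q : QuadraticForm K V}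

/-- The reflection in x + y exchanges nonorthogonal singular x and y; a further reflection fixing y
brings the product into the Siegel group. Orthogonal pairs are joined through a third singular
vector. -/
theorem exists_mem_siegelSubgroup_map (hQ : PolarSeparating Q) {n : ℕ}
    (hn : Module.finrank K V = 2 * n) (hG : gaussSumForm Q < 0) (h2 : 2 ≤ n) {x y : V}
    (hx : x ≠ 0) (hy : y ≠ 0) (hqx : Q x = 0) (hqy : Q y = 0) :
    ∃ g ∈ siegelSubgroup Q, g.1 x = y := by
  have key : ∀ {x y : V}, Q x = 0 → Q y = 0 → polar Q x y ≠ 0 →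
      ∃ g ∈ siegelSubgroup Q, g.1 x = y := by
    intro x y hqx hqy hxy
    obtain ⟨w, hyw, hw⟩ := exists_orthogonal_nonsingular hQ hn hG (by omega) y
    obtain ⟨h1, h3⟩ := exists_reflection_map hqx hqy hxy
    refine ⟨_, orthogonalReflection_mul_mem hQ hn hG h2 hw h1, ?_⟩
    change (orthogonalReflection Q w).1 ((orthogonalReflection Q (x + y)).1 x) = y
    rw [h3, orthogonalReflection_apply_of_polar_eq_zero (by rw [polar_comm, hyw])]
  by_cases hxy : polar Q x y = 0
  · obtain ⟨z, hz, hqz, hxz, hyz⟩ := exists_singular_polar_ne_zero hQ hx hy hqx hqy hxy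
    obtain ⟨g, hg, hgx⟩ := key hqx hqz hxz
    obtain ⟨h, hh, hhz⟩ := key hqz hqy (by rwa [polar_comm])
    refine ⟨h * g, mul_mem hh hg, ?_⟩
    change h.1 (g.1 x) = y
    rw [hgx, hhz]
  · exact key hqx hqy hxy

/-- The stabilizer of the singular vector `v` moves any other orthogonal singular point to a
nonorthogonal one. -/
theorem exists_mem_siegelSubgroup_fixing (hQ : PolarSeparating Q) {n : ℕ}
    (hn : Module.finrank K V = 2 * n) (hG : gaussSumForm Q < 0) (h2 : 2 ≤ n) {u v : V}
    (hv : v ≠ 0) (hqu : Q u = 0) (hqv : Q v = 0) (huv : polar Q v u = 0)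
    (hli : ∀ c : K, u ≠ c • v) :
    ∃ g ∈ siegelSubgroup Q, g.1 v = v ∧ polar Q u (g.1 u) ≠ 0 := by
  obtain ⟨f, -, hvf⟩ := exists_hyperbolic_partner hQ hv hqv
  have hvv : polar Q v v = 0 := polar_self_eq_zero Q v
  have huu : polar Q u u = 0 := polar_self_eq_zero Q u
  have huv' : polar Q u v = 0 := by rw [polar_comm, huv]
  have hfv : polar Q f v = 1 := by rw [polar_comm, hvf]
  have hw : u - polar Q f u • v ≠ 0 := sub_ne_zero.2 (hli _)
  obtain ⟨y, hy⟩ := hQ.exists_polar_eq_one hw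
  rw [sub_eq_add_neg, ← neg_smul, polar_add_left, polar_smul_left, smul_eq_mul] at hy
  obtain ⟨s, hs⟩ : ∃ s, polar Q f u = s := ⟨_, rfl⟩
  obtain ⟨t, ht⟩ : ∃ t, polar Q v y = t := ⟨_, rfl⟩
  obtain ⟨y', hvy', huy'⟩ : ∃ y', polar Q v y' = 0 ∧ polar Q u y' = 1 := by
    refine ⟨y - t • f, ?_, ?_⟩
    · rw [sub_eq_add_neg, ← neg_smul, polar_add_right, polar_smul_right, ht, hvf, smul_eq_mul]
      ring
    · rw [sub_eq_add_neg, ← neg_smul, polar_add_right, polar_smul_right, polar_comm Q u f, hs,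
        smul_eq_mul]
      rw [hs, ht] at hy
      linear_combination hy
  obtain ⟨z, hqz, huz, hvz⟩ : ∃ z, Q z = 0 ∧ polar Q u z = 1 ∧ polar Q v z = 0 := by
    refine ⟨y' + Q y' • u, ?_, ?_, ?_⟩
    · rw [form_add, QuadraticMap.map_smul, polar_smul_right, hqu, polar_comm, huy']
      simp [CharTwo.add_self_eq_zero]
    · rw [polar_add_right, polar_smul_right, huy', huu, smul_zero, add_zero]
    · rw [polar_add_right, polar_smul_right, hvy', huv, smul_zero, add_zero]
  -- Since z and a are orthogonal to v, the Siegel transformation of z and a fixes v, and it moves u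
  -- to a vector whose product with u is Q(a) ≠ 0.
  obtain ⟨a, hza, hva, ha⟩ := exists_orthogonal_pair_nonsingular hQ hn hG h2 z v
  refine ⟨_, siegel_mem hqz hza, ?_, ?_⟩
  · rw [siegel_apply_of_polar_eq_zero _ _ (by rw [polar_comm, hvz]), polar_comm, hva, zero_smul,
      add_zero]
  · rw [siegel_apply, polar_comm Q z u, huz, polar_add_right, polar_add_right, polar_add_right,
      polar_smul_right, polar_smul_right, polar_smul_right, huu, huz, polar_comm Q a u]
    simpa [CharTwo.add_self_eq_zero] using ha

/-- Primitivity of the action on singular points: an invariant equivalence relation relating two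
different points relates all points. -/
theorem forall_related_of_related (hQ : PolarSeparating Q) {n : ℕ}
    (hn : Module.finrank K V = 2 * n) (hG : gaussSumForm Q < 0) (h2 : 2 ≤ n) {r : V → V → Prop}
    (hsmul : ∀ (c : K) x, c ≠ 0 → r x (c • x)) (hsymm : ∀ x y, r x y → r y x)
    (htrans : ∀ x y z, r x y → r y z → r x z)
    (hinv : ∀ g ∈ siegelSubgroup Q, ∀ x y, r x y → r (g.1 x) (g.1 y)) {x y : V} (hx : x ≠ 0)
    (hqx : Q x = 0) (hqy : Q y = 0) (hxy : ∀ c : K, y ≠ c • x) (hr : r x y)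
    {u v : V} (hu : u ≠ 0) (hv : v ≠ 0) (hqu : Q u = 0) (hqv : Q v = 0) : r u v := by
  have nonorth : ∀ {x y : V}, Q x = 0 → Q y = 0 → polar Q x y ≠ 0 → r x y →
      ∀ {u v : V}, u ≠ 0 → v ≠ 0 → Q u = 0 → Q v = 0 → r u v := by
    intro x y hqx hqy hxy hr
    have hx : x ≠ 0 := by rintro rfl; simp at hxy
    -- The group acts transitively on nonorthogonal pairs of singular points: x is first carried to
    -- u, and a Siegel transformation centred at u then carries the image of y to a multiple of v.
    have h1 : ∀ {u v : V}, Q u = 0 → Q v = 0 → polar Q u v ≠ 0 → r u v := by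
      intro u v hqu hqv huv
      have hu : u ≠ 0 := by rintro rfl; simp at huv
      obtain ⟨g, hg, hgx⟩ := exists_mem_siegelSubgroup_map hQ hn hG h2 hx hu hqx hqu
      have h3 := hinv g hg x y hr
      rw [← polar_generalOrthogonalGroup g, hgx] at hxy
      rw [hgx] at h3
      obtain ⟨z, hz⟩ : ∃ z, z = g.1 y := ⟨_, rfl⟩
      have hqz : Q z = 0 := by rw [hz, g.2, hqy]
      rw [← hz] at h3 hxy
      have h4 : polar Q u ((polar Q u z)⁻¹ • z) = 1 := by
        rw [polar_smul_right, smul_eq_mul, inv_mul_cancel₀ hxy]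
      have h5 : polar Q u ((polar Q u v)⁻¹ • v) = 1 := by
        rw [polar_smul_right, smul_eq_mul, inv_mul_cancel₀ huv]
      have h6 : polar Q u ((polar Q u z)⁻¹ • z + (polar Q u v)⁻¹ • v) = 0 := by
        rw [polar_add_right, h4, h5, CharTwo.add_self_eq_zero]
      have h7 := siegel_apply_eq (v := (polar Q u z)⁻¹ • z) (w := (polar Q u v)⁻¹ • v) hqu
        (by rw [QuadraticMap.map_smul, hqz, smul_zero])
        (by rw [QuadraticMap.map_smul, hqv, smul_zero]) h4 h6
      have h8 : (siegel hqu h6).1 u = (1 + polar Q u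
          ((polar Q u z)⁻¹ • z + (polar Q u v)⁻¹ • v)) • u := by
        rw [siegel_apply_of_polar_eq_zero _ _ (polar_self_eq_zero Q u), polar_comm, add_smul,
          one_smul]
      rw [h6, add_zero, one_smul] at h8
      have h9 := hinv _ (siegel_mem hqu h6) _ _ (htrans _ _ _ h3 (hsmul _ z (inv_ne_zero hxy)))
      rw [h7, h8] at h9
      exact htrans _ _ _ h9 (hsymm _ _ (hsmul _ v (inv_ne_zero huv)))
    intro u v hu hv hqu hqv
    by_cases huv : polar Q u v = 0
    · obtain ⟨z, hz, hqz, huz, hvz⟩ := exists_singular_polar_ne_zero hQ hu hv hqu hqv huv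
      exact htrans _ _ _ (h1 hqu hqz huz) (h1 hqz hqv (by rwa [polar_comm]))
    · exact h1 hqu hqv huv
  by_cases h : polar Q x y = 0
  · obtain ⟨g, hg, hgx, hgy⟩ := exists_mem_siegelSubgroup_fixing hQ hn hG h2 hx hqy hqx h hxy
    have h3 := hinv g hg x y hr
    rw [hgx] at h3
    exact nonorth hqy (by rw [g.2, hqy]) hgy (htrans _ _ _ (hsymm _ _ hr) h3) hu hv hqu hqv
  · exact nonorth hqx hqy h hr hu hv hqu hqv

/-- The orthogonal group acts faithfully on singular points. -/
theorem eq_one_of_forall_singular (hQ : PolarSeparating Q) {n : ℕ}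
    (hn : Module.finrank K V = 2 * n) (h2 : 2 ≤ n)
    {h : generalOrthogonalGroup Q} (hh : ∀ x, Q x = 0 → ∃ c : K, h.1 x = c • x) : h = 1 := by
  obtain ⟨e, f, he, hf, hef⟩ := exists_hyperbolic_pair hQ hn (Or.inl h2)
  obtain ⟨c, hc⟩ := hh e he
  obtain ⟨d, hd⟩ := hh f hf
  have hfe : polar Q f e = 1 := by rw [polar_comm, hef]
  have hee : polar Q e e = 0 := polar_self_eq_zero Q e
  have hff : polar Q f f = 0 := polar_self_eq_zero Q f
  have hcd : c * d = 1 := by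
    have := polar_generalOrthogonalGroup h e f
    rwa [hc, hd, polar_smul_left, polar_smul_right, hef, smul_eq_mul, smul_eq_mul, mul_one] at this
  have hc0 : c ≠ 0 := left_ne_zero_of_mul_eq_one hcd
  have hd0 : d ≠ 0 := right_ne_zero_of_mul_eq_one hcd
  have hmap : ∀ w ∈ pairOrthogonal Q e f, polar Q e (h.1 w) = 0 ∧ polar Q f (h.1 w) = 0 := by
    intro w hw
    rw [mem_pairOrthogonal] at hw
    have h1 := polar_generalOrthogonalGroup h e w
    have h3 := polar_generalOrthogonalGroup h f w
    rw [hc, polar_smul_left, hw.1, smul_eq_mul] at h1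
    rw [hd, polar_smul_left, hw.2, smul_eq_mul] at h3
    exact ⟨(mul_eq_zero.1 h1).resolve_left hc0, (mul_eq_zero.1 h3).resolve_left hd0⟩
  have key : ∀ w ∈ pairOrthogonal Q e f, h.1 w = c • w ∧ Q w * d = c * Q w := by
    intro w hw
    obtain ⟨h3, h4⟩ := hmap w hw
    rw [mem_pairOrthogonal] at hw
    -- This vector is singular. Comparing the coefficients of its image forces the scalar l to be c
    -- and then h(w) = cw.
    obtain ⟨l, hl⟩ := hh (w + (e + Q w • f)) (by
      simp only [form_add, polar_add_right, polar_smul_right, QuadraticMap.map_smul, he, hf, hef,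
        polar_comm Q w e, polar_comm Q w f, hw.1, hw.2, smul_eq_mul]
      linear_combination Q w * CharTwo.two_eq_zero (R := K))
    rw [map_add, map_add, map_smul, hc, hd] at hl
    have h5 := congrArg (polar Q f) hl
    have h6 := congrArg (polar Q e) hl
    simp only [polar_add_right, polar_smul_right, h3, h4, hw.1, hw.2, hef, hfe, hee, hff,
      smul_eq_mul, mul_zero, mul_one, zero_add, add_zero] at h5 h6
    subst h5
    refine ⟨?_, h6⟩
    rw [mul_comm] at h6
    linear_combination (norm := module) hl - h6 • f
  have hW := polarSeparating_pairOrthogonal hQ hef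
  have hWn := finrank_pairOrthogonal Q hef
  have : Nontrivial (pairOrthogonal Q e f) := Module.nontrivial_of_finrank_pos (R := K) (by omega)
  obtain ⟨w, hw⟩ := hW.exists_ne_zero
  have hw' : Q (w : V) ≠ 0 := hw
  have hdc : d = c := mul_left_cancel₀ hw' (by rw [(key w w.2).2, mul_comm])
  have hc1 : c = 1 := by
    rw [hdc, ← pow_two] at hcd
    exact CharTwo.sq_injective (show c ^ 2 = 1 ^ 2 by rw [hcd, one_pow])
  subst hc1
  refine generalOrthogonalGroup_ext_pair hef ?_ ?_ fun w hw => ?_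
  · rw [hc, one_smul]; rfl
  · rw [hd, hdc, one_smul]; rfl
  · rw [(key w hw).1, one_smul]; rfl

theorem siegelSubgroup_nontrivial (hQ : PolarSeparating Q) {n : ℕ}
    (hn : Module.finrank K V = 2 * n) (hG : gaussSumForm Q < 0) (h2 : 2 ≤ n) :
    Nontrivial (siegelSubgroup Q) := by
  obtain ⟨e, f, he, hf, hef⟩ := exists_hyperbolic_pair hQ hn (Or.inl h2)
  obtain ⟨a, hea, hfa, ha⟩ := exists_orthogonal_pair_nonsingular hQ hn hG h2 e f
  refine ⟨⟨⟨_, siegel_mem he hea⟩, 1, fun h => ?_⟩⟩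
  have h1 : (siegel he hea).1 f = f := by
    have h0 : siegel he hea = 1 := congrArg Subtype.val h
    rw [h0]; rfl
  have h3 := congrArg (fun x => polar Q f x) h1
  simp only [siegel_apply, polar_add_right, polar_smul_right, polar_self_eq_zero, hfa, hef,
    polar_comm Q f e, polar_comm Q a f] at h3
  simp [ha] at h3

/-- A normal subgroup of the Siegel group that moves a singular point is transitive on singular
points. -/
theorem exists_mem_normal_map (hQ : PolarSeparating Q) {n : ℕ}
    (hn : Module.finrank K V = 2 * n) (hG : gaussSumForm Q < 0) (h2 : 2 ≤ n)
    {N : Subgroup (siegelSubgroup Q)} (hN : N.Normal) {h : siegelSubgroup Q} (hhN : h ∈ N) {x : V}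
    (hx : x ≠ 0) (hqx : Q x = 0) (hhx : ∀ c : K, h.1.1 x ≠ c • x) {u v : V} (hu : u ≠ 0)
    (hv : v ≠ 0) (hqu : Q u = 0) (hqv : Q v = 0) :
    ∃ g ∈ N, ∃ c : K, c ≠ 0 ∧ g.1.1 u = c • v := by
  refine forall_related_of_related (Q := Q)
    (r := fun u v => ∃ g ∈ N, ∃ c : K, c ≠ 0 ∧ g.1.1 u = c • v) hQ hn hG h2
    ?_ ?_ ?_ ?_ hx hqx (y := h.1.1 x) ?_ hhx ?_ hu hv hqu hqv
  · intro c x hc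
    exact ⟨1, one_mem _, c⁻¹, inv_ne_zero hc, by rw [inv_smul_smul₀ hc]; rfl⟩
  · rintro x y ⟨g, hg, c, hc, hgx⟩
    refine ⟨g⁻¹, inv_mem hg, c⁻¹, inv_ne_zero hc, ?_⟩
    change g.1.1.symm y = _
    rw [LinearEquiv.symm_apply_eq, map_smul, hgx, inv_smul_smul₀ hc]
  · rintro x y z ⟨g, hg, c, hc, hgx⟩ ⟨g', hg', c', hc', hgx'⟩
    refine ⟨g' * g, mul_mem hg' hg, c * c', mul_ne_zero hc hc', ?_⟩
    change g'.1.1 (g.1.1 x) = _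
    rw [hgx, map_smul, hgx', smul_smul]
  · rintro k hk x y ⟨g, hg, c, hc, hgx⟩
    obtain ⟨l, rfl⟩ : ∃ l : siegelSubgroup Q, l.1 = k := ⟨⟨k, hk⟩, rfl⟩
    refine ⟨l * g * l⁻¹, hN.conj_mem g hg l, c, hc, ?_⟩
    change l.1.1 (g.1.1 (l.1.1.symm (l.1.1 x))) = _
    rw [LinearEquiv.symm_apply_apply, hgx, map_smul]
  · rw [h.1.2, hqx]
  · exact ⟨h, hhN, 1, one_ne_zero, by rw [one_smul]⟩

/-- A nontrivial normal subgroup N moves some singular point x, so by primitivity it is transitive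
on singular points. Conjugates under N of the abelian group T of Siegel transformations centred at x
therefore give all of them, so N and T generate everything; the quotient by N is abelian, and
perfectness gives N = ⊤. -/
theorem isSimpleGroup_siegelSubgroup (hQ : PolarSeparating Q) {n : ℕ}
    (hn : Module.finrank K V = 2 * n) (hG : gaussSumForm Q < 0) (h3 : 3 ≤ n) :
    IsSimpleGroup (siegelSubgroup Q) := by
  have := siegelSubgroup_nontrivial hQ hn hG (by omega)
  refine IsSimpleGroup.mk fun N hN => ?_
  by_cases hN1 : ∀ h ∈ N, ∀ x, Q x = 0 → ∃ c : K, h.1.1 x = c • x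
  · left
    rw [Subgroup.eq_bot_iff_forall]
    exact fun h hh => Subtype.ext (eq_one_of_forall_singular hQ hn (by omega) (hN1 h hh))
  right
  push Not at hN1
  obtain ⟨h, hhN, x, hqx, hhx⟩ := hN1
  have hx : x ≠ 0 := by rintro rfl; simpa using hhx 1
  let T : Subgroup (siegelSubgroup Q) :=
    { carrier := {g | ∃ (a : V) (ha : polar Q x a = 0), g.1 = siegel hqx ha}
      mul_mem' := by
        rintro a b ⟨s, hs, hs'⟩ ⟨t, ht, ht'⟩
        exact ⟨s + t, polar_add_eq_zero hs ht, by
          rw [Subgroup.coe_mul, hs', ht', siegel_mul_siegel]⟩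
      one_mem' := ⟨0, by simp, by rw [siegel_zero_right]; rfl⟩
      inv_mem' := by
        rintro a ⟨s, hs, hs'⟩
        exact ⟨s, hs, by rw [Subgroup.coe_inv, hs', siegel_inv]⟩ }
  have hT : IsMulCommutative T := by
    refine ⟨⟨?_⟩⟩
    rintro ⟨a, s, hs, hs'⟩ ⟨b, t, ht, ht'⟩
    refine Subtype.ext (Subtype.ext ?_)
    change a.1 * b.1 = b.1 * a.1
    rw [hs', ht', siegel_comm]
  have hsup : N ⊔ T = ⊤ := by
    have h4 : siegelSubgroup Q ≤ (N ⊔ T).map (siegelSubgroup Q).subtype := by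
      conv_lhs => rw [siegelSubgroup]
      rw [Subgroup.closure_le]
      rintro _ ⟨u, a, hu, ha, rfl⟩
      by_cases hu0 : u = 0
      · subst hu0
        rw [siegel_zero_left]
        exact one_mem _
      obtain ⟨g, hg, c, hc, hgx⟩ := exists_mem_normal_map hQ hn hG (by omega) hN hhN hx hqx hhx
        hx hu0 hqx hu
      have h5 : polar Q x (g.1.1.symm (c⁻¹ • a)) = 0 := by
        rw [← polar_generalOrthogonalGroup g.1, LinearEquiv.apply_symm_apply, hgx,
          polar_smul_left, polar_smul_right, ha, smul_zero, smul_zero]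
      refine ⟨g * ⟨siegel hqx h5, siegel_mem _ _⟩ * g⁻¹, ?_, ?_⟩
      · exact mul_mem (mul_mem (Subgroup.mem_sup_left hg)
          (Subgroup.mem_sup_right ⟨_, h5, rfl⟩)) (inv_mem (Subgroup.mem_sup_left hg))
      · change g.1 * siegel hqx h5 * g.1⁻¹ = siegel hu ha
        rw [siegel_conj]
        simp only [LinearEquiv.apply_symm_apply, hgx]
        rw [siegel_smul_left c hu _ _ (by rw [smul_inv_smul₀ hc, ha])]
        congr 1
        exact smul_inv_smul₀ hc a
    rw [eq_top_iff]
    intro g _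
    obtain ⟨k, hk, hkg⟩ := h4 g.2
    rwa [← Subtype.ext (a1 := k) (a2 := g) hkg]
  have h6 := hN.commutator_le_of_self_sup_commutative_eq_top hsup hT
  rw [eq_top_iff]
  refine le_trans ?_ h6
  intro g _
  have h7 := siegelSubgroup_le_commutator hQ hn h3 g.2
  rw [← Subgroup.map_subtype_commutator] at h7
  obtain ⟨k, hk, hkg⟩ := h7
  rwa [← Subtype.ext (a1 := k) (a2 := g) hkg]

theorem isSimpleGroup_omegaGroup (hQ : PolarSeparating Q) {n : ℕ}
    (hn : Module.finrank K V = 2 * n) (hG : gaussSumForm Q < 0) (h3 : 3 ≤ n) :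
    IsSimpleGroup (omegaGroup Q) := by
  rw [omegaGroup_eq_siegelSubgroup hQ hn hG h3]
  exact isSimpleGroup_siegelSubgroup hQ hn hG h3

theorem not_commutative_omegaGroup (hQ : PolarSeparating Q) {n : ℕ}
    (hn : Module.finrank K V = 2 * n) (hG : gaussSumForm Q < 0) (h3 : 3 ≤ n) :
    ¬ ∀ a b : omegaGroup Q, a * b = b * a := by
  rw [omegaGroup_eq_siegelSubgroup hQ hn hG h3]
  intro h
  have h1 : ⁅siegelSubgroup Q, siegelSubgroup Q⁆ = ⊥ := by
    rw [Subgroup.commutator_eq_bot_iff_le_centralizer]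
    intro a ha
    rw [Subgroup.mem_centralizer_iff]
    intro b hb
    exact congrArg Subtype.val (h ⟨b, hb⟩ ⟨a, ha⟩)
  have h4 := siegelSubgroup_le_commutator hQ hn h3
  rw [h1, le_bot_iff] at h4
  have h5 := siegelSubgroup_nontrivial hQ hn hG (by omega)
  rw [h4] at h5
  exact not_subsingleton _ (inferInstance : Subsingleton (⊥ : Subgroup (generalOrthogonalGroup Q)))

end Simplicity

/-! ### Composition factors and conclusion -/

section CompositionFactors

theorem isSimpleGroup_of_forall_eq {G : Type*} [Group G] [Nontrivial G] {r : G}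
    (h : ∀ g : G, g = 1 ∨ g = r) : IsSimpleGroup G := by
  refine IsSimpleGroup.mk fun H _ => ?_
  by_cases hr : r ∈ H
  · right
    rw [eq_top_iff]
    rintro g -
    rcases h g with rfl | rfl
    · exact one_mem H
    · exact hr
  · left
    rw [Subgroup.eq_bot_iff_forall]
    intro g hg
    exact (h g).resolve_right fun hgr => hr (hgr ▸ hg)

theorem mul_comm_of_forall_eq {G : Type*} [Group G] {r : G} (h : ∀ g : G, g = 1 ∨ g = r)
    (a b : G) : a * b = b * a := by
  rcases h a with rfl | rfl <;> rcases h b with rfl | rfl <;> simp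

/-- The bottom factor of a composition series. -/
def quotientBotSubgroupOf {G : Type*} [Group G] (N : Subgroup G)
    [((⊥ : Subgroup G).subgroupOf N).Normal] : ↥N ⧸ (⊥ : Subgroup G).subgroupOf N ≃* N :=
  (QuotientGroup.quotientMulEquivOfEq (Subgroup.bot_subgroupOf N)).trans
    QuotientGroup.quotientBot

/-- The quotient by N has at most two elements. Whether it is trivial need not be known: the
composition series has one or two steps accordingly. -/
theorem hasOnlyNonabelianFactor_of_simple {G : Type*} [Group G] {N : Subgroup G}
    [hN : N.Normal] (hs : IsSimpleGroup N) (hab : ¬ ∀ a b : N, a * b = b * a) {r : G}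
    (hr : ∀ g, g ∈ N ∨ g * r ∈ N) : HasOnlyNonabelianFactor G N := by
  have hbot : ((⊥ : Subgroup G).subgroupOf N).Normal := inferInstance
  have hsimple : IsSimpleGroup (↥N ⧸ (⊥ : Subgroup G).subgroupOf N) := by
    have := hs
    have := (quotientBotSubgroupOf N).nontrivial
    exact IsSimpleGroup.isSimpleGroup_of_surjective (quotientBotSubgroupOf N).symm.toMonoidHom
      (quotientBotSubgroupOf N).symm.surjective
  have hab' : ¬ ∀ a b : ↥N ⧸ (⊥ : Subgroup G).subgroupOf N, a * b = b * a := fun h =>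
    hab fun a b => by
      apply (quotientBotSubgroupOf N).symm.injective
      rw [map_mul, map_mul, h]
  by_cases htop : N = ⊤
  · let s : GroupCompSeries G :=
      { length := 1
        term := ![⊥, N]
        bot_eq := rfl
        top_eq := htop
        le_succ := fun i => by
          fin_cases i
          exact bot_le
        normal := fun i => by
          fin_cases i
          exact hbot
        simple := fun i => by
          fin_cases i
          exact hsimple }
    refine ⟨s, (0 : Fin 1), ⟨quotientBotSubgroupOf N⟩, hab', fun j hj => ?_⟩
    exact (hj (Subsingleton.elim (α := Fin 1) j 0)).elim
  · have hnt : (N.subgroupOf ⊤).Normal := inferInstance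
    have key : ∀ q : ↥(⊤ : Subgroup G) ⧸ N.subgroupOf ⊤,
        q = 1 ∨ q = (QuotientGroup.mk ⟨r, trivial⟩)⁻¹ := by
      intro q
      obtain ⟨g, rfl⟩ := QuotientGroup.mk_surjective q
      refine (hr g).imp (fun h => (QuotientGroup.eq_one_iff g).2 h) fun h => ?_
      rw [eq_inv_iff_mul_eq_one, ← QuotientGroup.mk_mul]
      exact (QuotientGroup.eq_one_iff _).2 h
    have hntr : Nontrivial (↥(⊤ : Subgroup G) ⧸ N.subgroupOf ⊤) := by
      rw [QuotientGroup.nontrivial_iff, Ne, Subgroup.subgroupOf_eq_top]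
      exact fun h => htop (top_le_iff.1 h)
    have hsimple' : IsSimpleGroup (↥(⊤ : Subgroup G) ⧸ N.subgroupOf ⊤) :=
      isSimpleGroup_of_forall_eq key
    let s : GroupCompSeries G :=
      { length := 2
        term := ![⊥, N, ⊤]
        bot_eq := rfl
        top_eq := rfl
        le_succ := fun i => by
          fin_cases i
          · exact bot_le
          · exact le_top
        normal := fun i => by
          fin_cases i
          · exact hbot
          · exact hnt
        simple := fun i => by
          fin_cases i
          · exact hsimple
          · exact hsimple' }
    refine ⟨s, (0 : Fin 2), ⟨quotientBotSubgroupOf N⟩, hab', fun j hj => ?_⟩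
    have hj0 : (j : ℕ) ≠ 0 := fun h => hj (Fin.ext h)
    have hj2 : (j : ℕ) < 2 := j.isLt
    obtain rfl : j = (⟨1, one_lt_two⟩ : Fin s.length) := Fin.ext (show (j : ℕ) = 1 by omega)
    have hcomm := mul_comm_of_forall_eq key
    exact hcomm

theorem IsMinusType.hasOnlyNonabelianFactor {K : Type*} [Field K] [Finite K] [CharP K 2]
    {V : Type*} [AddCommGroup V] [Module K V] {Q : QuadraticForm K V} {n : ℕ}
    (hQ : IsMinusType n Q) (h3 : 3 ≤ n) :
    HasOnlyNonabelianFactor ↥(generalOrthogonalGroup Q) ↥(omegaGroup Q) := by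
  have hfin : FiniteDimensional K V :=
    Module.finite_of_finrank_pos (by rw [hQ.finrank_eq]; omega)
  have hsep := (polarSeparating_iff_nondegenerate Q).2 hQ.nondegenerate
  have hG : gaussSumForm Q < 0 := by
    rw [hQ.gaussSumForm_eq, neg_lt_zero]
    exact pow_pos (by exact_mod_cast Nat.card_pos) n
  obtain ⟨r, hr⟩ := exists_mem_or_mul_mem_siegelSubgroup hsep hQ.finrank_eq hG (by omega)
  rw [← omegaGroup_eq_siegelSubgroup hsep hQ.finrank_eq hG h3] at hr
  exact hasOnlyNonabelianFactor_of_simple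
    (isSimpleGroup_omegaGroup hsep hQ.finrank_eq hG h3)
    (not_commutative_omegaGroup hsep hQ.finrank_eq hG h3) hr

end CompositionFactors

theorem finite_generalOrthogonalGroup {K : Type*} [Field K] {V : Type*} [AddCommGroup V]
    [Module K V] [Finite V] (Q : QuadraticForm K V) : Finite (generalOrthogonalGroup Q) :=
  have : Finite (V ≃ₗ[K] V) := DFunLike.finite _
  inferInstance

theorem proposition4p1 (K : Type u) [Field K] [Finite K] (hq : Even (Nat.card K)) :
    (∀ (V : Type v) [AddCommGroup V] [Module K V] (Q : QuadraticForm K V), IsMinusType 4 Q →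
      elementOrders ↥(Matrix.symplecticGroup (Fin 4) K) =
          elementOrders ↥(generalOrthogonalGroup Q) ∧
        HasOnlyNonabelianFactor ↥(generalOrthogonalGroup Q) ↥(omegaGroup Q)) ∧
      ¬ QuasirecognizableBySpectrum ↥(Matrix.symplecticGroup (Fin 4) K) := by
  cases nonempty_fintype K
  have hchar : ringChar K = 2 :=
    FiniteField.even_card_iff_char_two.2 (Nat.even_iff.1 (by rwa [← Nat.card_eq_fintype_card]))
  have : CharP K 2 := hchar ▸ ringChar.charP K
  refine ⟨fun V _ _ Q hQ => ⟨?_, hQ.hasOnlyNonabelianFactor (by norm_num)⟩, fun h => ?_⟩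
  · have : FiniteDimensional K V :=
      Module.finite_of_finrank_pos (by rw [hQ.finrank_eq]; norm_num)
    exact (elementOrders_symplecticGroup_subset hQ).antisymm
      (elementOrders_subset_symplecticGroup hQ)
  -- The model form on K-valued functions is used because its isometry group lives in the universe
  -- of K, as the definition of quasirecognizability requires.
  · obtain ⟨c, hc⟩ := exists_artinSchreierChar_eq_neg_one (K := K)
    have := finite_generalOrthogonalGroup (modelForm 3 c)
    have hQ := isMinusType_modelForm 3 hc
    exact not_hasOnlyNonabelianFactor_modelForm 2 c (h _
      ((elementOrders_subset_symplecticGroup hQ).antisymm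
        (elementOrders_symplecticGroup_subset hQ)))
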